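/- Let $\mathfrak g$ be a finite-dimensional simple complex Lie algebra. A bigrading of $\mathfrak g$ is a decomposition $\mathfrak g=\bigoplus_{a,b\in\mathbb Z}\mathfrak g_{a,b}$ into subspaces with $[\mathfrak g_{a,b},\mathfrak g_{c,d}]\subset\mathfrak g_{a+c,b+d}$; put $\mathfrak g_a=\bigoplus_b\mathfrak g_{a,b}$ and $\mathfrak g_-=\bigoplus_{a<0}\mathfrak g_a$. Call the bigrading admissible if 1. $\mathfrak g_0=\mathfrak g_{0,-1}\oplus\mathfrak g_{0,0}\oplus\mathfrak g_{0,1}$, $\ \mathfrak g_{-1}=\mathfrak g_{-1,-1}\oplus\mathfrak g_{-1,0}$, $\ \mathfrak g_{-2}=\mathfrak g_{-2,-1}$; 2. $\mathfrak g_-$ is generated as a Lie algebra by $\mathfrak g_{-1}$, and it is nondegenerate: if $x\in\mathfrak g_{-1}$ and $[x,\mathfrak g_{-1}]=0$, then $x=0$; 3. $\mathfrak k=\mathfrak g_{0,-1}\oplus\mathfrak g_{0,1}$ is not zero, and the representation map $\mathfrak k\to\mathfrak{gl}(\mathfrak g_{-1})$ is injective. For a Cartan subalgebra, a base of simple roots,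 and sets $\Sigma_1,\Sigma_2$ of simple roots, the bigrading determined by $(\Sigma_1,\Sigma_2)$ is the one in which $\mathfrak g_{a,b}$ is the sum of the root spaces of those roots (and of the Cartan subalgebra, for the weight $0$) in which the coefficients at the simple roots of $\Sigma_1$ add up to $a$ and those at the simple roots of $\Sigma_2$ add up to $b$. Then a family of subspaces of $\mathfrak g$ is an admissible bigrading if and only if it is the bigrading determined by a pair $(\Sigma_1,\Sigma_2)$ in the following table, for some choice of a Cartan subalgebra and of a base. Moreover, for every Cartan subalgebra, every base, and all sets $\Sigma_1,\Sigma_2$ of simple roots, the bigrading determined by $(\Sigma_1,\Sigma_2)$ is admissible if and only if $(\Sigma_1,\Sigma_2)$ is in the table. Here the simple roots are numbered as described below, and a numbering is free up to automorphisms of the Dynkin diagram. | $\mathfrak g$ | $(\Sigma_1;\Sigma_2)$ | |---|---| | $A_n=\mathfrak{sl}(n+1,\mathbb C)$ | $(\{\alpha_r,\alpha_s\};\{\alpha_t\})$, $1\le r<t<s\le n$ | | $B_n=\mathfrak{so}(2n+1,\mathbb C)$, $n\ge2$ | $(\{\alpha_r,\alpha_{r+2}\};\{\alpha_{r+1}\})$,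 $1\le r\le n-2$; $\ (\{\alpha_2\};\{\alpha_1\})$ | | $C_n=\mathfrak{sp}(2n,\mathbb C)$, $n\ge2$ | $(\{\alpha_r\};\{\alpha_n\})$, $1\le r<n$ | | $D_n=\mathfrak{so}(2n,\mathbb C)$, $n\ge4$ | $(\{\alpha_2\};\{\alpha_1\})$; $\ (\{\alpha_r\};\{\alpha_n\})$, $1<r<n-1$; $\ (\{\alpha_r,\alpha_{r+2}\};\{\alpha_{r+1}\})$, $1\le r<n-3$; $\ (\{\alpha_{n-3},\alpha_{n-1},\alpha_n\};\{\alpha_{n-2}\})$ | | $G_2$ | $(\{\alpha_1\};\{\alpha_2\})$ | | $F_4$ | $(\{\alpha_2\};\{\alpha_1\})$; $\ (\{\alpha_1,\alpha_3\};\{\alpha_2\})$ | | $E_6$ | $(\{\alpha_2\};\{\alpha_1\})$; $\ (\{\alpha_6\};\{\alpha_1\})$; $\ (\{\alpha_3\};\{\alpha_6\})$; $\ (\{\alpha_1,\alpha_3\};\{\alpha_2\})$; $\ (\{\alpha_2,\alpha_4,\alpha_6\};\{\alpha_3\})$ | | $E_7$ | $(\{\alpha_2\};\{\alpha_1\})$;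 $\ (\{\alpha_5\};\{\alpha_6\})$; $\ (\{\alpha_6\};\{\alpha_1\})$; $\ (\{\alpha_4\};\{\alpha_7\})$; $\ (\{\alpha_1,\alpha_3\};\{\alpha_2\})$; $\ (\{\alpha_2,\alpha_4\};\{\alpha_3\})$; $\ (\{\alpha_4,\alpha_6\};\{\alpha_5\})$; $\ (\{\alpha_3,\alpha_5,\alpha_7\};\{\alpha_4\})$ | | $E_8$ | $(\{\alpha_2\};\{\alpha_1\})$; $\ (\{\alpha_6\};\{\alpha_7\})$; $\ (\{\alpha_5\};\{\alpha_8\})$; $\ (\{\alpha_1,\alpha_3\};\{\alpha_2\})$; $\ (\{\alpha_2,\alpha_4\};\{\alpha_3\})$; $\ (\{\alpha_3,\alpha_5\};\{\alpha_4\})$; $\ (\{\alpha_5,\alpha_7\};\{\alpha_6\})$; $\ (\{\alpha_4,\alpha_6,\alpha_8\};\{\alpha_5\})$ | Numbering: the usual one along the Dynkin diagram for $A_n,B_n,C_n,D_n$ ($\alpha_n$ is the short simple root of $B_n$ and the long one of $C_n$; for $D_n$ the roots $\alpha_{n-1},\alpha_n$ are both joined to $\alpha_{n-2}$); $\alpha_1$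 is short and $\alpha_2$ is long in $G_2$; $F_4$ is the chain $\alpha_1,\dots,\alpha_4$ with $\alpha_1,\alpha_2$ long; $E_n$ is the chain $\alpha_1,\dots,\alpha_{n-1}$ with $\alpha_n$ joined to $\alpha_{n-3}$. -/

import Mathlib

namespace CRBigrading

open LieAlgebra LieAlgebra.IsKilling LieModule Module

section Abstract

variable {L : Type*} [LieRing L] [LieAlgebra ℂ L]

/-- A family of subspaces `𝒢 (a, b)`, `a b : ℤ`, is a bigrading of the complex Lie algebra `L` if
`L` is the direct sum of these subspaces and brackets add the bidegrees. -/
structure IsBigrading (𝒢 : ℤ × ℤ → Submodule ℂ L) : Prop where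
  isInternal : DirectSum.IsInternal 𝒢
  gradedBracket : SetLike.GradedBracket 𝒢

/-- The component `𝔤_a = ⨁_b 𝔤_{a,b}` of the grading underlying a bigrading. -/
def gr (𝒢 : ℤ × ℤ → Submodule ℂ L) (a : ℤ) : Submodule ℂ L := ⨆ b : ℤ, 𝒢 (a, b)

/-- The complexified Levi kernel `𝔤_{0,-1} ⊕ 𝔤_{0,1}`. -/
def leviKernel (𝒢 : ℤ × ℤ → Submodule ℂ L) : Submodule ℂ L := 𝒢 (0, -1) ⊔ 𝒢 (0, 1)

/-- The bigradings to be classified.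

* `gr_zero`, `gr_neg_one`, `gr_neg_two` are the conditions on the bigrading itself;
* `generated`: the negative part of the grading `𝔤_a` is generated by `𝔤_{-1}`
  (the grading is the one of a parabolic subalgebra, and the filtration of the corresponding
  geometry is bracket generating);
* `nondegenerate`: `𝔤_{-1}` contains no nonzero ideal of `𝔤_-`;
* `leviKernel_ne_bot`, `injective`: the Levi kernel is not zero, and it is represented faithfully
  on `𝔤_{-1}` (the geometry is Levi degenerate, but 2-nondegenerate). -/
structure IsAdmissible (𝒢 : ℤ × ℤ → Submodule ℂ L) : Prop extends IsBigrading 𝒢 where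
  gr_zero : gr 𝒢 0 = 𝒢 (0, -1) ⊔ 𝒢 (0, 0) ⊔ 𝒢 (0, 1)
  gr_neg_one : gr 𝒢 (-1) = 𝒢 (-1, -1) ⊔ 𝒢 (-1, 0)
  gr_neg_two : gr 𝒢 (-2) = 𝒢 (-2, -1)
  generated : (LieSubalgebra.lieSpan ℂ L (gr 𝒢 (-1) : Set L)).toSubmodule =
    ⨆ (a : ℤ) (_ : a < 0), gr 𝒢 a
  nondegenerate : ∀ x ∈ gr 𝒢 (-1), (∀ y ∈ gr 𝒢 (-1), ⁅x, y⁆ = 0) → x = 0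
  leviKernel_ne_bot : leviKernel 𝒢 ≠ ⊥
  injective : ∀ x ∈ leviKernel 𝒢, (∀ y ∈ gr 𝒢 (-1), ⁅x, y⁆ = 0) → x = 0

end Abstract

section SimpleRoots

variable {L : Type*} [LieRing L] [LieAlgebra ℂ L] [FiniteDimensional ℂ L] [IsKilling ℂ L]
  {H : LieSubalgebra ℂ L} [H.IsCartanSubalgebra]

/-- The sum of the coefficients of `φ` at the simple roots in `S`, when `φ` is written as a linear
combination of the simple roots. -/
noncomputable def multiplicity (Δ : (rootSystem H).Base) (S : Finset Δ.support)
    (φ : Dual ℂ H) : ℂ :=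
  ∑ i ∈ S, Δ.toWeightBasis.repr φ i

/-- The bigrading determined by two sets `S₁`, `S₂` of simple roots: `𝔤_{a,b}` is the sum of the
root spaces of those roots (and of the Cartan subalgebra, as the weight space of `0`) whose
multiplicities over `S₁` and `S₂` are `a` and `b`. -/
noncomputable def ofSimpleRoots (Δ : (rootSystem H).Base) (S₁ S₂ : Finset Δ.support) :
    ℤ × ℤ → Submodule ℂ L := fun p ↦
  ⨆ (α : Weight ℂ H L) (_ : multiplicity Δ S₁ α.toLinear = (p.1 : ℂ) ∧
    multiplicity Δ S₂ α.toLinear = (p.2 : ℂ)), (rootSpace H α).toSubmodule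

end SimpleRoots

/-- `E₆`, labelled along the chain `α₁ - α₂ - α₃ - α₄ - α₅`, with `α₆` attached to `α₃`. -/
def cartanE₆ : Matrix (Fin 6) (Fin 6) ℤ :=
  CartanMatrix.E₆.submatrix ![0, 2, 3, 4, 5, 1] ![0, 2, 3, 4, 5, 1]

/-- `E₇`, labelled along the chain `α₁ - α₂ - α₃ - α₄ - α₅ - α₆`, with `α₇` attached to `α₄`. -/
def cartanE₇ : Matrix (Fin 7) (Fin 7) ℤ :=
  CartanMatrix.E₇.submatrix ![6, 5, 4, 3, 2, 0, 1] ![6, 5, 4, 3, 2, 0, 1]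

/-- `E₈`, labelled along the chain `α₁ - α₂ - α₃ - α₄ - α₅ - α₆ - α₇`, with `α₈` attached
to `α₅`. -/
def cartanE₈ : Matrix (Fin 8) (Fin 8) ℤ :=
  CartanMatrix.E₈.submatrix ![7, 6, 5, 4, 3, 2, 0, 1] ![7, 6, 5, 4, 3, 2, 0, 1]

/-- `F₄` with `α₁`, `α₂` long and `α₃`, `α₄` short. The entries of a Cartan matrix are
`⟨αᵢ, αⱼ^∨⟩`. -/
def cartanF₄ : Matrix (Fin 4) (Fin 4) ℤ := CartanMatrix.F₄

/-- `G₂` with `α₁` short and `α₂` long. -/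
def cartanG₂ : Matrix (Fin 2) (Fin 2) ℤ := CartanMatrix.G₂.transpose

/-- `TableEntry n A S₁ S₂`: the table of admissible bigradings contains the row
`Σ₁ = {α_k | k ∈ S₁}`, `Σ₂ = {α_k | k ∈ S₂}` for the Lie algebra of rank `n` with Cartan
matrix `A`. Labels of simple roots run from `1` to `n`. -/
inductive TableEntry : (n : ℕ) → Matrix (Fin n) (Fin n) ℤ → Finset ℕ → Finset ℕ → Prop
  | A (n r t s : ℕ) (h₁ : 1 ≤ r) (h₂ : r < t) (h₃ : t < s) (h₄ : s ≤ n) :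
      TableEntry n (CartanMatrix.A n) {r, s} {t}
  | B_adjacent (n r : ℕ) (h₁ : 1 ≤ r) (h₂ : r + 2 ≤ n) :
      TableEntry n (CartanMatrix.B n) {r, r + 2} {r + 1}
  | B_first (n : ℕ) (h : 2 ≤ n) : TableEntry n (CartanMatrix.B n) {2} {1}
  | C (n r : ℕ) (h₁ : 1 ≤ r) (h₂ : r < n) : TableEntry n (CartanMatrix.C n) {r} {n}
  | D_first (n : ℕ) (h : 4 ≤ n) : TableEntry n (CartanMatrix.D n) {2} {1}
  | D_last (n r : ℕ) (h : 4 ≤ n) (h₁ : 1 < r) (h₂ : r < n - 1) :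
      TableEntry n (CartanMatrix.D n) {r} {n}
  | D_adjacent (n r : ℕ) (h : 4 ≤ n) (h₁ : 1 ≤ r) (h₂ : r < n - 3) :
      TableEntry n (CartanMatrix.D n) {r, r + 2} {r + 1}
  | D_branch (n : ℕ) (h : 4 ≤ n) :
      TableEntry n (CartanMatrix.D n) {n - 3, n - 1, n} {n - 2}
  | G₂ : TableEntry 2 cartanG₂ {1} {2}
  | F₄_2_1 : TableEntry 4 cartanF₄ {2} {1}
  | F₄_13_2 : TableEntry 4 cartanF₄ {1, 3} {2}
  | E₆_2_1 : TableEntry 6 cartanE₆ {2} {1}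
  | E₆_6_1 : TableEntry 6 cartanE₆ {6} {1}
  | E₆_3_6 : TableEntry 6 cartanE₆ {3} {6}
  | E₆_13_2 : TableEntry 6 cartanE₆ {1, 3} {2}
  | E₆_246_3 : TableEntry 6 cartanE₆ {2, 4, 6} {3}
  | E₇_2_1 : TableEntry 7 cartanE₇ {2} {1}
  | E₇_5_6 : TableEntry 7 cartanE₇ {5} {6}
  | E₇_6_1 : TableEntry 7 cartanE₇ {6} {1}
  | E₇_4_7 : TableEntry 7 cartanE₇ {4} {7}
  | E₇_13_2 : TableEntry 7 cartanE₇ {1, 3} {2}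
  | E₇_24_3 : TableEntry 7 cartanE₇ {2, 4} {3}
  | E₇_46_5 : TableEntry 7 cartanE₇ {4, 6} {5}
  | E₇_357_4 : TableEntry 7 cartanE₇ {3, 5, 7} {4}
  | E₈_2_1 : TableEntry 8 cartanE₈ {2} {1}
  | E₈_6_7 : TableEntry 8 cartanE₈ {6} {7}
  | E₈_5_8 : TableEntry 8 cartanE₈ {5} {8}
  | E₈_13_2 : TableEntry 8 cartanE₈ {1, 3} {2}
  | E₈_24_3 : TableEntry 8 cartanE₈ {2, 4} {3}
  | E₈_35_4 : TableEntry 8 cartanE₈ {3, 5} {4}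
  | E₈_57_6 : TableEntry 8 cartanE₈ {5, 7} {6}
  | E₈_468_5 : TableEntry 8 cartanE₈ {4, 6, 8} {5}

section InTable

variable {L : Type*} [LieRing L] [LieAlgebra ℂ L] [FiniteDimensional ℂ L] [IsKilling ℂ L]
  {H : LieSubalgebra ℂ L} [H.IsCartanSubalgebra]

/-- For some numbering `e` of the simple roots which gives the Cartan matrix of a row of the table
(such a numbering is unique up to an automorphism of the Dynkin diagram), the pair `S₁`, `S₂` is
the one of that row. -/
def InTable (Δ : (rootSystem H).Base) (S₁ S₂ : Finset Δ.support) : Prop :=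
  ∃ (n : ℕ) (A : Matrix (Fin n) (Fin n) ℤ) (T₁ T₂ : Finset ℕ) (e : Fin n ≃ Δ.support),
    TableEntry n A T₁ T₂ ∧ (∀ i j, Δ.cartanMatrix (e i) (e j) = A i j) ∧
    (∀ i, e i ∈ S₁ ↔ (i : ℕ) + 1 ∈ T₁) ∧ (∀ i, e i ∈ S₂ ↔ (i : ℕ) + 1 ∈ T₂)

end InTable

end CRBigrading

/-!
A bigrading of a simple Lie algebra `L` is a pair of commuting diagonalizable derivations with
integral eigenvalues. As derivations are inner, they are given by two elements of `L`, the grading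
elements (`exists_isGradingElement`). A Cartan subalgebra of their centralizer, the component of
bidegree `0`, contains them and is a Cartan subalgebra of `L` (`exists_isCartanSubalgebra_mem`).
Hence the components of the bigrading are sums of root spaces, and the two degrees are additive
functions of the roots (`IsBigrading.exists_weight_degrees`). For a base that is adapted to the
lexicographic order on bidegrees (`exists_base_lex`), the first degree of a simple root is
nonnegative, and it is at most `1` because `𝔤_-` is generated by `𝔤_{-1}` (`le_one_of_generated`).
The second degree of a simple root is `0` or `1` as well: for simple roots of first degree `1` this
is a condition on `𝔤_{-1}`, and for the others it follows from the choice of the base and the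
condition on `𝔤_0`. So an admissible bigrading is determined by two sets of simple roots
(`IsAdmissible.exists_eq_ofSimpleRoots`), and it remains to decide which pairs of sets are
admissible.

Root spaces multiply without zeros (`lie_ne_zero_of_add_isRoot`), so that admissibility of the
bigrading determined by `(Σ₁, Σ₂)` is a condition on the coordinate vectors of the roots with
respect to the simple roots (`IsCombAdmissible`; `IsAdmissible.isCombAdmissible`,
`IsCombAdmissible.isAdmissible`), and these coordinate vectors are determined by the Cartan matrix:
they are the orbit of the unit vectors under the simple reflections (`IsRootVec`, `isRootVec_iff`).
Sums of simple roots along paths in the Dynkin diagram show that `Σ₂` has just one element `σ`,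
which is not in `Σ₁` (`exists_eq_singleton`). Nondegeneracy and faithfulness say that certain roots
can be added to the given ones; by the Jacobi identity this depends only on the class of a root
under addition of roots of degree `0`, so that it suffices to have one root of degree `2` for every
element of `Σ₁`, and one root of bidegree `(1, 1)`. The resulting condition is `Good`.

It is decided type by type. For the classical types, the roots are written in terms of the unit
vectors of Euclidean space (`IsRootVec.form_A` and its analogues), which proves that the rows of the
table are good (`TableEntry.good`); conversely, a pair that is not in the table is excluded by the
lack of roots of degree `2`, or by an explicit root of degree `2` whose coordinate at `σ` is not `1`
(`Good.listedA` and its analogues).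
For the exceptional types, all subsets of the simple roots are tested against the list of positive
roots, where `isRootVec_ofColumns_iff` certifies the list.

That every Cartan matrix has one of the types in the table comes from positive definiteness: no vector
`v ≥ 0`, `v ≠ 0`, has `v A ≤ 0` on its support (`IsFiniteType`). Such vectors live on cycles, on
diagrams with too many bonds or branch points, and on the diagrams of affine type. Hence the diagram
is a chain or a chain with one more vertex (`exists_realizes`), and a comparison of the lengths of
its arms and of its multiple bonds leaves the diagrams in the table (`IsFiniteType.exists_equiv`).
-/

namespace CRBigrading

/-! ### Roots of a Cartan matrix -/

section RootVectors

variable {ι κ : Type*} [Fintype ι] [DecidableEq ι] [Fintype κ] [DecidableEq κ]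

/-- The simple reflection `v ↦ v - ⟨v, αⱼ^∨⟩ αⱼ` on coordinate vectors with respect to the simple
roots, where `A i j = ⟨αᵢ, αⱼ^∨⟩`. -/
def simpleReflection (A : Matrix ι ι ℤ) (j : ι) (v : ι → ℤ) : ι → ℤ :=
  Function.update v j (v j - ∑ i, v i * A i j)

/-- The coordinate vectors of the roots of a root system with Cartan matrix `A`: the orbit of the
simple roots under the simple reflections. -/
inductive IsRootVec (A : Matrix ι ι ℤ) : (ι → ℤ) → Prop
  | simple (i : ι) : IsRootVec A (Pi.single i 1)
  | reflect (v : ι → ℤ) (j : ι) : IsRootVec A v → IsRootVec A (simpleReflection A j v)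

theorem simpleReflection_neg (A : Matrix ι ι ℤ) (j : ι) (v : ι → ℤ) :
    simpleReflection A j (-v) = -simpleReflection A j v := by
  ext k
  by_cases h : k = j
  · subst h
    simp [simpleReflection, Finset.sum_neg_distrib]
    ring
  · simp [simpleReflection, h]

theorem sum_simpleReflection_mul {A : Matrix ι ι ℤ} (hA : ∀ i, A i i = 2) (j : ι) (v : ι → ℤ) :
    ∑ i, simpleReflection A j v i * A i j = - ∑ i, v i * A i j := by
  have h : ∀ i, simpleReflection A j v i * A i j =
      v i * A i j - if i = j then 2 * ∑ i, v i * A i j else 0 := by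
    intro i
    by_cases h : i = j
    · subst h
      simp [simpleReflection, hA]
      ring
    · simp [simpleReflection, h]
  simp only [h, Finset.sum_sub_distrib, Finset.sum_ite_eq', Finset.mem_univ, if_true]
  ring

theorem simpleReflection_involutive {A : Matrix ι ι ℤ} (hA : ∀ i, A i i = 2) (j : ι) (v : ι → ℤ) :
    simpleReflection A j (simpleReflection A j v) = v := by
  ext k
  by_cases h : k = j
  · subst h
    rw [simpleReflection, Function.update_self, sum_simpleReflection_mul hA]
    simp [simpleReflection]
  · simp [simpleReflection, h]

theorem IsRootVec.neg {A : Matrix ι ι ℤ} (hA : ∀ i, A i i = 2) {v : ι → ℤ} (h : IsRootVec A v) :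
    IsRootVec A (-v) := by
  induction h with
  | simple i =>
    have : -Pi.single i 1 = simpleReflection A i (Pi.single i 1) := by
      ext k
      by_cases h : k = i
      · subst h
        simp [simpleReflection, Pi.single_apply, hA]
      · simp [simpleReflection, h]
    rw [this]
    exact .reflect _ _ (.simple i)
  | reflect v j _ ih => rw [← simpleReflection_neg]; exact .reflect _ _ ih

theorem IsRootVec.comp_equiv {A : Matrix ι ι ℤ} {B : Matrix κ κ ℤ} (e : κ ≃ ι)
    (h : ∀ i j, A (e i) (e j) = B i j) {v : ι → ℤ} (hv : IsRootVec A v) :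
    IsRootVec B (v ∘ e) := by
  induction hv with
  | simple i =>
    convert IsRootVec.simple (A := B) (e.symm i) using 1
    ext k
    simp [Pi.single_apply, Equiv.eq_symm_apply]
  | reflect v j _ ih =>
    convert IsRootVec.reflect _ (e.symm j) ih using 1
    ext k
    by_cases hk : e k = j
    · subst hk
      simp only [Function.comp_apply, simpleReflection, Function.update_self,
        Equiv.symm_apply_apply]
      rw [← Equiv.sum_comp e]
      simp [h]
    · have : k ≠ e.symm j := by rintro rfl; simp at hk
      simp [simpleReflection, hk, this]

/-- The pairs `(S, {σ})` with `σ ∉ S` whose bigrading is admissible, in terms of the coordinate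
vectors of the roots. The fields `zero`, `one` and `two` are the bounds on the bidegrees. By
`exists_two` every simple root of `S` occurs in a root of degree `2`, which accounts for
nondegeneracy, and by `exists_one` there is a root of bidegree `(1, 1)`, which accounts for the
faithfulness of the representation. -/
structure Good (A : Matrix ι ι ℤ) (S : Finset ι) (σ : ι) : Prop where
  notMem : σ ∉ S
  zero : ∀ v, IsRootVec A v → ∑ i ∈ S, v i = 0 → v σ ≤ 1
  one : ∀ v, IsRootVec A v → ∑ i ∈ S, v i = 1 → v σ = 0 ∨ v σ = 1
  two : ∀ v, IsRootVec A v → ∑ i ∈ S, v i = 2 → v σ = 1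
  exists_two : ∀ i ∈ S, ∃ v, IsRootVec A v ∧ ∑ i ∈ S, v i = 2 ∧ 0 < v i
  exists_one : ∃ v, IsRootVec A v ∧ ∑ i ∈ S, v i = 1 ∧ v σ = 1

theorem Good.comp_equiv {A : Matrix ι ι ℤ} {B : Matrix κ κ ℤ} (e : κ ≃ ι)
    (h : ∀ i j, A (e i) (e j) = B i j) {S : Finset ι} {σ : ι} (hS : Good A S σ) :
    Good B (S.map e.symm.toEmbedding) (e.symm σ) := by
  have h' : ∀ i j, B (e.symm i) (e.symm j) = A i j := fun i j ↦ by simp [← h]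
  have hsum (v : κ → ℤ) : ∑ i ∈ S.map e.symm.toEmbedding, v i = ∑ i ∈ S, (v ∘ e.symm) i := by
    simp
  have hsum' (v : ι → ℤ) : ∑ i ∈ S.map e.symm.toEmbedding, (v ∘ e) i = ∑ i ∈ S, v i := by
    simp
  refine ⟨by simpa using hS.notMem, fun v hv h0 ↦ ?_, fun v hv h0 ↦ ?_, fun v hv h0 ↦ ?_, ?_, ?_⟩
  · exact hS.zero _ (hv.comp_equiv e.symm h') (by rw [← hsum, h0])
  · exact hS.one _ (hv.comp_equiv e.symm h') (by rw [← hsum, h0])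
  · exact hS.two _ (hv.comp_equiv e.symm h') (by rw [← hsum, h0])
  · intro i hi
    obtain ⟨v, hv, h2, hi⟩ := hS.exists_two (e i) (by simpa using hi)
    exact ⟨v ∘ e, hv.comp_equiv e h, by rw [hsum', h2], hi⟩
  · obtain ⟨v, hv, h1, hσ⟩ := hS.exists_one
    exact ⟨v ∘ e, hv.comp_equiv e h, by rw [hsum', h1], by simpa using hσ⟩

/-- `Listed A S₁ S₂`: for some numbering `e` of the index set, `A` is the Cartan matrix of a row of
the table and the pair `S₁`, `S₂` is the one of that row. -/
def Listed {ι : Type*} (A : Matrix ι ι ℤ) (S₁ S₂ : Finset ι) : Prop :=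
  ∃ (n : ℕ) (B : Matrix (Fin n) (Fin n) ℤ) (T₁ T₂ : Finset ℕ) (e : Fin n ≃ ι),
    TableEntry n B T₁ T₂ ∧ (∀ i j, A (e i) (e j) = B i j) ∧
    (∀ i, e i ∈ S₁ ↔ (i : ℕ) + 1 ∈ T₁) ∧ (∀ i, e i ∈ S₂ ↔ (i : ℕ) + 1 ∈ T₂)

theorem Listed.of_equiv {ι κ : Type*} {A : Matrix ι ι ℤ} {B : Matrix κ κ ℤ} (e : κ ≃ ι)
    (h : ∀ i j, A (e i) (e j) = B i j) {S₁ S₂ : Finset ι}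
    (hB : Listed B (S₁.map e.symm.toEmbedding) (S₂.map e.symm.toEmbedding)) : Listed A S₁ S₂ := by
  obtain ⟨n, C, T₁, T₂, f, hT, hC, h₁, h₂⟩ := hB
  refine ⟨n, C, T₁, T₂, f.trans e, hT, fun i j ↦ ?_, fun i ↦ ?_, fun i ↦ ?_⟩
  · simp [h, hC]
  · rw [← h₁]; simp
  · rw [← h₂]; simp

end RootVectors

/-! ### Root lists and the exceptional types -/

section RootLists

/-- The coordinate vector with the given list of entries. -/
def vec (n : ℕ) (l : List ℕ) : Fin n → ℤ := fun i ↦ (l.getD i 0 : ℕ)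

/-- The standard scalar product of two lists. -/
def dot : List ℕ → List ℕ → ℕ
  | a :: l, b :: c => a * b + dot l c
  | _, _ => 0

theorem dot_eq_sum {n : ℕ} {l c : List ℕ} (hl : l.length = n) (hc : c.length = n) :
    (dot l c : ℤ) = ∑ i, vec n l i * vec n c i := by
  induction n generalizing l c with
  | zero => simp_all [dot]
  | succ n ih =>
    match l, c, hl, hc with
    | a :: l, b :: c, hl, hc =>
      rw [Fin.sum_univ_succ, dot, Nat.cast_add, ih (by simpa using hl) (by simpa using hc)]
      push_cast
      rfl

/-- Equality of lists of natural numbers, in a form that is fast to evaluate. -/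
def eqTest : List ℕ → List ℕ → Bool
  | [], [] => true
  | a :: l, b :: c => Nat.beq a b && eqTest l c
  | _, _ => false

theorem eqTest_iff (l c : List ℕ) : eqTest l c = true ↔ l = c := by
  induction l generalizing c with
  | nil => cases c <;> simp [eqTest]
  | cons a l ih => cases c <;> simp [eqTest, ih]

/-- The list of entries of the `j`-th simple root. -/
def unitList (n j : ℕ) : List ℕ := (List.replicate n 0).set j 1

/-- A test for `R` to be the list of positive roots of the Cartan matrix whose off-diagonal entries
are the negatives of the entries in the list of columns `C`: the simple roots are there, simple
reflections lead out of the list only from a simple root to its negative, and from every other root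
some simple reflection leads to a lower one. (Roots fixed by a reflection are treated separately
only to save time.) -/
def isRootList (n : ℕ) (C R : List (List ℕ)) : Bool :=
  R.all (fun l ↦ l.length.beq n) &&
  (List.range n).all (fun j ↦ (C.getD j []).length.beq n && ((C.getD j []).getD j 0).beq 0 &&
    R.any (eqTest (unitList n j))) &&
  R.all (fun l ↦ (List.range n).all fun j ↦ eqTest l (unitList n j) ||
    Nat.beq (dot l (C.getD j [])) (2 * l.getD j 0) ||
    (Nat.ble (l.getD j 0) (dot l (C.getD j [])) &&
      R.any (eqTest (l.set j (dot l (C.getD j []) - l.getD j 0))))) &&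
  R.all (fun l ↦ (List.range n).any fun j ↦ eqTest l (unitList n j) ||
    Nat.blt (dot l (C.getD j [])) (2 * l.getD j 0))

variable {n : ℕ} {C R : List (List ℕ)}

/-- The Cartan matrix whose off-diagonal entries are the negatives of the entries in the list of
columns `C`. -/
def ofColumns (n : ℕ) (C : List (List ℕ)) : Matrix (Fin n) (Fin n) ℤ :=
  fun i j ↦ if i = j then 2 else -vec n (C.getD j []) i

theorem vec_unitList (j : Fin n) : vec n (unitList n j) = Pi.single j 1 := by
  ext k
  simp only [vec, unitList, List.getD_eq_getElem?_getD, List.getElem?_set, Pi.single_apply,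
    Fin.ext_iff]
  by_cases h : (k : ℕ) = j
  · simp [h]
  · simp [h, Ne.symm h]

theorem sum_vec_mul_ofColumns {j : Fin n} {l : List ℕ} (hl : l.length = n)
    (hC : (C.getD j []).length = n) (hj : (C.getD j []).getD j 0 = 0) :
    ∑ i, vec n l i * ofColumns n C i j = 2 * vec n l j - dot l (C.getD j []) := by
  have h (i : Fin n) : vec n l i * ofColumns n C i j =
      (if i = j then 2 * vec n l i else 0) - vec n l i * vec n (C.getD j []) i := by
    by_cases h : i = j
    · subst h
      have : vec n (C.getD i []) i = 0 := by rw [vec, hj]; rfl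
      rw [this, ofColumns, if_pos rfl, if_pos rfl]
      ring
    · rw [ofColumns, if_neg h, if_neg h]
      ring
  simp only [h, Finset.sum_sub_distrib, ← dot_eq_sum hl hC]
  simp

theorem vec_reflect {j : Fin n} {l : List ℕ} (hl : l.length = n)
    (hC : (C.getD j []).length = n) (hj : (C.getD j []).getD j 0 = 0)
    (hle : l.getD j 0 ≤ dot l (C.getD j [])) :
    vec n (l.set j (dot l (C.getD j []) - l.getD j 0)) =
      simpleReflection (ofColumns n C) j (vec n l) := by
  ext k
  by_cases h : k = j
  · subst h
    rw [simpleReflection, Function.update_self, sum_vec_mul_ofColumns hl hC hj]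
    have : vec n (l.set k (dot l (C.getD k []) - l.getD k 0)) k =
        (dot l (C.getD k []) - l.getD k 0 : ℕ) := by
      simp only [vec, List.getD_eq_getElem?_getD, List.getElem?_set]
      simp [hl]
    rw [this, Nat.cast_sub hle, vec]
    ring
  · have : (j : ℕ) ≠ k := fun h' ↦ h (Fin.ext h'.symm)
    simp [simpleReflection, h, vec, this]

/-- A list that passes `isRootList` is the list of all positive roots: together with the negatives
it contains the simple roots and is closed under simple reflections, and by descent all its elements
are in the orbit of the simple roots. -/
theorem isRootVec_ofColumns_iff (h : isRootList n C R = true) (v : Fin n → ℤ) :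
    IsRootVec (ofColumns n C) v ↔ ∃ l ∈ R, v = vec n l ∨ v = -vec n l := by
  have hA : ∀ i, ofColumns n C i i = 2 := fun i ↦ by simp [ofColumns]
  simp only [isRootList, Bool.and_eq_true, List.all_eq_true, List.mem_range, Nat.beq_eq,
    Bool.or_eq_true, List.any_eq_true, Nat.ble_eq, Nat.blt_eq, eqTest_iff, exists_eq_right'] at h
  obtain ⟨⟨⟨h₁, h₂⟩, h₃⟩, h₄⟩ := h
  constructor
  · intro hv
    induction hv with
    | simple i => exact ⟨_, (h₂ i i.2).2, .inl (vec_unitList i).symm⟩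
    | reflect v j _ ih =>
      obtain ⟨l, hl, hv⟩ := ih
      rcases h₃ l hl j j.2 with (h | h) | ⟨h', h⟩
      · have hs : vec n l = Pi.single j 1 := by rw [h, vec_unitList]
        have : simpleReflection (ofColumns n C) j (vec n l) = -vec n l := by
          rw [hs]
          ext k
          by_cases hk : k = j
          · subst hk
            simp [simpleReflection, Pi.single_apply, hA]
          · simp [simpleReflection, hk]
        refine ⟨l, hl, ?_⟩
        rcases hv with rfl | rfl
        · exact .inr this
        · left; rw [simpleReflection_neg, this, neg_neg]
      · have : simpleReflection (ofColumns n C) j (vec n l) = vec n l := by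
          rw [simpleReflection,
            sum_vec_mul_ofColumns (h₁ l hl) (h₂ j j.2).1.1 (h₂ j j.2).1.2, h, vec]
          push_cast
          rw [sub_self, sub_zero]
          exact Function.update_eq_self _ _
        refine ⟨l, hl, ?_⟩
        rcases hv with rfl | rfl
        · exact .inl this
        · right; rw [simpleReflection_neg, this]
      · have hr := vec_reflect (h₁ l hl) (h₂ j j.2).1.1 (h₂ j j.2).1.2 h'
        refine ⟨_, h, ?_⟩
        rcases hv with rfl | rfl
        · exact .inl hr.symm
        · right; rw [simpleReflection_neg, hr]
  · -- induction on the height, which is lowered by a simple reflection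
    suffices H : ∀ (N : ℕ) (l) (_ : l ∈ R), ∑ i, vec n l i < N →
        IsRootVec (ofColumns n C) (vec n l) by
      have H' (l) (hl : l ∈ R) := H ((∑ i, vec n l i).toNat + 1) l hl
        (by push_cast; have := Int.self_le_toNat (∑ i, vec n l i); omega)
      rintro ⟨l, hl, rfl | rfl⟩
      · exact H' l hl
      · exact (H' l hl).neg hA
    intro N
    induction N with
    | zero =>
      intro l hl hs
      exact absurd hs (not_lt.mpr (Finset.sum_nonneg fun i _ ↦ Int.natCast_nonneg _))
    | succ N ih =>
      intro l hl hs
      obtain ⟨j, hj, h | hlt⟩ := h₄ l hl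
      · rw [h]
        exact vec_unitList (⟨j, hj⟩ : Fin n) ▸ .simple _
      rcases h₃ l hl j hj with (h | h) | ⟨h', h⟩
      · rw [h]
        exact vec_unitList (⟨j, hj⟩ : Fin n) ▸ .simple _
      · omega
      have hr := vec_reflect (j := ⟨j, hj⟩) (h₁ l hl) (h₂ j hj).1.1 (h₂ j hj).1.2 h'
      have hs' := sum_vec_mul_ofColumns (j := ⟨j, hj⟩) (h₁ l hl) (h₂ j hj).1.1 (h₂ j hj).1.2
      have hlt' : 0 < ∑ i, vec n l i * ofColumns n C i ⟨j, hj⟩ := by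
        rw [hs']
        simp only [vec]
        omega
      have hlow : ∑ i, vec n (l.set j (dot l (C.getD j []) - l.getD j 0)) i <
          ∑ i, vec n l i := by
        rw [hr, simpleReflection, Finset.sum_update_of_mem (Finset.mem_univ _),
          ← Finset.add_sum_erase _ (vec n l) (Finset.mem_univ ⟨j, hj⟩),
          Finset.sdiff_singleton_eq_erase]
        omega
      have := ih _ h (by push_cast at hs; omega)
      rw [← simpleReflection_involutive hA ⟨j, hj⟩ (vec n l), ← hr]
      exact .reflect _ _ this

/-- The conditions of `Good` on a root with coefficient sum `a` over `S` and coefficient `b`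
at `σ`. -/
def boundTest : ℕ → ℕ → Bool
  | 0, b => b.ble 1
  | 1, b => b.ble 1
  | 2, b => b.beq 1
  | _, _ => true

theorem boundTest_iff (a b : ℕ) :
    boundTest a b = true ↔ (a = 0 → b ≤ 1) ∧ (a = 1 → b ≤ 1) ∧ (a = 2 → b = 1) := by
  match a with
  | 0 => simp [boundTest]
  | 1 => simp [boundTest]
  | 2 => simp [boundTest]
  | a + 3 => simp [boundTest]

/-- A test for the property `Good`, where `m` is the indicator list of `S`, and `R` is the list of
positive roots. -/
def goodTest (n : ℕ) (R : List (List ℕ)) (m : List ℕ) (t : ℕ) : Bool :=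
  (m.getD t 0).beq 0 && R.all (fun l ↦ boundTest (dot l m) (l.getD t 0)) &&
  (List.range n).all (fun i ↦ (m.getD i 0).beq 0 ||
    R.any fun l ↦ (dot l m).beq 2 && Nat.blt 0 (l.getD i 0)) &&
  R.any (fun l ↦ (dot l m).beq 1 && (l.getD t 0).beq 1)

/-- The indicator list of a subset of `Fin n`. -/
def indicatorList (S : Finset (Fin n)) : List ℕ := List.ofFn fun i ↦ if i ∈ S then 1 else 0

theorem vec_indicatorList (S : Finset (Fin n)) (i : Fin n) :
    vec n (indicatorList S) i = if i ∈ S then 1 else 0 := by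
  simp [vec, indicatorList]

/-- For a matrix with a known list of positive roots, `Good` is decided by `goodTest`. Negative
roots need no test, as their coordinates are at most `0`. -/
theorem good_ofColumns_iff (h : isRootList n C R = true) (S : Finset (Fin n)) (t : Fin n) :
    Good (ofColumns n C) S t ↔ goodTest n R (indicatorList S) t = true := by
  have hv := isRootVec_ofColumns_iff h
  simp only [isRootList, Bool.and_eq_true, List.all_eq_true, Nat.beq_eq] at h
  have h₁ := h.1.1.1
  have hdot (l) (hl : l ∈ R) : (dot l (indicatorList S) : ℤ) = ∑ i ∈ S, vec n l i := by
    rw [dot_eq_sum (h₁ l hl) (by simp [indicatorList])]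
    simp [vec_indicatorList]
  have hdot' (l) (hl : l ∈ R) (k : ℕ) : dot l (indicatorList S) = k ↔ ∑ i ∈ S, vec n l i = k := by
    rw [← hdot l hl, Nat.cast_inj]
  have hpos (l : List ℕ) (i : Fin n) : 0 ≤ vec n l i := Int.natCast_nonneg _
  have hpos' (l) : 0 ≤ ∑ i ∈ S, vec n l i := Finset.sum_nonneg fun i _ ↦ hpos l i
  have hm (i : Fin n) : (indicatorList S).getD i 0 = 0 ↔ i ∉ S := by
    have := vec_indicatorList S i
    rw [vec] at this
    rw [← Nat.cast_inj (R := ℤ), this]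
    simp
  simp only [goodTest, Bool.and_eq_true, List.all_eq_true, Nat.beq_eq, Nat.blt_eq, boundTest_iff,
    List.any_eq_true, Bool.or_eq_true, List.mem_range]
  have hsub (P : ℕ → Prop) : (∀ i < n, P i) ↔ ∀ i : Fin n, P i :=
    ⟨fun h i ↦ h i i.2, fun h i hi ↦ h ⟨i, hi⟩⟩
  rw [hsub]
  simp only [hm]
  constructor
  · intro g
    refine ⟨⟨⟨g.notMem, fun l hl ↦ ?_⟩, fun i ↦ ?_⟩, ?_⟩
    · have hr := (hv _).2 ⟨l, hl, .inl rfl⟩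
      simp only [hdot' l hl]
      refine ⟨fun h ↦ ?_, fun h ↦ ?_, fun h ↦ ?_⟩
      · have := g.zero _ hr h; simp only [vec] at this; omega
      · have := g.one _ hr h; simp only [vec] at this; omega
      · have := g.two _ hr h; simp only [vec] at this; omega
    · by_cases hi : i ∈ S
      · right
        obtain ⟨v, hr, h2, h0⟩ := g.exists_two i hi
        obtain ⟨l, hl, rfl | rfl⟩ := (hv _).1 hr
        · exact ⟨l, hl, (hdot' l hl 2).2 h2, by simp only [vec] at h0; omega⟩
        · have := hpos l i
          simp only [Pi.neg_apply] at h0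
          omega
      · exact .inl hi
    · obtain ⟨v, hr, h2, h0⟩ := g.exists_one
      obtain ⟨l, hl, rfl | rfl⟩ := (hv _).1 hr
      · exact ⟨l, hl, (hdot' l hl 1).2 h2, by simp only [vec] at h0; omega⟩
      · have := hpos l t
        simp only [Pi.neg_apply] at h0
        omega
  · rintro ⟨⟨⟨g₁, g₂⟩, g₃⟩, g₄⟩
    refine ⟨g₁, fun v hr h0 ↦ ?_, fun v hr h0 ↦ ?_, fun v hr h0 ↦ ?_, fun i hi ↦ ?_, ?_⟩
    · obtain ⟨l, hl, rfl | rfl⟩ := (hv _).1 hr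
      · have := (g₂ l hl).1 ((hdot' l hl 0).2 h0); simp only [vec]; omega
      · have := hpos l t; simp only [Pi.neg_apply]; omega
    · obtain ⟨l, hl, rfl | rfl⟩ := (hv _).1 hr
      · have := (g₂ l hl).2.1 ((hdot' l hl 1).2 h0); simp only [vec]; omega
      · have := hpos' l
        simp only [Pi.neg_apply, Finset.sum_neg_distrib] at h0
        omega
    · obtain ⟨l, hl, rfl | rfl⟩ := (hv _).1 hr
      · have := (g₂ l hl).2.2 ((hdot' l hl 2).2 h0); simp only [vec]; omega
      · have := hpos' l
        simp only [Pi.neg_apply, Finset.sum_neg_distrib] at h0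
        omega
    · obtain ⟨l, hl, h2, h0⟩ := (g₃ i).resolve_left (by simpa using hi)
      exact ⟨_, (hv _).2 ⟨l, hl, .inl rfl⟩, (hdot' l hl 2).1 h2, by simp only [vec]; omega⟩
    · obtain ⟨l, hl, h2, h0⟩ := g₄
      exact ⟨_, (hv _).2 ⟨l, hl, .inl rfl⟩, (hdot' l hl 1).1 h2, by simp only [vec]; omega⟩

/-- All lists of length `n` with entries `0` and `1`. -/
def masks : ℕ → List (List ℕ)
  | 0 => [[]]
  | n + 1 => (masks n).map (0 :: ·) ++ (masks n).map (1 :: ·)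

theorem indicatorList_mem_masks (S : Finset (Fin n)) : indicatorList S ∈ masks n := by
  suffices H : ∀ (n : ℕ) (f : Fin n → ℕ), (∀ i, f i = 0 ∨ f i = 1) → List.ofFn f ∈ masks n from
    H n _ fun i ↦ by by_cases h : i ∈ S <;> simp [h]
  intro n
  induction n with
  | zero => simp [masks]
  | succ n ih =>
    intro f hf
    have := ih (fun i ↦ f i.succ) fun i ↦ hf _
    rw [List.ofFn_succ, masks]
    rcases hf 0 with h | h <;> simp [h, this]

end RootLists

section Exceptional

/-- The negatives of the off-diagonal entries, by columns, of the Cartan matrix of type `G₂`. -/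
def columnsG₂ : List (List ℕ) :=
  [[0, 3],
   [1, 0]]

/-- The positive roots of type `G₂`. -/
def rootsG₂ : List (List ℕ) :=
  [[3, 2], [3, 1], [2, 1], [1, 1], [0, 1], [1, 0]]

theorem cartanG₂_eq : cartanG₂ = ofColumns 2 columnsG₂ := by decide

theorem isRootListG₂ : isRootList 2 columnsG₂ rootsG₂ = true := by decide +kernel

theorem goodG₂_iff (S : Finset (Fin 2)) (t : Fin 2) :
    Good cartanG₂ S t ↔ goodTest 2 rootsG₂ (indicatorList S) t = true :=
  cartanG₂_eq ▸ good_ofColumns_iff isRootListG₂ S t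

/-- The pairs of type `G₂` that pass the test, found by evaluation for all subsets of the simple
roots. -/
theorem testG₂ : ∀ m ∈ masks 2, ∀ t : Fin 2, goodTest 2 rootsG₂ m t = true →
    (m, t) ∈ ([([1, 0], 1)] : List (List ℕ × Fin 2)) := by
  decide +kernel

/-- The negatives of the off-diagonal entries, by columns, of the Cartan matrix of type `F₄`. -/
def columnsF₄ : List (List ℕ) :=
  [[0, 1, 0, 0],
   [1, 0, 1, 0],
   [0, 2, 0, 1],
   [0, 0, 1, 0]]

/-- The positive roots of type `F₄`. -/
def rootsF₄ : List (List ℕ) :=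
  [[2, 3, 4, 2], [1, 3, 4, 2], [1, 2, 4, 2], [1, 2, 3, 2], [1, 2, 2, 2], [1, 2, 3, 1], [1, 1, 2, 2],
   [1, 2, 2, 1], [0, 1, 2, 2], [1, 1, 2, 1], [1, 2, 2, 0], [0, 1, 2, 1], [1, 1, 1, 1], [1, 1, 2, 0],
   [0, 1, 1, 1], [0, 1, 2, 0], [1, 1, 1, 0], [0, 0, 1, 1], [0, 1, 1, 0], [1, 1, 0, 0], [0, 0, 0, 1],
   [0, 0, 1, 0], [0, 1, 0, 0], [1, 0, 0, 0]]

theorem cartanF₄_eq : cartanF₄ = ofColumns 4 columnsF₄ := by decide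

theorem isRootListF₄ : isRootList 4 columnsF₄ rootsF₄ = true := by decide +kernel

theorem goodF₄_iff (S : Finset (Fin 4)) (t : Fin 4) :
    Good cartanF₄ S t ↔ goodTest 4 rootsF₄ (indicatorList S) t = true :=
  cartanF₄_eq ▸ good_ofColumns_iff isRootListF₄ S t

/-- The pairs of type `F₄` that pass the test, found by evaluation for all subsets of the simple
roots. -/
theorem testF₄ : ∀ m ∈ masks 4, ∀ t : Fin 4, goodTest 4 rootsF₄ m t = true →
    (m, t) ∈ ([([0, 1, 0, 0], 0),
      ([1, 0, 1, 0], 1)] : List (List ℕ × Fin 4)) := by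
  decide +kernel

/-- The negatives of the off-diagonal entries, by columns, of the Cartan matrix of type `E₆`. -/
def columnsE₆ : List (List ℕ) :=
  [[0, 1, 0, 0, 0, 0],
   [1, 0, 1, 0, 0, 0],
   [0, 1, 0, 1, 0, 1],
   [0, 0, 1, 0, 1, 0],
   [0, 0, 0, 1, 0, 0],
   [0, 0, 1, 0, 0, 0]]

/-- The positive roots of type `E₆`, ordered so that `goodTest` rejects most pairs early. -/
def rootsE₆ : List (List ℕ) :=
  [[0, 1, 2, 1, 0, 1], [1, 1, 1, 0, 0, 0], [0, 0, 1, 1, 1, 0], [1, 2, 2, 2, 1, 1],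
   [0, 0, 1, 0, 0, 1], [0, 1, 1, 0, 0, 1], [0, 0, 0, 1, 1, 0], [1, 2, 2, 1, 0, 1],
   [1, 2, 3, 2, 1, 2], [0, 1, 2, 2, 1, 1], [0, 1, 1, 1, 0, 0], [1, 1, 1, 1, 1, 0],
   [1, 1, 0, 0, 0, 0], [0, 0, 1, 1, 0, 1], [1, 0, 0, 0, 0, 0], [0, 1, 0, 0, 0, 0],
   [0, 0, 1, 0, 0, 0], [0, 0, 0, 1, 0, 0], [0, 0, 0, 0, 1, 0], [0, 0, 0, 0, 0, 1],
   [0, 1, 1, 0, 0, 0], [0, 0, 1, 1, 0, 0], [1, 1, 1, 1, 0, 0], [1, 1, 1, 0, 0, 1],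
   [0, 1, 1, 1, 1, 0], [0, 1, 1, 1, 0, 1], [0, 0, 1, 1, 1, 1], [1, 1, 1, 1, 0, 1],
   [0, 1, 1, 1, 1, 1], [1, 1, 2, 1, 0, 1], [1, 1, 1, 1, 1, 1], [0, 1, 2, 1, 1, 1],
   [1, 1, 2, 1, 1, 1], [1, 2, 2, 1, 1, 1], [1, 1, 2, 2, 1, 1], [1, 2, 3, 2, 1, 1]]

theorem cartanE₆_eq : cartanE₆ = ofColumns 6 columnsE₆ := by decide

theorem isRootListE₆ : isRootList 6 columnsE₆ rootsE₆ = true := by decide +kernel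

theorem goodE₆_iff (S : Finset (Fin 6)) (t : Fin 6) :
    Good cartanE₆ S t ↔ goodTest 6 rootsE₆ (indicatorList S) t = true :=
  cartanE₆_eq ▸ good_ofColumns_iff isRootListE₆ S t

/-- The pairs of type `E₆` that pass the test, found by evaluation for all subsets of the simple
roots. -/
theorem testE₆ : ∀ m ∈ masks 6, ∀ t : Fin 6, goodTest 6 rootsE₆ m t = true →
    (m, t) ∈ ([([0, 1, 0, 0, 0, 0], 0),
      ([0, 0, 0, 0, 0, 1], 0),
      ([0, 0, 1, 0, 0, 0], 5),
      ([1, 0, 1, 0, 0, 0], 1),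
      ([0, 1, 0, 1, 0, 1], 2),
      ([0, 0, 0, 1, 0, 0], 4),
      ([0, 0, 0, 0, 0, 1], 4),
      ([0, 0, 1, 0, 1, 0], 3)] : List (List ℕ × Fin 6)) := by
  decide +kernel

/-- The negatives of the off-diagonal entries, by columns, of the Cartan matrix of type `E₇`. -/
def columnsE₇ : List (List ℕ) :=
  [[0, 1, 0, 0, 0, 0, 0],
   [1, 0, 1, 0, 0, 0, 0],
   [0, 1, 0, 1, 0, 0, 0],
   [0, 0, 1, 0, 1, 0, 1],
   [0, 0, 0, 1, 0, 1, 0],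
   [0, 0, 0, 0, 1, 0, 0],
   [0, 0, 0, 1, 0, 0, 0]]

/-- The positive roots of type `E₇`, ordered so that `goodTest` rejects most pairs early. -/
def rootsE₇ : List (List ℕ) :=
  [[0, 0, 1, 2, 1, 0, 1], [0, 1, 1, 1, 0, 0, 0], [0, 0, 0, 1, 1, 1, 0], [0, 1, 2, 2, 2, 1, 1],
   [0, 0, 1, 1, 0, 0, 1], [1, 1, 0, 0, 0, 0, 0], [0, 0, 0, 1, 1, 0, 0], [1, 2, 2, 2, 1, 0, 1],
   [1, 1, 1, 0, 0, 0, 0], [0, 0, 0, 1, 1, 1, 1], [0, 1, 2, 3, 2, 1, 2], [0, 1, 1, 1, 1, 1, 0],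
   [1, 1, 1, 1, 0, 0, 1], [1, 2, 3, 4, 3, 2, 2], [1, 1, 1, 1, 1, 0, 0], [0, 0, 1, 2, 2, 1, 1],
   [0, 0, 0, 0, 1, 1, 0], [0, 1, 2, 2, 1, 0, 1], [1, 0, 0, 0, 0, 0, 0], [0, 1, 0, 0, 0, 0, 0],
   [0, 0, 1, 0, 0, 0, 0], [0, 0, 0, 1, 0, 0, 0], [0, 0, 0, 0, 1, 0, 0], [0, 0, 0, 0, 0, 1, 0],
   [0, 0, 0, 0, 0, 0, 1], [0, 1, 1, 0, 0, 0, 0], [0, 0, 1, 1, 0, 0, 0], [0, 0, 0, 1, 0, 0, 1],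
   [0, 0, 1, 1, 1, 0, 0], [0, 0, 0, 1, 1, 0, 1], [1, 1, 1, 1, 0, 0, 0], [0, 1, 1, 1, 1, 0, 0],
   [0, 1, 1, 1, 0, 0, 1], [0, 0, 1, 1, 1, 1, 0], [0, 0, 1, 1, 1, 0, 1], [0, 1, 1, 1, 1, 0, 1],
   [0, 0, 1, 1, 1, 1, 1], [1, 1, 1, 1, 1, 1, 0], [1, 1, 1, 1, 1, 0, 1], [0, 1, 1, 2, 1, 0, 1],
   [0, 1, 1, 1, 1, 1, 1], [0, 0, 1, 2, 1, 1, 1], [1, 1, 1, 2, 1, 0, 1], [1, 1, 1, 1, 1, 1, 1],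
   [0, 1, 1, 2, 1, 1, 1], [1, 1, 2, 2, 1, 0, 1], [1, 1, 1, 2, 1, 1, 1], [0, 1, 2, 2, 1, 1, 1],
   [0, 1, 1, 2, 2, 1, 1], [1, 1, 2, 2, 1, 1, 1], [1, 1, 1, 2, 2, 1, 1], [1, 2, 2, 2, 1, 1, 1],
   [1, 1, 2, 2, 2, 1, 1], [0, 1, 2, 3, 2, 1, 1], [1, 2, 2, 2, 2, 1, 1], [1, 1, 2, 3, 2, 1, 1],
   [1, 2, 2, 3, 2, 1, 1], [1, 1, 2, 3, 2, 1, 2], [1, 2, 3, 3, 2, 1, 1], [1, 2, 2, 3, 2, 1, 2],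
   [1, 2, 3, 3, 2, 1, 2], [1, 2, 3, 4, 2, 1, 2], [1, 2, 3, 4, 3, 1, 2]]

theorem cartanE₇_eq : cartanE₇ = ofColumns 7 columnsE₇ := by decide

theorem isRootListE₇ : isRootList 7 columnsE₇ rootsE₇ = true := by decide +kernel

theorem goodE₇_iff (S : Finset (Fin 7)) (t : Fin 7) :
    Good cartanE₇ S t ↔ goodTest 7 rootsE₇ (indicatorList S) t = true :=
  cartanE₇_eq ▸ good_ofColumns_iff isRootListE₇ S t

/-- The pairs of type `E₇` that pass the test, found by evaluation for all subsets of the simple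
roots. -/
theorem testE₇ : ∀ m ∈ masks 7, ∀ t : Fin 7, goodTest 7 rootsE₇ m t = true →
    (m, t) ∈ ([([0, 1, 0, 0, 0, 0, 0], 0),
      ([0, 0, 0, 0, 1, 0, 0], 5),
      ([0, 0, 0, 0, 0, 1, 0], 0),
      ([0, 0, 0, 1, 0, 0, 0], 6),
      ([1, 0, 1, 0, 0, 0, 0], 1),
      ([0, 1, 0, 1, 0, 0, 0], 2),
      ([0, 0, 0, 1, 0, 1, 0], 4),
      ([0, 0, 1, 0, 1, 0, 1], 3)] : List (List ℕ × Fin 7)) := by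
  decide +kernel

/-- The negatives of the off-diagonal entries, by columns, of the Cartan matrix of type `E₈`. -/
def columnsE₈ : List (List ℕ) :=
  [[0, 1, 0, 0, 0, 0, 0, 0],
   [1, 0, 1, 0, 0, 0, 0, 0],
   [0, 1, 0, 1, 0, 0, 0, 0],
   [0, 0, 1, 0, 1, 0, 0, 0],
   [0, 0, 0, 1, 0, 1, 0, 1],
   [0, 0, 0, 0, 1, 0, 1, 0],
   [0, 0, 0, 0, 0, 1, 0, 0],
   [0, 0, 0, 0, 1, 0, 0, 0]]

/-- The positive roots of type `E₈`, ordered so that `goodTest` rejects most pairs early. -/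
def rootsE₈ : List (List ℕ) :=
  [[1, 1, 1, 0, 0, 0, 0, 0], [0, 0, 0, 1, 1, 1, 0, 0], [0, 0, 0, 1, 2, 1, 0, 1],
   [0, 0, 0, 0, 1, 0, 0, 1], [0, 0, 0, 1, 2, 2, 1, 1], [0, 0, 1, 2, 2, 1, 0, 1],
   [0, 0, 0, 1, 1, 0, 0, 0], [0, 0, 1, 1, 1, 1, 1, 0], [0, 1, 2, 2, 3, 2, 1, 2],
   [1, 1, 0, 0, 0, 0, 0, 0], [0, 0, 0, 0, 0, 1, 1, 0], [1, 1, 1, 1, 1, 0, 0, 0],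
   [1, 2, 2, 2, 2, 1, 0, 1], [0, 0, 0, 0, 1, 1, 1, 1], [0, 1, 1, 1, 1, 0, 0, 1],
   [0, 1, 2, 3, 4, 3, 2, 2], [1, 1, 1, 1, 0, 0, 0, 0], [0, 1, 1, 1, 1, 1, 0, 0],
   [0, 1, 2, 2, 2, 1, 0, 1], [2, 3, 4, 5, 6, 4, 2, 3], [1, 0, 0, 0, 0, 0, 0, 0],
   [0, 1, 0, 0, 0, 0, 0, 0], [0, 0, 1, 0, 0, 0, 0, 0], [0, 0, 0, 1, 0, 0, 0, 0],
   [0, 0, 0, 0, 1, 0, 0, 0], [0, 0, 0, 0, 0, 1, 0, 0], [0, 0, 0, 0, 0, 0, 1, 0],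
   [0, 0, 0, 0, 0, 0, 0, 1], [0, 1, 1, 0, 0, 0, 0, 0], [0, 0, 1, 1, 0, 0, 0, 0],
   [0, 0, 0, 0, 1, 1, 0, 0], [0, 1, 1, 1, 0, 0, 0, 0], [0, 0, 1, 1, 1, 0, 0, 0],
   [0, 0, 0, 1, 1, 0, 0, 1], [0, 0, 0, 0, 1, 1, 1, 0], [0, 0, 0, 0, 1, 1, 0, 1],
   [0, 1, 1, 1, 1, 0, 0, 0], [0, 0, 1, 1, 1, 1, 0, 0], [0, 0, 1, 1, 1, 0, 0, 1],
   [0, 0, 0, 1, 1, 1, 1, 0], [0, 0, 0, 1, 1, 1, 0, 1], [0, 0, 1, 1, 1, 1, 0, 1],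
   [0, 0, 0, 1, 1, 1, 1, 1], [1, 1, 1, 1, 1, 1, 0, 0], [1, 1, 1, 1, 1, 0, 0, 1],
   [0, 1, 1, 1, 1, 1, 1, 0], [0, 1, 1, 1, 1, 1, 0, 1], [0, 0, 1, 1, 2, 1, 0, 1],
   [0, 0, 1, 1, 1, 1, 1, 1], [0, 0, 0, 1, 2, 1, 1, 1], [1, 1, 1, 1, 1, 1, 1, 0],
   [1, 1, 1, 1, 1, 1, 0, 1], [0, 1, 1, 1, 2, 1, 0, 1], [0, 1, 1, 1, 1, 1, 1, 1],
   [0, 0, 1, 1, 2, 1, 1, 1], [1, 1, 1, 1, 2, 1, 0, 1], [1, 1, 1, 1, 1, 1, 1, 1],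
   [0, 1, 1, 2, 2, 1, 0, 1], [0, 1, 1, 1, 2, 1, 1, 1], [0, 0, 1, 2, 2, 1, 1, 1],
   [0, 0, 1, 1, 2, 2, 1, 1], [1, 1, 1, 2, 2, 1, 0, 1], [1, 1, 1, 1, 2, 1, 1, 1],
   [0, 1, 1, 2, 2, 1, 1, 1], [0, 1, 1, 1, 2, 2, 1, 1], [0, 0, 1, 2, 2, 2, 1, 1],
   [1, 1, 2, 2, 2, 1, 0, 1], [1, 1, 1, 2, 2, 1, 1, 1], [1, 1, 1, 1, 2, 2, 1, 1],
   [0, 1, 2, 2, 2, 1, 1, 1], [0, 1, 1, 2, 2, 2, 1, 1], [0, 0, 1, 2, 3, 2, 1, 1],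
   [1, 1, 2, 2, 2, 1, 1, 1], [1, 1, 1, 2, 2, 2, 1, 1], [0, 1, 2, 2, 2, 2, 1, 1],
   [0, 1, 1, 2, 3, 2, 1, 1], [0, 0, 1, 2, 3, 2, 1, 2], [1, 2, 2, 2, 2, 1, 1, 1],
   [1, 1, 2, 2, 2, 2, 1, 1], [1, 1, 1, 2, 3, 2, 1, 1], [0, 1, 2, 2, 3, 2, 1, 1],
   [0, 1, 1, 2, 3, 2, 1, 2], [1, 2, 2, 2, 2, 2, 1, 1], [1, 1, 2, 2, 3, 2, 1, 1],
   [1, 1, 1, 2, 3, 2, 1, 2], [0, 1, 2, 3, 3, 2, 1, 1], [1, 2, 2, 2, 3, 2, 1, 1],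
   [1, 1, 2, 3, 3, 2, 1, 1], [1, 1, 2, 2, 3, 2, 1, 2], [0, 1, 2, 3, 3, 2, 1, 2],
   [1, 2, 2, 3, 3, 2, 1, 1], [1, 2, 2, 2, 3, 2, 1, 2], [1, 1, 2, 3, 3, 2, 1, 2],
   [0, 1, 2, 3, 4, 2, 1, 2], [1, 2, 3, 3, 3, 2, 1, 1], [1, 2, 2, 3, 3, 2, 1, 2],
   [1, 1, 2, 3, 4, 2, 1, 2], [0, 1, 2, 3, 4, 3, 1, 2], [1, 2, 3, 3, 3, 2, 1, 2],
   [1, 2, 2, 3, 4, 2, 1, 2], [1, 1, 2, 3, 4, 3, 1, 2], [1, 2, 3, 3, 4, 2, 1, 2],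
   [1, 2, 2, 3, 4, 3, 1, 2], [1, 1, 2, 3, 4, 3, 2, 2], [1, 2, 3, 4, 4, 2, 1, 2],
   [1, 2, 3, 3, 4, 3, 1, 2], [1, 2, 2, 3, 4, 3, 2, 2], [1, 2, 3, 4, 4, 3, 1, 2],
   [1, 2, 3, 3, 4, 3, 2, 2], [1, 2, 3, 4, 5, 3, 1, 2], [1, 2, 3, 4, 4, 3, 2, 2],
   [1, 2, 3, 4, 5, 3, 2, 2], [1, 2, 3, 4, 5, 3, 1, 3], [1, 2, 3, 4, 5, 4, 2, 2],
   [1, 2, 3, 4, 5, 3, 2, 3], [1, 2, 3, 4, 5, 4, 2, 3], [1, 2, 3, 4, 6, 4, 2, 3],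
   [1, 2, 3, 5, 6, 4, 2, 3], [1, 2, 4, 5, 6, 4, 2, 3], [1, 3, 4, 5, 6, 4, 2, 3]]

theorem cartanE₈_eq : cartanE₈ = ofColumns 8 columnsE₈ := by decide

theorem isRootListE₈ : isRootList 8 columnsE₈ rootsE₈ = true := by decide +kernel

theorem goodE₈_iff (S : Finset (Fin 8)) (t : Fin 8) :
    Good cartanE₈ S t ↔ goodTest 8 rootsE₈ (indicatorList S) t = true :=
  cartanE₈_eq ▸ good_ofColumns_iff isRootListE₈ S t

/-- The pairs of type `E₈` that pass the test, found by evaluation for all subsets of the simple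
roots. -/
theorem testE₈ : ∀ m ∈ masks 8, ∀ t : Fin 8, goodTest 8 rootsE₈ m t = true →
    (m, t) ∈ ([([0, 1, 0, 0, 0, 0, 0, 0], 0),
      ([0, 0, 0, 0, 0, 1, 0, 0], 6),
      ([0, 0, 0, 0, 1, 0, 0, 0], 7),
      ([1, 0, 1, 0, 0, 0, 0, 0], 1),
      ([0, 1, 0, 1, 0, 0, 0, 0], 2),
      ([0, 0, 1, 0, 1, 0, 0, 0], 3),
      ([0, 0, 0, 0, 1, 0, 1, 0], 5),
      ([0, 0, 0, 1, 0, 1, 0, 1], 4)] : List (List ℕ × Fin 8)) := by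
  decide +kernel

/-- If the numbering of a row of the table is changed by an automorphism `π` of the diagram, the
resulting pair is listed. -/
theorem listed_of_indicatorList {n : ℕ} {A : Matrix (Fin n) (Fin n) ℤ} {T : Finset ℕ} {k : ℕ}
    (hT : TableEntry n A T {k}) (π : Equiv.Perm (Fin n)) (hπ : A.submatrix π π = A)
    {S : Finset (Fin n)} {t : Fin n} {m : List ℕ} (hm : indicatorList S = m)
    (hS : ∀ i : Fin n, m.getD (π i) 0 = if (i : ℕ) + 1 ∈ T then 1 else 0)
    (ht : ∀ i : Fin n, π i = t ↔ (i : ℕ) + 1 = k) : Listed A S {t} := by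
  refine ⟨n, A, T, {k}, π, hT, fun i j ↦ congr_fun₂ hπ i j, fun i ↦ ?_, fun i ↦ by simp [ht]⟩
  have h := vec_indicatorList S (π i)
  rw [vec, hm, hS] at h
  by_cases h₁ : π i ∈ S <;> by_cases h₂ : (i : ℕ) + 1 ∈ T <;> simp_all

/-- The labels of the simple roots in a row of the table, as indices. -/
def labelled (n : ℕ) (T : Finset ℕ) : Finset (Fin n) := {i | (i : ℕ) + 1 ∈ T}

/-- The nontrivial automorphism of the Dynkin diagram of type `E₆`. -/
def flipE₆ : Equiv.Perm (Fin 6) :=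
  ⟨![4, 3, 2, 1, 0, 5], ![4, 3, 2, 1, 0, 5], by decide, by decide⟩

theorem Good.listedG₂ {S : Finset (Fin 2)} {t : Fin 2} (h : Good cartanG₂ S t) :
    Listed cartanG₂ S {t} := by
  have := testG₂ _ (indicatorList_mem_masks S) t ((goodG₂_iff S t).1 h)
  simp only [List.mem_cons, List.not_mem_nil, or_false, Prod.mk.injEq] at this
  obtain ⟨hm, rfl⟩ := this
  exact listed_of_indicatorList .G₂ (Equiv.refl _) (by decide) hm (by decide) (by decide)

theorem Good.listedF₄ {S : Finset (Fin 4)} {t : Fin 4} (h : Good cartanF₄ S t) :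
    Listed cartanF₄ S {t} := by
  have := testF₄ _ (indicatorList_mem_masks S) t ((goodF₄_iff S t).1 h)
  simp only [List.mem_cons, List.not_mem_nil, or_false, Prod.mk.injEq] at this
  rcases this with ⟨hm, rfl⟩ | ⟨hm, rfl⟩
  · exact listed_of_indicatorList .F₄_2_1 (Equiv.refl _) (by decide) hm (by decide) (by decide)
  · exact listed_of_indicatorList .F₄_13_2 (Equiv.refl _) (by decide) hm (by decide) (by decide)

theorem Good.listedE₆ {S : Finset (Fin 6)} {t : Fin 6} (h : Good cartanE₆ S t) :
    Listed cartanE₆ S {t} := by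
  have := testE₆ _ (indicatorList_mem_masks S) t ((goodE₆_iff S t).1 h)
  simp only [List.mem_cons, List.not_mem_nil, or_false, Prod.mk.injEq] at this
  rcases this with ⟨hm, rfl⟩ | ⟨hm, rfl⟩ | ⟨hm, rfl⟩ | ⟨hm, rfl⟩ | ⟨hm, rfl⟩ | ⟨hm, rfl⟩ |
    ⟨hm, rfl⟩ | ⟨hm, rfl⟩
  · exact listed_of_indicatorList .E₆_2_1 (Equiv.refl _) (by decide) hm (by decide) (by decide)
  · exact listed_of_indicatorList .E₆_6_1 (Equiv.refl _) (by decide) hm (by decide) (by decide)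
  · exact listed_of_indicatorList .E₆_3_6 (Equiv.refl _) (by decide) hm (by decide) (by decide)
  · exact listed_of_indicatorList .E₆_13_2 (Equiv.refl _) (by decide) hm (by decide) (by decide)
  · exact listed_of_indicatorList .E₆_246_3 (Equiv.refl _) (by decide) hm (by decide) (by decide)
  · exact listed_of_indicatorList .E₆_2_1 flipE₆ (by decide) hm (by decide) (by decide)
  · exact listed_of_indicatorList .E₆_6_1 flipE₆ (by decide) hm (by decide) (by decide)
  · exact listed_of_indicatorList .E₆_13_2 flipE₆ (by decide) hm (by decide) (by decide)

theorem Good.listedE₇ {S : Finset (Fin 7)} {t : Fin 7} (h : Good cartanE₇ S t) :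
    Listed cartanE₇ S {t} := by
  have := testE₇ _ (indicatorList_mem_masks S) t ((goodE₇_iff S t).1 h)
  simp only [List.mem_cons, List.not_mem_nil, or_false, Prod.mk.injEq] at this
  rcases this with ⟨hm, rfl⟩ | ⟨hm, rfl⟩ | ⟨hm, rfl⟩ | ⟨hm, rfl⟩ | ⟨hm, rfl⟩ | ⟨hm, rfl⟩ |
    ⟨hm, rfl⟩ | ⟨hm, rfl⟩
  · exact listed_of_indicatorList .E₇_2_1 (Equiv.refl _) (by decide) hm (by decide) (by decide)
  · exact listed_of_indicatorList .E₇_5_6 (Equiv.refl _) (by decide) hm (by decide) (by decide)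
  · exact listed_of_indicatorList .E₇_6_1 (Equiv.refl _) (by decide) hm (by decide) (by decide)
  · exact listed_of_indicatorList .E₇_4_7 (Equiv.refl _) (by decide) hm (by decide) (by decide)
  · exact listed_of_indicatorList .E₇_13_2 (Equiv.refl _) (by decide) hm (by decide) (by decide)
  · exact listed_of_indicatorList .E₇_24_3 (Equiv.refl _) (by decide) hm (by decide) (by decide)
  · exact listed_of_indicatorList .E₇_46_5 (Equiv.refl _) (by decide) hm (by decide) (by decide)
  · exact listed_of_indicatorList .E₇_357_4 (Equiv.refl _) (by decide) hm (by decide) (by decide)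

theorem Good.listedE₈ {S : Finset (Fin 8)} {t : Fin 8} (h : Good cartanE₈ S t) :
    Listed cartanE₈ S {t} := by
  have := testE₈ _ (indicatorList_mem_masks S) t ((goodE₈_iff S t).1 h)
  simp only [List.mem_cons, List.not_mem_nil, or_false, Prod.mk.injEq] at this
  rcases this with ⟨hm, rfl⟩ | ⟨hm, rfl⟩ | ⟨hm, rfl⟩ | ⟨hm, rfl⟩ | ⟨hm, rfl⟩ | ⟨hm, rfl⟩ |
    ⟨hm, rfl⟩ | ⟨hm, rfl⟩
  · exact listed_of_indicatorList .E₈_2_1 (Equiv.refl _) (by decide) hm (by decide) (by decide)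
  · exact listed_of_indicatorList .E₈_6_7 (Equiv.refl _) (by decide) hm (by decide) (by decide)
  · exact listed_of_indicatorList .E₈_5_8 (Equiv.refl _) (by decide) hm (by decide) (by decide)
  · exact listed_of_indicatorList .E₈_13_2 (Equiv.refl _) (by decide) hm (by decide) (by decide)
  · exact listed_of_indicatorList .E₈_24_3 (Equiv.refl _) (by decide) hm (by decide) (by decide)
  · exact listed_of_indicatorList .E₈_35_4 (Equiv.refl _) (by decide) hm (by decide) (by decide)
  · exact listed_of_indicatorList .E₈_57_6 (Equiv.refl _) (by decide) hm (by decide) (by decide)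
  · exact listed_of_indicatorList .E₈_468_5 (Equiv.refl _) (by decide) hm (by decide) (by decide)

end Exceptional

/-! ### Coordinates for the classical types -/

section Coordinates

variable {n : ℕ}

/-- The coordinate of `v` at the simple root with label `k`, where labels run from `1` to `n`; it
is `0` for other `k`. -/
def coord (v : Fin n → ℤ) (k : ℕ) : ℤ := if h : 1 ≤ k ∧ k ≤ n then v ⟨k - 1, by omega⟩ else 0

theorem coord_succ (v : Fin n → ℤ) (i : Fin n) : coord v (i + 1) = v i := by
  have : 1 ≤ (i : ℕ) + 1 ∧ (i : ℕ) + 1 ≤ n := by omega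
  simp [coord]

theorem coord_eq_zero (v : Fin n → ℤ) {k : ℕ} (hk : k = 0 ∨ n < k) : coord v k = 0 := by
  rw [coord, dif_neg (by omega)]

theorem coord_single (i : Fin n) (k : ℕ) :
    coord (Pi.single i 1 : Fin n → ℤ) k = if k = i + 1 then 1 else 0 := by
  by_cases h : 1 ≤ k ∧ k ≤ n
  · rw [coord, dif_pos h, Pi.single_apply]
    congr 1
    rw [Fin.ext_iff, eq_iff_iff]
    simp only
    omega
  · rw [coord, dif_neg h, if_neg]
    omega

theorem coord_simpleReflection (A : Matrix (Fin n) (Fin n) ℤ) (j : Fin n) (v : Fin n → ℤ) (k : ℕ) :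
    coord (simpleReflection A j v) k =
      if k = j + 1 then coord v (j + 1) - ∑ i, v i * A i j else coord v k := by
  split_ifs with h
  · rw [h, coord_succ, coord_succ, simpleReflection, Function.update_self]
  · by_cases hk : 1 ≤ k ∧ k ≤ n
    · rw [coord, coord, dif_pos hk, dif_pos hk, simpleReflection, Function.update_of_ne]
      rw [ne_eq, Fin.ext_iff]
      simp only
      omega
    · rw [coord, coord, dif_neg hk, dif_neg hk]

theorem sum_mul_ite (v : Fin n → ℤ) (a : ℕ) (c : ℤ) :
    ∑ i, v i * (if (i : ℕ) + 1 = a then c else 0) = c * coord v a := by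
  by_cases h : 1 ≤ a ∧ a ≤ n
  · rw [Finset.sum_eq_single ⟨a - 1, by omega⟩, if_pos (by simp only; omega), coord, dif_pos h,
      mul_comm]
    · intro i _ hi
      rw [if_neg, mul_zero]
      rw [ne_eq, Fin.ext_iff] at hi
      simp only at hi
      omega
    · simp
  · rw [coord, dif_neg h, mul_zero]
    refine Finset.sum_eq_zero fun i _ ↦ ?_
    rw [if_neg (by omega), mul_zero]

theorem sum_mul_A (v : Fin n → ℤ) (j : Fin n) :
    ∑ i, v i * CartanMatrix.A n i j = 2 * coord v (j + 1) - coord v j - coord v (j + 2) := by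
  have h (i : Fin n) : v i * CartanMatrix.A n i j = v i * (if (i : ℕ) + 1 = j + 1 then 2 else 0) +
      v i * (if (i : ℕ) + 1 = j then -1 else 0) +
      v i * (if (i : ℕ) + 1 = j + 2 then -1 else 0) := by
    rw [← mul_add, ← mul_add]
    simp only [CartanMatrix.A, Matrix.of_apply, Fin.ext_iff]
    congr 1
    split_ifs <;> omega
  simp only [h, Finset.sum_add_distrib, sum_mul_ite]
  ring

theorem sum_mul_B (v : Fin n → ℤ) (j : Fin n) :
    ∑ i, v i * CartanMatrix.B n i j =
      2 * coord v (j + 1) - (if (j : ℕ) + 1 = n then 2 else 1) * coord v j - coord v (j + 2) := by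
  have h (i : Fin n) : v i * CartanMatrix.B n i j = v i * (if (i : ℕ) + 1 = j + 1 then 2 else 0) +
      v i * (if (i : ℕ) + 1 = j then -(if (j : ℕ) + 1 = n then 2 else 1) else 0) +
      v i * (if (i : ℕ) + 1 = j + 2 then -1 else 0) := by
    rw [← mul_add, ← mul_add]
    simp only [CartanMatrix.B, Matrix.of_apply, Fin.ext_iff]
    congr 1
    split_ifs <;> omega
  simp only [h, Finset.sum_add_distrib, sum_mul_ite]
  ring

theorem sum_mul_C (v : Fin n → ℤ) (j : Fin n) :
    ∑ i, v i * CartanMatrix.C n i j =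
      2 * coord v (j + 1) - coord v j - (if (j : ℕ) + 2 = n then 2 else 1) * coord v (j + 2) := by
  have h (i : Fin n) : v i * CartanMatrix.C n i j = v i * (if (i : ℕ) + 1 = j + 1 then 2 else 0) +
      v i * (if (i : ℕ) + 1 = j then -1 else 0) +
      v i * (if (i : ℕ) + 1 = j + 2 then -(if (j : ℕ) + 2 = n then 2 else 1) else 0) := by
    rw [← mul_add, ← mul_add]
    simp only [CartanMatrix.C, Matrix.of_apply, Fin.ext_iff]
    congr 1
    split_ifs <;> omega
  simp only [h, Finset.sum_add_distrib, sum_mul_ite]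
  ring

theorem sum_mul_D (hn : 4 ≤ n) (v : Fin n → ℤ) (j : Fin n) :
    ∑ i, v i * CartanMatrix.D n i j = 2 * coord v (j + 1) -
      (if (j : ℕ) + 1 = n then coord v (n - 2) else
      coord v j + (if (j : ℕ) + 2 = n then 0 else coord v (j + 2)) +
      (if (j : ℕ) + 3 = n then coord v n else 0)) := by
  have h (i : Fin n) : v i * CartanMatrix.D n i j = v i * (if (i : ℕ) + 1 = j + 1 then 2 else 0) +
      v i * (if (i : ℕ) + 1 = n - 2 then -(if (j : ℕ) + 1 = n then 1 else 0) else 0) +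
      v i * (if (i : ℕ) + 1 = j then -(if (j : ℕ) + 1 = n then 0 else 1) else 0) +
      v i * (if (i : ℕ) + 1 = j + 2 then -(if (j : ℕ) + 2 = n ∨ (j : ℕ) + 1 = n then 0 else 1)
        else 0) +
      v i * (if (i : ℕ) + 1 = n then -(if (j : ℕ) + 3 = n then 1 else 0) else 0) := by
    rw [← mul_add, ← mul_add, ← mul_add, ← mul_add]
    have hi := i.2
    simp only [CartanMatrix.D, Matrix.of_apply, Fin.ext_iff, if_neg (show ¬n ≤ 2 by omega)]
    congr 1
    rcases (by omega : (j : ℕ) + 1 = n ∨ (j : ℕ) + 2 = n ∨ (j : ℕ) + 3 = n ∨ (j : ℕ) + 3 < n)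
      with h | h | h | h
    · simp only [h, show ¬(j : ℕ) + 2 < n by omega, show ¬(j : ℕ) + 3 = n by omega,
        show ¬(j : ℕ) + 2 = n by omega, and_false, false_and, if_false, or_true, and_true, if_true]
      split_ifs <;> omega
    · simp only [h, show ¬(j : ℕ) + 1 = n by omega, show ¬(j : ℕ) + 3 = n by omega, lt_irrefl,
        and_false, false_and, if_false, true_or, and_true, if_true]
      split_ifs <;> omega
    · simp only [h, show ¬(j : ℕ) + 1 = n by omega, show ¬(j : ℕ) + 2 = n by omega,
        show (j : ℕ) + 2 < n by omega, and_false, or_false, true_and, if_false, and_true, if_true]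
      split_ifs <;> omega
    · simp only [show ¬(j : ℕ) + 1 = n by omega, show ¬(j : ℕ) + 2 = n by omega,
        show ¬(j : ℕ) + 3 = n by omega, show (j : ℕ) + 2 < n by omega, and_false, or_false,
        false_and, if_false, and_true]
      split_ifs <;> omega
  simp only [h, Finset.sum_add_distrib, sum_mul_ite]
  rcases (by omega : (j : ℕ) + 1 = n ∨ (j : ℕ) + 2 = n ∨ (j : ℕ) + 3 = n ∨ (j : ℕ) + 3 < n)
    with h | h | h | h
  · simp [h, show ¬(j : ℕ) + 3 = n by omega]
    ring
  · simp [h, show ¬(j : ℕ) + 1 = n by omega, show ¬(j : ℕ) + 3 = n by omega]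
    ring
  · simp [h, show ¬(j : ℕ) + 1 = n by omega, show ¬(j : ℕ) + 2 = n by omega]
    ring
  · simp [show ¬(j : ℕ) + 1 = n by omega, show ¬(j : ℕ) + 2 = n by omega,
      show ¬(j : ℕ) + 3 = n by omega]
    ring

/-- The indicator function of the labels from `a` on. It represents the unit vector `e_a`: for the
classical types, a vector is described by the sums of its first `k` coordinates with respect to the
unit vectors, for all `k`, and these sums are `ind a k` for `e_a`. For the types `A` and `B`, where
`α_k = e_k - e_{k+1}`, they are also the coordinates with respect to the simple roots. -/
def ind (a k : ℕ) : ℤ := if a ≤ k then 1 else 0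

/-- The reflection in `e_j - e_{j+1}` exchanges `e_j` and `e_{j+1}`. -/
theorem ind_swap (a : ℕ) {j k : ℕ} (hj : 1 ≤ j) :
    ind (Equiv.swap j (j + 1) a) k = if k = j then ind a (j - 1) + ind a (j + 1) - ind a j
      else ind a k := by
  simp only [ind, Equiv.swap_apply_def]
  split_ifs <;> omega

/-- The sum over a set of simple roots, given by labels. -/
theorem sum_labelled (v : Fin n → ℤ) {T : Finset ℕ} (hT : ∀ k ∈ T, 1 ≤ k ∧ k ≤ n) :
    ∑ i ∈ labelled n T, v i = ∑ k ∈ T, coord v k := by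
  refine Finset.sum_bij (fun i _ ↦ (i : ℕ) + 1) ?_ ?_ ?_ ?_
  · intro i hi; simpa [labelled] using hi
  · intro i _ j _ h; exact Fin.ext (by omega)
  · intro k hk
    exact ⟨⟨k - 1, by have := hT k hk; omega⟩,
      by have := hT k hk; simp [labelled, Nat.sub_add_cancel this.1, hk],
      Nat.sub_add_cancel (hT k hk).1⟩
  · intro i _; exact (coord_succ v i).symm

/-- `Good` in terms of labels. -/
theorem good_of_labels {A : Matrix (Fin n) (Fin n) ℤ} {T : Finset ℕ} {t : ℕ}
    (hT : ∀ k ∈ T, 1 ≤ k ∧ k ≤ n) (ht : 1 ≤ t ∧ t ≤ n) (htT : t ∉ T)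
    (bounds : ∀ v, IsRootVec A v → (∑ k ∈ T, coord v k = 0 → coord v t ≤ 1) ∧
      (∑ k ∈ T, coord v k = 1 → coord v t = 0 ∨ coord v t = 1) ∧
      (∑ k ∈ T, coord v k = 2 → coord v t = 1))
    (exists_two : ∀ k ∈ T, ∃ v, IsRootVec A v ∧ ∑ k ∈ T, coord v k = 2 ∧ 0 < coord v k)
    (exists_one : ∃ v, IsRootVec A v ∧ ∑ k ∈ T, coord v k = 1 ∧ coord v t = 1) :
    ∃ σ : Fin n, ({t} : Finset ℕ) = {(σ : ℕ) + 1} ∧ Good A (labelled n T) σ := by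
  obtain ⟨σ, rfl⟩ : ∃ σ : Fin n, t = σ + 1 := ⟨⟨t - 1, by omega⟩, by simp only; omega⟩
  simp only [← sum_labelled _ hT, coord_succ] at *
  refine ⟨σ, rfl, by simpa [labelled] using htT, fun v hv ↦ (bounds v hv).1,
    fun v hv ↦ (bounds v hv).2.1, fun v hv ↦ (bounds v hv).2.2, fun i hi ↦ ?_, exists_one⟩
  simpa only [coord_succ] using exists_two (i + 1) (by simpa [labelled] using hi)

/-- The labels of a set of simple roots. -/
def labels (S : Finset (Fin n)) : Finset ℕ := S.image fun i : Fin n ↦ (i : ℕ) + 1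

theorem mem_labels {S : Finset (Fin n)} {i : Fin n} : (i : ℕ) + 1 ∈ labels S ↔ i ∈ S := by
  simp only [labels, Finset.mem_image]
  exact ⟨fun ⟨j, hj, h⟩ ↦ (Fin.ext (by omega) : j = i) ▸ hj, fun h ↦ ⟨i, h, rfl⟩⟩

theorem le_of_mem_labels {S : Finset (Fin n)} {k : ℕ} (hk : k ∈ labels S) : 1 ≤ k ∧ k ≤ n := by
  simp only [labels, Finset.mem_image] at hk
  obtain ⟨i, -, rfl⟩ := hk
  omega

theorem sum_labels (S : Finset (Fin n)) (v : Fin n → ℤ) :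
    ∑ k ∈ labels S, coord v k = ∑ i ∈ S, v i := by
  rw [labels, Finset.sum_image fun i _ j _ h ↦ Fin.ext (by omega)]
  simp [coord_succ]

/-- A table row whose labels are those of `S` and `σ`, up to an automorphism. -/
theorem listed_of_labels {A : Matrix (Fin n) (Fin n) ℤ} {S : Finset (Fin n)} {σ : Fin n}
    (h : TableEntry n A (labels S) {(σ : ℕ) + 1}) : Listed A S {σ} :=
  ⟨n, A, _, _, Equiv.refl _, h, fun _ _ ↦ rfl, fun i ↦ mem_labels.symm,
    fun i ↦ by simp [Fin.ext_iff]⟩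

end Coordinates

/-! ### The roots of the classical types -/

section ClassicalRoots

variable {n N : ℕ} {A : Matrix (Fin n) (Fin n) ℤ} {w : (Fin n → ℤ) → ℕ → ℤ}

/-- The first simple reflections act on the coordinates `w v` like the transpositions
of adjacent unit vectors `e_j`, `e_{j+1}`, `j + 1 ≤ N`, act on sums of coordinates. -/
def SwapsCoordinates (A : Matrix (Fin n) (Fin n) ℤ) (w : (Fin n → ℤ) → ℕ → ℤ) (N : ℕ) : Prop :=
  ∀ (j : Fin n) (v : Fin n → ℤ) (k : ℕ), (j : ℕ) + 1 < N → k ≤ N →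
    w (simpleReflection A j v) k =
      if k = j + 1 then w v j + w v (j + 2) - w v (j + 1) else w v k

/-- Some root has the form `ε e_a + δ e_b`. -/
def HasRoot (A : Matrix (Fin n) (Fin n) ℤ) (w : (Fin n → ℤ) → ℕ → ℤ) (N : ℕ)
    (ε : ℤ) (a : ℕ) (δ : ℤ) (b : ℕ) : Prop :=
  ∃ v, IsRootVec A v ∧ ∀ k ≤ N, w v k = ε * ind a k + δ * ind b k

theorem SwapsCoordinates.eq_swap (h : SwapsCoordinates A w N) {v : Fin n → ℤ} {ε δ : ℤ} {a b : ℕ}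
    (hv : ∀ k ≤ N, w v k = ε * ind a k + δ * ind b k) {j : Fin n} (hj : (j : ℕ) + 1 < N) :
    ∀ k ≤ N, w (simpleReflection A j v) k = ε * ind (Equiv.swap ((j : ℕ) + 1) (j + 1 + 1) a) k +
      δ * ind (Equiv.swap ((j : ℕ) + 1) (j + 1 + 1) b) k := by
  intro k hk
  rw [h j v k hj hk, ind_swap a (Nat.le_add_left 1 j), ind_swap b (Nat.le_add_left 1 j),
    hv k hk, hv j (by omega), hv (j + 1) (by omega), hv (j + 2) (by omega)]
  split_ifs
  · simp only [Nat.add_sub_cancel]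
    ring
  · ring

theorem HasRoot.swap (h : SwapsCoordinates A w N) {ε δ : ℤ} {a b : ℕ} (H : HasRoot A w N ε a δ b)
    {j : ℕ} (hj : 1 ≤ j) (hjn : j ≤ n) (hjN : j < N) :
    HasRoot A w N ε (Equiv.swap j (j + 1) a) δ (Equiv.swap j (j + 1) b) := by
  obtain ⟨v, hv, hv'⟩ := H
  obtain ⟨j, rfl⟩ : ∃ i : Fin n, j = i + 1 := ⟨⟨j - 1, by omega⟩, by simp only; omega⟩
  exact ⟨_, hv.reflect v j, h.eq_swap hv' hjN⟩

/-- The second index of `ε e_a + δ e_b` can be raised. -/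
theorem HasRoot.raise (h : SwapsCoordinates A w N) (hN : N ≤ n + 1) {ε δ : ℤ} {a b c : ℕ}
    (H : HasRoot A w N ε a δ b) (hab : a < b) (hbc : b ≤ c) (hc : c ≤ N) :
    HasRoot A w N ε a δ c := by
  induction c, hbc using Nat.le_induction with
  | base => exact H
  | succ c hbc ih =>
    have := (ih (by omega)).swap h (j := c) (by omega) (by omega) (by omega)
    rwa [Equiv.swap_apply_of_ne_of_ne (by omega) (by omega), Equiv.swap_apply_left] at this

/-- The second index of `ε e_a + δ e_b` can be lowered, as long as it stays above the first one. -/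
theorem HasRoot.lower (h : SwapsCoordinates A w N) (hN : N ≤ n + 1) {ε δ : ℤ} {a b c : ℕ}
    (H : HasRoot A w N ε a δ c) (ha : 1 ≤ a) (hab : a < b) (hbc : b ≤ c) (hc : c ≤ N) :
    HasRoot A w N ε a δ b := by
  induction hbc using Nat.decreasingInduction with
  | self => exact H
  | of_succ b hb ih =>
    have := (ih (by omega)).swap h (j := b) (by omega) (by omega) (by omega)
    rwa [Equiv.swap_apply_of_ne_of_ne (by omega) (by omega), Equiv.swap_apply_right] at this

/-- The first index of `ε e_a + δ e_b` can be lowered, if it is below the second one. -/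
theorem HasRoot.lower_left (h : SwapsCoordinates A w N) (hN : N ≤ n + 1) {ε δ : ℤ} {a b c : ℕ}
    (H : HasRoot A w N ε b δ c) (ha : 1 ≤ a) (hab : a ≤ b) (hbc : b < c) (hb : b ≤ N) :
    HasRoot A w N ε a δ c := by
  induction hab using Nat.decreasingInduction with
  | self => exact H
  | of_succ a hb ih =>
    have := (ih (by omega)).swap h (j := a) (by omega) (by omega) (by omega)
    rwa [Equiv.swap_apply_right, Equiv.swap_apply_of_ne_of_ne (by omega) (by omega)] at this

/-- Both indices of `ε e_a + δ e_a` can be lowered. -/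
theorem HasRoot.lower_both (h : SwapsCoordinates A w N) (hN : N ≤ n + 1) {ε δ : ℤ} {a b : ℕ}
    (H : HasRoot A w N ε b δ b) (ha : 1 ≤ a) (hab : a ≤ b) (hb : b ≤ N) :
    HasRoot A w N ε a δ a := by
  induction hab using Nat.decreasingInduction with
  | self => exact H
  | of_succ a hb ih =>
    have := (ih (by omega)).swap h (j := a) (by omega) (by omega) (by omega)
    rwa [Equiv.swap_apply_right] at this

theorem swap_mem {N a j : ℕ} (ha : 1 ≤ a ∧ a ≤ N) (hj : 1 ≤ j) (hjN : j < N) :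
    1 ≤ Equiv.swap j (j + 1) a ∧ Equiv.swap j (j + 1) a ≤ N := by
  rw [Equiv.swap_apply_def]
  split_ifs <;> omega

/-! #### Type `A` -/

theorem swapsCoordinates_A : SwapsCoordinates (CartanMatrix.A n) coord (n + 1) := by
  intro j v k _ _
  rw [coord_simpleReflection, sum_mul_A]
  split_ifs <;> ring

/-- The roots of type `A` have the form `e_a - e_b` with `a ≠ b`. -/
theorem IsRootVec.form_A {v : Fin n → ℤ} (hv : IsRootVec (CartanMatrix.A n) v) :
    ∃ a b, a ≠ b ∧ (1 ≤ a ∧ a ≤ n + 1) ∧ (1 ≤ b ∧ b ≤ n + 1) ∧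
      ∀ k ≤ n + 1, coord v k = 1 * ind a k + -1 * ind b k := by
  induction hv with
  | simple i =>
    refine ⟨i + 1, i + 2, by omega, by omega, by omega, fun k _ ↦ ?_⟩
    simp only [coord_single, ind]
    split_ifs <;> omega
  | reflect v j _ ih =>
    obtain ⟨a, b, hab, ha, hb, h⟩ := ih
    exact ⟨_, _, (Equiv.swap _ _).injective.ne hab, swap_mem ha (by omega) (by omega),
      swap_mem hb (by omega) (by omega), swapsCoordinates_A.eq_swap h (by omega)⟩

/-- `e_a - e_b` is a root for `a < b`. -/
theorem hasRoot_A {a b : ℕ} (ha : 1 ≤ a) (hab : a < b) (hb : b ≤ n + 1) :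
    HasRoot (CartanMatrix.A n) coord (n + 1) 1 a (-1) b := by
  have : HasRoot (CartanMatrix.A n) coord (n + 1) 1 a (-1) (a + 1) := by
    refine ⟨_, .simple ⟨a - 1, by omega⟩, fun k _ ↦ ?_⟩
    simp only [coord_single, ind]
    split_ifs <;> omega
  exact this.raise swapsCoordinates_A le_rfl (by omega) hab hb

/-! #### Type `B` -/

theorem swapsCoordinates_B : SwapsCoordinates (CartanMatrix.B n) coord n := by
  intro j v k hj _
  rw [coord_simpleReflection, sum_mul_B, if_neg (by omega : (j : ℕ) + 1 ≠ n)]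
  split_ifs <;> ring

theorem coord_simpleReflection_B_last {j : Fin n} (hj : (j : ℕ) + 1 = n) (v : Fin n → ℤ) (k : ℕ) :
    coord (simpleReflection (CartanMatrix.B n) j v) k =
      if k = n then 2 * coord v (n - 1) - coord v n else coord v k := by
  rw [coord_simpleReflection, sum_mul_B, if_pos hj, hj, coord_eq_zero v (k := j + 2) (by omega),
    show (j : ℕ) = n - 1 by omega]
  split_ifs <;> ring

/-- The roots of type `B` have the form `± e_a ± e_b` with `a ≠ b`. The indices run up to `n + 1`,
where `e_{n+1} = 0` since `ind (n + 1)` vanishes at all labels; this covers the short roots. -/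
theorem IsRootVec.form_B {v : Fin n → ℤ} (hv : IsRootVec (CartanMatrix.B n) v) :
    ∃ (a b : ℕ) (ε δ : ℤ), (ε = 1 ∨ ε = -1) ∧ (δ = 1 ∨ δ = -1) ∧ a ≠ b ∧ (1 ≤ a ∧ a ≤ n + 1) ∧
      (1 ≤ b ∧ b ≤ n + 1) ∧ ∀ k ≤ n, coord v k = ε * ind a k + δ * ind b k := by
  induction hv with
  | simple i =>
    refine ⟨i + 1, i + 2, 1, -1, by omega, by omega, by omega, by omega, by omega, fun k _ ↦ ?_⟩
    simp only [coord_single, ind]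
    split_ifs <;> omega
  | reflect v j _ ih =>
    obtain ⟨a, b, ε, δ, hε, hδ, hab, ha, hb, h⟩ := ih
    by_cases hj : (j : ℕ) + 1 = n
    -- the last reflection changes the sign of `e_n`
    · refine ⟨a, b, if a = n then -ε else ε, if b = n then -δ else δ, by grind, by grind, hab, ha,
        hb, fun k hk ↦ ?_⟩
      rw [coord_simpleReflection_B_last hj, h k hk, h _ le_rfl, h (n - 1) (by omega)]
      simp only [ind]
      split_ifs <;> omega
    · have hm {c} (hc : 1 ≤ c ∧ c ≤ n + 1) : 1 ≤ Equiv.swap ((j : ℕ) + 1) (j + 1 + 1) c ∧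
          Equiv.swap ((j : ℕ) + 1) (j + 1 + 1) c ≤ n + 1 := swap_mem hc (by omega) (by omega)
      exact ⟨_, _, ε, δ, hε, hδ, (Equiv.swap _ _).injective.ne hab, hm ha, hm hb,
        swapsCoordinates_B.eq_swap h (by omega)⟩

theorem hasRoot_B_sub {a b : ℕ} (ha : 1 ≤ a) (hab : a < b) (hb : b ≤ n) :
    HasRoot (CartanMatrix.B n) coord n 1 a (-1) b := by
  have : HasRoot (CartanMatrix.B n) coord n 1 a (-1) (a + 1) := by
    refine ⟨_, .simple ⟨a - 1, by omega⟩, fun k _ ↦ ?_⟩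
    simp only [coord_single, ind]
    split_ifs <;> omega
  exact this.raise swapsCoordinates_B (by omega) (by omega) hab hb

theorem hasRoot_B_add {a b : ℕ} (ha : 1 ≤ a) (hab : a < b) (hb : b ≤ n) :
    HasRoot (CartanMatrix.B n) coord n 1 a 1 b := by
  obtain ⟨v, hv, h⟩ := hasRoot_B_sub (n := n) ha (show a < n by omega) le_rfl
  have : HasRoot (CartanMatrix.B n) coord n 1 a 1 n := by
    refine ⟨_, hv.reflect v ⟨n - 1, by omega⟩, fun k hk ↦ ?_⟩
    rw [coord_simpleReflection_B_last (by simp only; omega), h k hk, h _ le_rfl,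
      h (n - 1) (by omega)]
    simp only [ind]
    split_ifs <;> omega
  exact this.lower swapsCoordinates_B (by omega) ha hab hb le_rfl

/-- The short root `e_a`, written as `e_a + e_{n+1}`. -/
theorem hasRoot_B_single {a : ℕ} (ha : 1 ≤ a) (han : a ≤ n) :
    HasRoot (CartanMatrix.B n) coord n 1 a 1 (n + 1) := by
  have : HasRoot (CartanMatrix.B n) coord n 1 n 1 (n + 1) := by
    refine ⟨_, .simple ⟨n - 1, by omega⟩, fun k _ ↦ ?_⟩
    simp only [coord_single, ind]
    split_ifs <;> omega
  exact this.lower_left swapsCoordinates_B (by omega) ha han (by omega) le_rfl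

/-! #### Type `C` -/

/-- The sum of the first `k` coordinates of `v` with respect to the unit vectors, for type `C`; here
`α_n = 2 e_n`. -/
def coordC (v : Fin n → ℤ) (k : ℕ) : ℤ := if k = n then 2 * coord v n else coord v k

theorem swapsCoordinates_C : SwapsCoordinates (CartanMatrix.C n) coordC n := by
  intro j v k hj _
  simp only [coordC, coord_simpleReflection, sum_mul_C]
  by_cases h : (j : ℕ) + 2 = n
  · simp only [h]
    split_ifs <;> omega
  · split_ifs <;> omega

theorem coordC_simpleReflection_last {j : Fin n} (hj : (j : ℕ) + 1 = n) (v : Fin n → ℤ) (k : ℕ) :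
    coordC (simpleReflection (CartanMatrix.C n) j v) k =
      if k = n then 2 * coordC v (n - 1) - coordC v n else coordC v k := by
  simp only [coordC, coord_simpleReflection, sum_mul_C]
  rw [coord_eq_zero v (k := j + 2) (by omega), hj, show (j : ℕ) = n - 1 by omega]
  split_ifs <;> omega

/-- The roots of type `C` have the form `± e_a ± e_b`, where `a = b` is allowed with equal
signs. -/
theorem IsRootVec.form_C {v : Fin n → ℤ} (hv : IsRootVec (CartanMatrix.C n) v) :
    ∃ (a b : ℕ) (ε δ : ℤ), (ε = 1 ∨ ε = -1) ∧ (δ = 1 ∨ δ = -1) ∧ (a = b → ε = δ) ∧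
      (1 ≤ a ∧ a ≤ n) ∧ (1 ≤ b ∧ b ≤ n) ∧ ∀ k ≤ n, coordC v k = ε * ind a k + δ * ind b k := by
  induction hv with
  | simple i =>
    by_cases hi : (i : ℕ) + 1 = n
    · refine ⟨n, n, 1, 1, by omega, by omega, by omega, by omega, by omega, fun k _ ↦ ?_⟩
      simp only [coordC, coord_single, ind]
      split_ifs <;> omega
    · refine ⟨i + 1, i + 2, 1, -1, by omega, by omega, by omega, by omega, by omega, fun k _ ↦ ?_⟩
      simp only [coordC, coord_single, ind]
      split_ifs <;> omega
  | reflect v j _ ih =>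
    obtain ⟨a, b, ε, δ, hε, hδ, hab, ha, hb, h⟩ := ih
    by_cases hj : (j : ℕ) + 1 = n
    -- the last reflection changes the sign of `e_n`
    · refine ⟨a, b, if a = n then -ε else ε, if b = n then -δ else δ, by grind, by grind, by grind,
        ha, hb, fun k hk ↦ ?_⟩
      rw [coordC_simpleReflection_last hj, h k hk, h _ le_rfl, h (n - 1) (by omega)]
      simp only [ind]
      split_ifs <;> omega
    · exact ⟨_, _, ε, δ, hε, hδ, fun he ↦ hab ((Equiv.swap _ _).injective he),
        swap_mem ha (by omega) (by omega), swap_mem hb (by omega) (by omega),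
        swapsCoordinates_C.eq_swap h (by omega)⟩

theorem hasRoot_C_sub {a b : ℕ} (ha : 1 ≤ a) (hab : a < b) (hb : b ≤ n) :
    HasRoot (CartanMatrix.C n) coordC n 1 a (-1) b := by
  have : HasRoot (CartanMatrix.C n) coordC n 1 a (-1) (a + 1) := by
    refine ⟨_, .simple ⟨a - 1, by omega⟩, fun k _ ↦ ?_⟩
    simp only [coordC, coord_single, ind]
    split_ifs <;> omega
  exact this.raise swapsCoordinates_C (by omega) (by omega) hab hb

theorem hasRoot_C_add {a b : ℕ} (ha : 1 ≤ a) (hab : a ≤ b) (hb : b ≤ n) :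
    HasRoot (CartanMatrix.C n) coordC n 1 a 1 b := by
  rcases hab.eq_or_lt with rfl | hab
  · have : HasRoot (CartanMatrix.C n) coordC n 1 n 1 n := by
      refine ⟨_, .simple ⟨n - 1, by omega⟩, fun k _ ↦ ?_⟩
      simp only [coordC, coord_single, ind]
      split_ifs <;> omega
    exact this.lower_both swapsCoordinates_C (by omega) ha hb le_rfl
  · obtain ⟨v, hv, h⟩ := hasRoot_C_sub (n := n) ha (show a < n by omega) le_rfl
    have : HasRoot (CartanMatrix.C n) coordC n 1 a 1 n := by
      refine ⟨_, hv.reflect v ⟨n - 1, by omega⟩, fun k hk ↦ ?_⟩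
      rw [coordC_simpleReflection_last (by simp only; omega), h k hk, h _ le_rfl,
        h (n - 1) (by omega)]
      simp only [ind]
      split_ifs <;> omega
    exact this.lower swapsCoordinates_C (by omega) ha hab hb le_rfl

/-! #### Type `D` -/

/-- The sum of the first `k` coordinates of `v` with respect to the unit vectors, for type `D`; here
`α_n = e_{n-1} + e_n`. -/
def coordD (v : Fin n → ℤ) (k : ℕ) : ℤ :=
  if k = n then 2 * coord v n else if k + 1 = n then coord v k + coord v n else coord v k

theorem swapsCoordinates_D (hn : 4 ≤ n) : SwapsCoordinates (CartanMatrix.D n) coordD n := by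
  intro j v k hj _
  simp only [coordD, coord_simpleReflection, sum_mul_D hn]
  rcases (by omega : (j : ℕ) + 2 = n ∨ (j : ℕ) + 3 = n ∨ (j : ℕ) + 3 < n) with h | h | h
  · simp only [← h, show (j : ℕ) + 2 - 2 = j by omega]
    split_ifs <;> omega
  · simp only [← h, show (j : ℕ) + 3 - 2 = j + 1 by omega]
    split_ifs <;> omega
  · split_ifs <;> omega

theorem coordD_simpleReflection_last (hn : 4 ≤ n) {j : Fin n} (hj : (j : ℕ) + 1 = n)
    (v : Fin n → ℤ) (k : ℕ) :
    coordD (simpleReflection (CartanMatrix.D n) j v) k =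
      if k = n then 2 * coordD v (n - 2) - coordD v n else
      if k + 1 = n then coordD v (n - 2) + coordD v (n - 1) - coordD v n else coordD v k := by
  simp only [coordD, coord_simpleReflection, sum_mul_D hn, hj]
  obtain ⟨m, rfl⟩ : ∃ m, n = m + 2 := ⟨n - 2, by omega⟩
  split_ifs <;> try omega
  rw [show k = m + 2 - 1 by omega]
  ring

/-- The roots of type `D` have the form `± e_a ± e_b` with `a ≠ b`. -/
theorem IsRootVec.form_D (hn : 4 ≤ n) {v : Fin n → ℤ} (hv : IsRootVec (CartanMatrix.D n) v) :
    ∃ (a b : ℕ) (ε δ : ℤ), (ε = 1 ∨ ε = -1) ∧ (δ = 1 ∨ δ = -1) ∧ a ≠ b ∧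
      (1 ≤ a ∧ a ≤ n) ∧ (1 ≤ b ∧ b ≤ n) ∧ ∀ k ≤ n, coordD v k = ε * ind a k + δ * ind b k := by
  induction hv with
  | simple i =>
    by_cases hi : (i : ℕ) + 1 = n
    · refine ⟨n - 1, n, 1, 1, by omega, by omega, by omega, by omega, by omega, fun k _ ↦ ?_⟩
      simp only [coordD, coord_single, ind]
      split_ifs <;> omega
    · refine ⟨i + 1, i + 2, 1, -1, by omega, by omega, by omega, by omega, by omega, fun k _ ↦ ?_⟩
      simp only [coordD, coord_single, ind]
      split_ifs <;> omega
  | reflect v j _ ih =>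
    obtain ⟨a, b, ε, δ, hε, hδ, hab, ha, hb, h⟩ := ih
    by_cases hj : (j : ℕ) + 1 = n
    -- the last reflection exchanges `e_{n-1}` with `-e_n`
    · refine ⟨Equiv.swap (n - 1) n a, Equiv.swap (n - 1) n b, if n ≤ a + 1 then -ε else ε,
        if n ≤ b + 1 then -δ else δ, by grind, by grind, (Equiv.swap _ _).injective.ne hab,
        ?_, ?_, fun k hk ↦ ?_⟩
      · rw [Equiv.swap_apply_def]; split_ifs <;> omega
      · rw [Equiv.swap_apply_def]; split_ifs <;> omega
      rw [coordD_simpleReflection_last hn hj, h k hk, h _ le_rfl, h (n - 1) (by omega),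
        h (n - 2) (by omega)]
      have key (c : ℕ) (ε : ℤ) (hc : 1 ≤ c ∧ c ≤ n) :
          (if n ≤ c + 1 then -ε else ε) * ind (Equiv.swap (n - 1) n c) k =
          if k = n then 2 * (ε * ind c (n - 2)) - ε * ind c n else
          if k + 1 = n then ε * ind c (n - 2) + ε * ind c (n - 1) - ε * ind c n
          else ε * ind c k := by
        simp only [ind, Equiv.swap_apply_def]
        split_ifs <;> omega
      rw [key a ε ha, key b δ hb]
      split_ifs <;> ring
    · exact ⟨_, _, ε, δ, hε, hδ, (Equiv.swap _ _).injective.ne hab,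
        swap_mem ha (by omega) (by omega), swap_mem hb (by omega) (by omega),
        (swapsCoordinates_D hn).eq_swap h (by omega)⟩

theorem hasRoot_D_sub (hn : 4 ≤ n) {a b : ℕ} (ha : 1 ≤ a) (hab : a < b) (hb : b ≤ n) :
    HasRoot (CartanMatrix.D n) coordD n 1 a (-1) b := by
  have : HasRoot (CartanMatrix.D n) coordD n 1 a (-1) (a + 1) := by
    refine ⟨_, .simple ⟨a - 1, by omega⟩, fun k _ ↦ ?_⟩
    simp only [coordD, coord_single, ind]
    split_ifs <;> omega
  exact this.raise (swapsCoordinates_D hn) (by omega) (by omega) hab hb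

theorem hasRoot_D_add (hn : 4 ≤ n) {a b : ℕ} (ha : 1 ≤ a) (hab : a < b) (hb : b ≤ n) :
    HasRoot (CartanMatrix.D n) coordD n 1 a 1 b := by
  have : HasRoot (CartanMatrix.D n) coordD n 1 (n - 1) 1 n := by
    refine ⟨_, .simple ⟨n - 1, by omega⟩, fun k _ ↦ ?_⟩
    simp only [coordD, coord_single, ind]
    split_ifs <;> omega
  exact (this.lower_left (swapsCoordinates_D hn) (by omega) ha (by omega) (by omega)
    (by omega)).lower (swapsCoordinates_D hn) (by omega) ha hab hb le_rfl

end ClassicalRoots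

/-! ### The table for the classical types -/

section ClassicalTable

variable {n : ℕ} {A : Matrix (Fin n) (Fin n) ℤ}

/-- Every row of the table satisfies the combinatorial form of admissibility. For the classical
types the bounds are read off from the form of the roots, and the two existence statements from
explicit roots `e_a - e_b`, `e_a` or `e_a + e_b`. -/
theorem TableEntry.good {T₁ T₂ : Finset ℕ} (h : TableEntry n A T₁ T₂) :
    ∃ σ : Fin n, T₂ = {(σ : ℕ) + 1} ∧ Good A (labelled n T₁) σ := by
  cases h with
  | A n r t s h₁ h₂ h₃ h₄ =>
    have hrs : r ≠ s := by omega
    refine good_of_labels (by simp; omega) (by omega) (by simp; omega) ?_ ?_ ?_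
    · simp only [Finset.sum_pair hrs]
      intro v hv
      obtain ⟨a, b, hab, ha, hb, h⟩ := hv.form_A
      have hr := h r (by omega); have ht := h t (by omega); have hs := h s (by omega)
      simp only [ind] at hr ht hs
      omega
    · simp only [Finset.sum_pair hrs]
      intro k hk
      obtain ⟨v, hv, h⟩ := hasRoot_A (n := n) (a := 1) (b := n + 1) (by omega) (by omega) (by omega)
      have hr := h r (by omega); have hs := h s (by omega)
      simp only [ind] at hr hs
      refine ⟨v, hv, by omega, ?_⟩
      rcases (by simpa using hk : k = r ∨ k = s) with rfl | rfl <;> omega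
    · simp only [Finset.sum_pair hrs]
      obtain ⟨v, hv, h⟩ := hasRoot_A (n := n) (a := t) (b := n + 1) (by omega) (by omega) (by omega)
      have hr := h r (by omega); have ht := h t (by omega); have hs := h s (by omega)
      simp only [ind] at hr ht hs
      exact ⟨v, hv, by omega, by omega⟩
  | B_adjacent n r h₁ h₂ =>
    have hrs : r ≠ r + 2 := by omega
    refine good_of_labels (by simp; omega) (by omega) (by simp) ?_ ?_ ?_
    · simp only [Finset.sum_pair hrs]
      intro v hv
      obtain ⟨a, b, ε, δ, hε, hδ, hab, ha, hb, h⟩ := hv.form_B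
      have hr := h r (by omega); have ht := h (r + 1) (by omega); have hs := h (r + 2) (by omega)
      simp only [ind] at hr ht hs
      rcases hε with rfl | rfl <;> rcases hδ with rfl | rfl <;> omega
    · simp only [Finset.sum_pair hrs]
      intro k hk
      obtain ⟨v, hv, h⟩ := hasRoot_B_single (n := n) (a := 1) (by omega) (by omega)
      have hr := h r (by omega); have hs := h (r + 2) (by omega)
      simp only [ind] at hr hs
      refine ⟨v, hv, by omega, ?_⟩
      rcases (by simpa using hk : k = r ∨ k = r + 2) with rfl | rfl <;> omega
    · simp only [Finset.sum_pair hrs]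
      obtain ⟨v, hv, h⟩ := hasRoot_B_single (n := n) (a := r + 1) (by omega) (by omega)
      have hr := h r (by omega); have ht := h (r + 1) (by omega); have hs := h (r + 2) (by omega)
      simp only [ind] at hr ht hs
      exact ⟨v, hv, by omega, by omega⟩
  | B_first n hn =>
    refine good_of_labels (by simp; omega) (by omega) (by simp) ?_ ?_ ?_
    · simp only [Finset.sum_singleton]
      intro v hv
      obtain ⟨a, b, ε, δ, hε, hδ, hab, ha, hb, h⟩ := hv.form_B
      have hr := h 1 (by omega); have ht := h 2 (by omega)
      simp only [ind] at hr ht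
      rcases hε with rfl | rfl <;> rcases hδ with rfl | rfl <;> omega
    · simp only [Finset.sum_singleton]
      intro k hk
      obtain rfl : k = 2 := by simpa using hk
      obtain ⟨v, hv, h⟩ := hasRoot_B_add (n := n) (a := 1) (b := 2) (by omega) (by omega) hn
      have hr := h 2 (by omega)
      simp only [ind] at hr
      exact ⟨v, hv, by omega, by omega⟩
    · simp only [Finset.sum_singleton]
      obtain ⟨v, hv, h⟩ := hasRoot_B_single (n := n) (a := 1) (by omega) (by omega)
      have hr := h 1 (by omega); have ht := h 2 (by omega)
      simp only [ind] at hr ht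
      exact ⟨v, hv, by omega, by omega⟩
  | C n r h₁ h₂ =>
    have wr (v : Fin n → ℤ) : coordC v r = coord v r := if_neg (by omega)
    have wn (v : Fin n → ℤ) : coordC v n = 2 * coord v n := if_pos rfl
    refine good_of_labels (by simp; omega) (by omega) (by simp; omega) ?_ ?_ ?_
    · simp only [Finset.sum_singleton]
      intro v hv
      obtain ⟨a, b, ε, δ, hε, hδ, hab, ha, hb, h⟩ := hv.form_C
      have hr := h r (by omega); have ht := h n (by omega)
      simp only [ind, wr, wn] at hr ht
      rcases hε with rfl | rfl <;> rcases hδ with rfl | rfl <;> omega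
    · simp only [Finset.sum_singleton]
      intro k hk
      obtain rfl : k = r := by simpa using hk
      obtain ⟨v, hv, h⟩ := hasRoot_C_add (n := n) (a := 1) (b := 1) (by omega) (by omega) (by omega)
      have hr := h k (by omega)
      simp only [ind, wr] at hr
      exact ⟨v, hv, by omega, by omega⟩
    · simp only [Finset.sum_singleton]
      obtain ⟨v, hv, h⟩ := hasRoot_C_add (n := n) (a := r) (b := n) (by omega) (by omega) (by omega)
      have hr := h r (by omega); have ht := h n (by omega)
      simp only [ind, wr, wn] at hr ht
      exact ⟨v, hv, by omega, by omega⟩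
  | D_first n hn =>
    have w1 (v : Fin n → ℤ) : coordD v 1 = coord v 1 := by
      rw [coordD, if_neg (by omega), if_neg (by omega)]
    have w2 (v : Fin n → ℤ) : coordD v 2 = coord v 2 := by
      rw [coordD, if_neg (by omega), if_neg (by omega)]
    refine good_of_labels (by simp; omega) (by omega) (by simp) ?_ ?_ ?_
    · simp only [Finset.sum_singleton]
      intro v hv
      obtain ⟨a, b, ε, δ, hε, hδ, hab, ha, hb, h⟩ := hv.form_D hn
      have hr := h 1 (by omega); have ht := h 2 (by omega)
      simp only [ind, w1, w2] at hr ht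
      rcases hε with rfl | rfl <;> rcases hδ with rfl | rfl <;> omega
    · simp only [Finset.sum_singleton]
      intro k hk
      obtain rfl : k = 2 := by simpa using hk
      obtain ⟨v, hv, h⟩ := hasRoot_D_add hn (a := 1) (b := 2) (by omega) (by omega) (by omega)
      have hr := h 2 (by omega)
      simp only [ind, w2] at hr
      exact ⟨v, hv, by omega, by omega⟩
    · simp only [Finset.sum_singleton]
      obtain ⟨v, hv, h⟩ := hasRoot_D_add hn (a := 1) (b := n) (by omega) (by omega) (by omega)
      have hr := h 1 (by omega); have ht := h 2 (by omega)
      simp only [ind, w1, w2] at hr ht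
      exact ⟨v, hv, by omega, by omega⟩
  | D_last n r hn h₁ h₂ =>
    have wr (v : Fin n → ℤ) : coordD v r = coord v r := by
      rw [coordD, if_neg (by omega), if_neg (by omega)]
    have wn (v : Fin n → ℤ) : coordD v n = 2 * coord v n := if_pos rfl
    refine good_of_labels (by simp; omega) (by omega) (by simp; omega) ?_ ?_ ?_
    · simp only [Finset.sum_singleton]
      intro v hv
      obtain ⟨a, b, ε, δ, hε, hδ, hab, ha, hb, h⟩ := hv.form_D hn
      have hr := h r (by omega); have ht := h n (by omega)
      simp only [ind, wr, wn] at hr ht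
      rcases hε with rfl | rfl <;> rcases hδ with rfl | rfl <;> omega
    · simp only [Finset.sum_singleton]
      intro k hk
      obtain rfl : k = r := by simpa using hk
      obtain ⟨v, hv, h⟩ := hasRoot_D_add hn (a := 1) (b := 2) (by omega) (by omega) (by omega)
      have hr := h k (by omega)
      simp only [ind, wr] at hr
      exact ⟨v, hv, by omega, by omega⟩
    · simp only [Finset.sum_singleton]
      obtain ⟨v, hv, h⟩ := hasRoot_D_add hn (a := r) (b := n) (by omega) (by omega) (by omega)
      have hr := h r (by omega); have ht := h n (by omega)
      simp only [ind, wr, wn] at hr ht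
      exact ⟨v, hv, by omega, by omega⟩
  | D_adjacent n r hn h₁ h₂ =>
    have hrs : r ≠ r + 2 := by omega
    have w (v : Fin n → ℤ) {k : ℕ} (hk : k ≤ r + 2) : coordD v k = coord v k := by
      rw [coordD, if_neg (by omega), if_neg (by omega)]
    refine good_of_labels (by simp; omega) (by omega) (by simp) ?_ ?_ ?_
    · simp only [Finset.sum_pair hrs]
      intro v hv
      obtain ⟨a, b, ε, δ, hε, hδ, hab, ha, hb, h⟩ := hv.form_D hn
      have hr := h r (by omega); have ht := h (r + 1) (by omega); have hs := h (r + 2) (by omega)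
      rw [w v (by omega)] at hr ht hs
      simp only [ind] at hr ht hs
      rcases hε with rfl | rfl <;> rcases hδ with rfl | rfl <;> omega
    · simp only [Finset.sum_pair hrs]
      intro k hk
      obtain ⟨v, hv, h⟩ := hasRoot_D_add hn (a := 1) (b := n) (by omega) (by omega) (by omega)
      have hr := h r (by omega); have hs := h (r + 2) (by omega)
      rw [w v (by omega)] at hr hs
      simp only [ind] at hr hs
      refine ⟨v, hv, by omega, ?_⟩
      rcases (by simpa using hk : k = r ∨ k = r + 2) with rfl | rfl <;> omega
    · simp only [Finset.sum_pair hrs]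
      obtain ⟨v, hv, h⟩ := hasRoot_D_add hn (a := r + 1) (b := n) (by omega) (by omega) (by omega)
      have hr := h r (by omega); have ht := h (r + 1) (by omega); have hs := h (r + 2) (by omega)
      rw [w v (by omega)] at hr ht hs
      simp only [ind] at hr ht hs
      exact ⟨v, hv, by omega, by omega⟩
  | D_branch n hn =>
    have w3 (v : Fin n → ℤ) : coordD v (n - 3) = coord v (n - 3) := by
      rw [coordD, if_neg (by omega), if_neg (by omega)]
    have w2 (v : Fin n → ℤ) : coordD v (n - 2) = coord v (n - 2) := by
      rw [coordD, if_neg (by omega), if_neg (by omega)]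
    have w1 (v : Fin n → ℤ) : coordD v (n - 1) = coord v (n - 1) + coord v n := by
      rw [coordD, if_neg (by omega), if_pos (by omega)]
    have w0 (v : Fin n → ℤ) : coordD v n = 2 * coord v n := if_pos rfl
    have hsum (v : Fin n → ℤ) : ∑ k ∈ {n - 3, n - 1, n}, coord v k =
        coord v (n - 3) + (coord v (n - 1) + coord v n) := by
      rw [Finset.sum_insert (by simp; omega), Finset.sum_pair (by omega)]
    refine good_of_labels (by simp; omega) (by omega) (by simp; omega) ?_ ?_ ?_
    · simp only [hsum]
      intro v hv
      obtain ⟨a, b, ε, δ, hε, hδ, hab, ha, hb, h⟩ := hv.form_D hn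
      have hr := h (n - 3) (by omega); have ht := h (n - 2) (by omega)
      have hs := h (n - 1) (by omega)
      rw [w3] at hr; rw [w2] at ht; rw [w1] at hs
      simp only [ind] at hr ht hs
      rcases hε with rfl | rfl <;> rcases hδ with rfl | rfl <;> omega
    · simp only [hsum]
      intro k hk
      have hk : k = n - 3 ∨ k = n - 1 ∨ k = n := by simpa using hk
      rcases (by omega : k ≠ n ∨ k = n) with hkn | rfl
      · obtain ⟨v, hv, h⟩ := hasRoot_D_sub hn (a := n - 3) (b := n) (by omega) (by omega) (by omega)
        have hr := h (n - 3) (by omega); have hs := h (n - 1) (by omega); have hn' := h n le_rfl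
        rw [w3] at hr; rw [w1] at hs; rw [w0] at hn'
        simp only [ind] at hr hs hn'
        refine ⟨v, hv, by omega, ?_⟩
        rcases hk with rfl | rfl | rfl <;> omega
      · obtain ⟨v, hv, h⟩ := hasRoot_D_add hn (a := k - 3) (b := k) (by omega) (by omega) (by omega)
        have hr := h (k - 3) (by omega); have hs := h (k - 1) (by omega); have hn' := h k le_rfl
        rw [w3] at hr; rw [w1] at hs; rw [w0] at hn'
        simp only [ind] at hr hs hn'
        exact ⟨v, hv, by omega, by omega⟩
    · simp only [hsum]
      obtain ⟨v, hv, h⟩ := hasRoot_D_sub hn (a := n - 3) (b := n - 1) (by omega) (by omega)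
        (by omega)
      have hr := h (n - 3) (by omega); have ht := h (n - 2) (by omega)
      have hs := h (n - 1) (by omega)
      rw [w3] at hr; rw [w2] at ht; rw [w1] at hs
      simp only [ind] at hr ht hs
      exact ⟨v, hv, by omega, by omega⟩
  | G₂ => exact ⟨1, rfl, (goodG₂_iff _ _).2 (by decide +kernel)⟩
  | F₄_2_1 => exact ⟨0, rfl, (goodF₄_iff _ _).2 (by decide +kernel)⟩
  | F₄_13_2 => exact ⟨1, rfl, (goodF₄_iff _ _).2 (by decide +kernel)⟩
  | E₆_2_1 => exact ⟨0, rfl, (goodE₆_iff _ _).2 (by decide +kernel)⟩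
  | E₆_6_1 => exact ⟨0, rfl, (goodE₆_iff _ _).2 (by decide +kernel)⟩
  | E₆_3_6 => exact ⟨5, rfl, (goodE₆_iff _ _).2 (by decide +kernel)⟩
  | E₆_13_2 => exact ⟨1, rfl, (goodE₆_iff _ _).2 (by decide +kernel)⟩
  | E₆_246_3 => exact ⟨2, rfl, (goodE₆_iff _ _).2 (by decide +kernel)⟩
  | E₇_2_1 => exact ⟨0, rfl, (goodE₇_iff _ _).2 (by decide +kernel)⟩
  | E₇_5_6 => exact ⟨5, rfl, (goodE₇_iff _ _).2 (by decide +kernel)⟩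
  | E₇_6_1 => exact ⟨0, rfl, (goodE₇_iff _ _).2 (by decide +kernel)⟩
  | E₇_4_7 => exact ⟨6, rfl, (goodE₇_iff _ _).2 (by decide +kernel)⟩
  | E₇_13_2 => exact ⟨1, rfl, (goodE₇_iff _ _).2 (by decide +kernel)⟩
  | E₇_24_3 => exact ⟨2, rfl, (goodE₇_iff _ _).2 (by decide +kernel)⟩
  | E₇_46_5 => exact ⟨4, rfl, (goodE₇_iff _ _).2 (by decide +kernel)⟩
  | E₇_357_4 => exact ⟨3, rfl, (goodE₇_iff _ _).2 (by decide +kernel)⟩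
  | E₈_2_1 => exact ⟨0, rfl, (goodE₈_iff _ _).2 (by decide +kernel)⟩
  | E₈_6_7 => exact ⟨6, rfl, (goodE₈_iff _ _).2 (by decide +kernel)⟩
  | E₈_5_8 => exact ⟨7, rfl, (goodE₈_iff _ _).2 (by decide +kernel)⟩
  | E₈_13_2 => exact ⟨1, rfl, (goodE₈_iff _ _).2 (by decide +kernel)⟩
  | E₈_24_3 => exact ⟨2, rfl, (goodE₈_iff _ _).2 (by decide +kernel)⟩
  | E₈_35_4 => exact ⟨3, rfl, (goodE₈_iff _ _).2 (by decide +kernel)⟩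
  | E₈_57_6 => exact ⟨5, rfl, (goodE₈_iff _ _).2 (by decide +kernel)⟩
  | E₈_468_5 => exact ⟨4, rfl, (goodE₈_iff _ _).2 (by decide +kernel)⟩

end ClassicalTable

/-! ### Completeness of the table for the classical types -/

section Completeness

variable {n : ℕ} {A : Matrix (Fin n) (Fin n) ℤ} {S : Finset (Fin n)} {σ : Fin n}

theorem Good.coord_eq_one (h : Good A S σ) {v : Fin n → ℤ} (hv : IsRootVec A v)
    (h2 : ∑ k ∈ labels S, coord v k = 2) : coord v (σ + 1) = 1 := by
  rw [coord_succ]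
  exact h.two v hv (by rw [← sum_labels, h2])

theorem Good.exists_sum_eq_two (h : Good A S σ) {k : ℕ} (hk : k ∈ labels S) :
    ∃ v, IsRootVec A v ∧ ∑ k ∈ labels S, coord v k = 2 := by
  obtain ⟨i, hi, -⟩ := Finset.mem_image.1 hk
  obtain ⟨v, hv, h2, -⟩ := h.exists_two i hi
  exact ⟨v, hv, by rw [sum_labels, h2]⟩

theorem Good.labels_nonempty (h : Good A S σ) : (labels S).Nonempty := by
  obtain ⟨v, -, h1, -⟩ := h.exists_one
  rw [Finset.nonempty_iff_ne_empty]
  intro h0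
  rw [← sum_labels, h0] at h1
  simp at h1

/-- If the sum of the simple roots in an interval from `r` to `s` is a root, and `r` and `s` are the
only elements of the first set in the interval, then the label of `σ` lies between `r` and `s`. To
cover type `D`, coordinates are prescribed only on a part `T` of the first set outside of which the
root vanishes. -/
theorem Good.lt_and_lt (h : Good A S σ) {T : Finset ℕ} (hT : T ⊆ labels S) {r s : ℕ} (hr : r ∈ T)
    (hs : s ∈ T) (hrs : r < s) (hT' : ∀ k ∈ T, ¬(r < k ∧ k < s)) {v : Fin n → ℤ}
    (hv : IsRootVec A v) (hk : ∀ k ∈ T, coord v k = if r ≤ k ∧ k ≤ s then 1 else 0)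
    (hk' : ∀ k ∈ labels S, k ∉ T → coord v k = 0)
    (hσ : coord v (σ + 1) = 1 → r ≤ (σ : ℕ) + 1 ∧ (σ : ℕ) + 1 ≤ s) :
    r < (σ : ℕ) + 1 ∧ (σ : ℕ) + 1 < s := by
  have h2 : ∑ k ∈ labels S, coord v k = 2 := by
    rw [← Finset.sum_subset hT hk', ← Finset.sum_subset (s₁ := {r, s}), Finset.sum_pair hrs.ne,
      hk r hr, hk s hs, if_pos (by omega), if_pos (by omega), one_add_one_eq_two]
    · exact Finset.insert_subset hr (Finset.singleton_subset_iff.2 hs)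
    · intro k hkT hkrs
      rw [hk k hkT, if_neg]
      have := hT' k hkT
      simp only [Finset.mem_insert, Finset.mem_singleton] at hkrs
      omega
  have h1 := hσ (h.coord_eq_one hv h2)
  have hmem : (σ : ℕ) + 1 ∉ T := fun h' ↦ h.notMem (mem_labels.1 (hT h'))
  have hrne : r ≠ σ + 1 := fun h' ↦ hmem (h' ▸ hr)
  have hsne : s ≠ σ + 1 := fun h' ↦ hmem (h' ▸ hs)
  omega

/-- A set of labels in which `t` lies between any two neighbours has at most two elements. -/
theorem eq_singleton_or_pair {T : Finset ℕ} {t : ℕ} (hT : T.Nonempty)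
    (h : ∀ r ∈ T, ∀ s ∈ T, r < s → (∀ k ∈ T, ¬(r < k ∧ k < s)) → r < t ∧ t < s) :
    (∃ r, T = {r}) ∨ ∃ r s, r < t ∧ t < s ∧ T = {r, s} := by
  -- the assumption on neighbours extends to all pairs, by induction on the distance
  have key : ∀ d, ∀ r ∈ T, ∀ s ∈ T, r < s → s ≤ r + d → r < t ∧ t < s := by
    intro d
    induction d with
    | zero => intros; omega
    | succ d ih =>
      intro r hr s hs hrs hd
      refine h r hr s hs hrs fun k hk hk' ↦ ?_
      have h₁ := ih r hr k hk hk'.1 (by omega)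
      have h₂ := ih k hk s hs hk'.2 (by omega)
      omega
  obtain ⟨r, hr, hrmin⟩ := T.exists_min_image id hT
  obtain ⟨s, hs, hsmax⟩ := T.exists_max_image id hT
  simp only [id] at hrmin hsmax
  have hmem : ∀ k ∈ T, k = r ∨ k = s := by
    intro k hk
    by_contra! hne
    have h₁ := key k r hr k hk (by have := hrmin k hk; omega) (by omega)
    have h₂ := key s k hk s hs (by have := hsmax k hk; omega) (by omega)
    omega
  rcases (hrmin s hs).eq_or_lt with rfl | hlt
  · exact .inl ⟨r, Finset.Subset.antisymm (fun k hk ↦ by simpa using hmem k hk) (by simpa using hr)⟩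
  · refine .inr ⟨r, s, (key s r hr s hs hlt (by omega)).1, (key s r hr s hs hlt (by omega)).2,
      Finset.Subset.antisymm (fun k hk ↦ by simpa using hmem k hk) ?_⟩
    exact Finset.insert_subset hr (Finset.singleton_subset_iff.2 hs)

/-- The label of `σ` lies between any two neighbours in `S` because `e_r - e_{s+1}` is a root, and
`S` has more than one element because the roots have no coordinate `2`. -/
theorem Good.listedA (h : Good (CartanMatrix.A n) S σ) : Listed (CartanMatrix.A n) S {σ} := by
  have hσ := σ.2
  refine listed_of_labels ?_
  have hadj : ∀ r ∈ labels S, ∀ s ∈ labels S, r < s → (∀ k ∈ labels S, ¬(r < k ∧ k < s)) →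
      r < (σ : ℕ) + 1 ∧ (σ : ℕ) + 1 < s := by
    intro r hr s hs hrs hT
    have hr' := le_of_mem_labels hr
    have hs' := le_of_mem_labels hs
    obtain ⟨v, hv, hform⟩ := hasRoot_A (n := n) (b := s + 1) hr'.1 (by omega) (by omega)
    have hcoord : ∀ k ≤ n, coord v k = if r ≤ k ∧ k ≤ s then 1 else 0 := by
      intro k hk
      rw [hform k (by omega)]
      simp only [ind]
      omega
    refine h.lt_and_lt subset_rfl hr hs hrs hT hv
      (fun k hk ↦ hcoord k (le_of_mem_labels hk).2) (fun k hk hk' ↦ absurd hk hk') ?_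
    rw [hcoord _ (by omega)]
    omega
  rcases eq_singleton_or_pair h.labels_nonempty hadj with ⟨r, hT⟩ | ⟨r, s, hr, hs, hT⟩
  · have hr : r ∈ labels S := by simp [hT]
    obtain ⟨v, hv, h2⟩ := h.exists_sum_eq_two hr
    obtain ⟨a, b, -, -, -, hform⟩ := hv.form_A
    have := hform r (by have := le_of_mem_labels hr; omega)
    rw [hT, Finset.sum_singleton] at h2
    simp only [ind] at this
    omega
  · have hr' := le_of_mem_labels (show r ∈ labels S by simp [hT])
    have hs' := le_of_mem_labels (show s ∈ labels S by simp [hT])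
    rw [hT]
    exact .A n r _ s hr'.1 hr hs hs'.2

/-- As for type `A`, the label `t` of `σ` lies between any two neighbours in `S`. The root
`e_a + e_b`, with `a < b`, has coordinates `0`, `1`, `2` at the labels before `a`, from `a` to
`b - 1`, and from `b` on; for suitable `a`, `b` it violates `two` unless the pair is in the
table. -/
theorem Good.listedB (h : Good (CartanMatrix.B n) S σ) : Listed (CartanMatrix.B n) S {σ} := by
  have hσ := σ.2
  refine listed_of_labels ?_
  generalize ht : (σ : ℕ) + 1 = t
  have hadj : ∀ r ∈ labels S, ∀ s ∈ labels S, r < s → (∀ k ∈ labels S, ¬(r < k ∧ k < s)) →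
      r < t ∧ t < s := by
    intro r hr s hs hrs hT
    have hr' := le_of_mem_labels hr
    have hs' := le_of_mem_labels hs
    obtain ⟨v, hv, hcoord⟩ : ∃ v, IsRootVec (CartanMatrix.B n) v ∧
        ∀ k ≤ n, coord v k = if r ≤ k ∧ k ≤ s then 1 else 0 := by
      by_cases hsn : s = n
      · obtain ⟨v, hv, hform⟩ := hasRoot_B_single (n := n) hr'.1 (by omega)
        refine ⟨v, hv, fun k hk ↦ ?_⟩
        rw [hform k hk]
        simp only [ind]
        omega
      · obtain ⟨v, hv, hform⟩ := hasRoot_B_sub (n := n) (b := s + 1) hr'.1 (by omega) (by omega)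
        refine ⟨v, hv, fun k hk ↦ ?_⟩
        rw [hform k hk]
        simp only [ind]
        omega
    rw [← ht]
    refine h.lt_and_lt subset_rfl hr hs hrs hT hv
      (fun k hk ↦ hcoord k (le_of_mem_labels hk).2) (fun k hk hk' ↦ absurd hk hk') ?_
    rw [hcoord _ (by omega)]
    omega
  rcases eq_singleton_or_pair h.labels_nonempty hadj with ⟨r, hT⟩ | ⟨r, s, hr, hs, hT⟩
  · have hr : r ∈ labels S := by simp [hT]
    have hr' := le_of_mem_labels hr
    have hrt : r ≠ t := by rintro rfl; exact h.notMem (mem_labels.1 (ht ▸ hr))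
    -- the coordinate of a root at `α_1` is at most `1`
    have hr1 : r ≠ 1 := by
      rintro rfl
      obtain ⟨v, hv, h2⟩ := h.exists_sum_eq_two hr
      obtain ⟨a, b, ε, δ, hε, hδ, hab, ha, hb, hform⟩ := hv.form_B
      have := hform 1 hr'.2
      rw [hT, Finset.sum_singleton] at h2
      simp only [ind] at this
      rcases hε with rfl | rfl <;> rcases hδ with rfl | rfl <;> omega
    by_cases ht1 : t = 1
    · by_cases hr2 : r = 2
      · rw [hT, ht1, hr2]
        exact .B_first n (by omega)
      -- coordinate `2` at `r` and `0` at `t`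
      obtain ⟨v, hv, hform⟩ := hasRoot_B_add (n := n) (a := 2) (b := 3) (by omega) (by omega)
        (by omega)
      have h₁ := hform r (by omega)
      have h₂ := hform t (by omega)
      have h₃ := h.coord_eq_one hv
      rw [hT, Finset.sum_singleton, ht] at h₃
      simp only [ind] at h₁ h₂
      omega
    · -- coordinate `2` at `r` and at `t`
      obtain ⟨v, hv, hform⟩ := hasRoot_B_add (n := n) (a := 1) (b := 2) (by omega) (by omega)
        (by omega)
      have h₁ := hform r (by omega)
      have h₂ := hform t (by omega)
      have h₃ := h.coord_eq_one hv
      rw [hT, Finset.sum_singleton, ht] at h₃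
      simp only [ind] at h₁ h₂
      omega
  · have hr' := le_of_mem_labels (show r ∈ labels S by simp [hT])
    have hs' := le_of_mem_labels (show s ∈ labels S by simp [hT])
    have ht₁ : t = r + 1 := by
      by_contra hne
      -- coordinate `0` at `r`, and `2` at `s` and `t`
      obtain ⟨v, hv, hform⟩ := hasRoot_B_add (n := n) (a := r + 1) (b := t) (by omega) (by omega)
        (by omega)
      have h₀ := hform r (by omega)
      have h₁ := hform s (by omega)
      have h₂ := hform t (by omega)
      have h₃ := h.coord_eq_one hv
      rw [hT, Finset.sum_pair (by omega), ht] at h₃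
      simp only [ind] at h₀ h₁ h₂
      omega
    have hs₁ : s = r + 2 := by
      by_contra hne
      -- coordinate `2` at `s`, and `0` at `r` and `t`
      obtain ⟨v, hv, hform⟩ := hasRoot_B_add (n := n) (a := t + 1) (b := s) (by omega) (by omega)
        (by omega)
      have h₀ := hform r (by omega)
      have h₁ := hform s (by omega)
      have h₂ := hform t (by omega)
      have h₃ := h.coord_eq_one hv
      rw [hT, Finset.sum_pair (by omega), ht] at h₃
      simp only [ind] at h₀ h₁ h₂
      omega
    rw [hT, hs₁, ht₁]
    exact .B_adjacent n r hr'.1 (by omega)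

/-- As for type `A`, the label `t` of `σ` lies between any two neighbours in `S`. The long roots
`2 e_a` exclude the pairs that are not in the table, except in the case that `α_n` and another
simple root `α_r` are in `S`, where `e_r + e_t` is used. -/
theorem Good.listedC (h : Good (CartanMatrix.C n) S σ) : Listed (CartanMatrix.C n) S {σ} := by
  have hσ := σ.2
  have w (v : Fin n → ℤ) {k : ℕ} (hk : k < n) : coordC v k = coord v k := if_neg (by omega)
  have wn (v : Fin n → ℤ) : coordC v n = 2 * coord v n := if_pos rfl
  refine listed_of_labels ?_
  generalize ht : (σ : ℕ) + 1 = t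
  -- the roots `2 e_a` have coordinates `0` or `2`, except for the last one
  have long {a : ℕ} (ha : 1 ≤ a) (han : a ≤ n) : ∃ v, IsRootVec (CartanMatrix.C n) v ∧
      coord v n = 1 ∧ ∀ k < n, coord v k = if a ≤ k then 2 else 0 := by
    obtain ⟨v, hv, hform⟩ := hasRoot_C_add (n := n) ha le_rfl han
    have := hform n le_rfl
    rw [wn] at this
    simp only [ind] at this
    refine ⟨v, hv, by omega, fun k hk ↦ ?_⟩
    rw [← w v hk, hform k hk.le]
    simp only [ind]
    omega
  have hadj : ∀ r ∈ labels S, ∀ s ∈ labels S, r < s → (∀ k ∈ labels S, ¬(r < k ∧ k < s)) →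
      r < t ∧ t < s := by
    intro r hr s hs hrs hT
    have hr' := le_of_mem_labels hr
    have hs' := le_of_mem_labels hs
    obtain ⟨v, hv, hcoord⟩ : ∃ v, IsRootVec (CartanMatrix.C n) v ∧
        ∀ k ≤ n, coord v k = if r ≤ k ∧ k ≤ s then 1 else 0 := by
      by_cases hsn : s = n
      · obtain ⟨v, hv, hform⟩ := hasRoot_C_add (n := n) (b := n) hr'.1 (by omega) le_rfl
        refine ⟨v, hv, fun k hk ↦ ?_⟩
        have := hform k hk
        simp only [ind] at this
        by_cases hkn : k = n
        · subst hkn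
          rw [wn] at this
          omega
        · rw [w v (by omega)] at this
          omega
      · obtain ⟨v, hv, hform⟩ := hasRoot_C_sub (n := n) (b := s + 1) hr'.1 (by omega) (by omega)
        refine ⟨v, hv, fun k hk ↦ ?_⟩
        have := hform k hk
        simp only [ind] at this
        by_cases hkn : k = n
        · subst hkn
          rw [wn] at this
          omega
        · rw [w v (by omega)] at this
          omega
    rw [← ht]
    refine h.lt_and_lt subset_rfl hr hs hrs hT hv
      (fun k hk ↦ hcoord k (le_of_mem_labels hk).2) (fun k hk hk' ↦ absurd hk hk') ?_
    rw [hcoord _ (by omega)]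
    omega
  rcases eq_singleton_or_pair h.labels_nonempty hadj with ⟨r, hT⟩ | ⟨r, s, hr, hs, hT⟩
  · have hr : r ∈ labels S := by simp [hT]
    have hr' := le_of_mem_labels hr
    have hrt : r ≠ t := by rintro rfl; exact h.notMem (mem_labels.1 (ht ▸ hr))
    -- the coordinate of a root at `α_n` is at most `1`
    have hrn : r ≠ n := by
      rintro rfl
      obtain ⟨v, hv, h2⟩ := h.exists_sum_eq_two hr
      obtain ⟨a, b, ε, δ, hε, hδ, hab, ha, hb, hform⟩ := hv.form_C
      have := hform r hr'.2
      rw [hT, Finset.sum_singleton] at h2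
      rw [wn] at this
      simp only [ind] at this
      rcases hε with rfl | rfl <;> rcases hδ with rfl | rfl <;> omega
    by_cases htn : t = n
    · rw [hT, htn]
      exact .C n r hr'.1 (by omega)
    · -- a root `2 e_a` with coordinate `2` at `r`, and `0` or `2` at `t`
      obtain ⟨a, ha, han, har⟩ : ∃ a, 1 ≤ a ∧ a ≤ r ∧ (t < a ↔ t < r) := by
        by_cases htr : t < r
        · exact ⟨t + 1, by omega, by omega, by omega⟩
        · exact ⟨1, by omega, by omega, by omega⟩
      obtain ⟨v, hv, -, hform⟩ := long ha (by omega)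
      have h₁ := hform r (by omega)
      have h₂ := hform t (by omega)
      have h₃ := h.coord_eq_one hv
      rw [hT, Finset.sum_singleton, ht] at h₃
      omega
  · have hr' := le_of_mem_labels (show r ∈ labels S by simp [hT])
    have hs' := le_of_mem_labels (show s ∈ labels S by simp [hT])
    exfalso
    by_cases hsn : s = n
    · -- coordinate `1` at `r` and `n`, and `2` at `t`
      obtain ⟨v, hv, hform⟩ := hasRoot_C_add (n := n) (a := r) (b := t) (by omega) (by omega)
        (by omega)
      have h₀ := hform r (by omega)
      have h₁ := hform n (by omega)
      have h₂ := hform t (by omega)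
      have h₃ := h.coord_eq_one hv
      rw [hT, Finset.sum_pair (by omega), ht, hsn] at h₃
      rw [w v (by omega)] at h₀ h₂
      rw [wn] at h₁
      simp only [ind] at h₀ h₁ h₂
      omega
    · -- coordinate `2` at `s`, and `0` at `r` and `t`
      obtain ⟨v, hv, -, hform⟩ := long (a := t + 1) (by omega) (by omega)
      have h₀ := hform r (by omega)
      have h₁ := hform s (by omega)
      have h₂ := hform t (by omega)
      have h₃ := h.coord_eq_one hv
      rw [hT, Finset.sum_pair (by omega), ht] at h₃
      omega

theorem cartanMatrix_D_apply (hn : 4 ≤ n) (i j : Fin n) : CartanMatrix.D n i j =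
    if (i : ℕ) = j then 2 else
    if ((i : ℕ) + 1 = j ∧ (j : ℕ) + 1 < n) ∨ ((j : ℕ) + 1 = i ∧ (i : ℕ) + 1 < n) ∨
      ((i : ℕ) + 3 = n ∧ (j : ℕ) + 1 = n) ∨ ((j : ℕ) + 3 = n ∧ (i : ℕ) + 1 = n)
    then -1 else 0 := by
  simp only [CartanMatrix.D, Matrix.of_apply, if_neg (show ¬n ≤ 2 by omega), Fin.ext_iff]
  split_ifs <;> omega

/-- The table is invariant under the automorphism that exchanges `α_{n-1}` and `α_n`. -/
theorem listed_D_swap (hn : 4 ≤ n) {S T : Finset (Fin n)}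
    (h : Listed (CartanMatrix.D n)
      (S.map (Equiv.swap (⟨n - 2, by omega⟩ : Fin n) ⟨n - 1, by omega⟩).symm.toEmbedding)
      (T.map (Equiv.swap (⟨n - 2, by omega⟩ : Fin n) ⟨n - 1, by omega⟩).symm.toEmbedding)) :
    Listed (CartanMatrix.D n) S T := by
  refine h.of_equiv _ fun i j ↦ ?_
  have hi := i.2
  have hj := j.2
  have hval (k : Fin n) : (Equiv.swap (⟨n - 2, by omega⟩ : Fin n) ⟨n - 1, by omega⟩ k : ℕ) =
      if (k : ℕ) = n - 2 then n - 1 else if (k : ℕ) = n - 1 then n - 2 else k := by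
    rw [Equiv.swap_apply_def]
    simp only [Fin.ext_iff]
    split_ifs <;> rfl
  rw [cartanMatrix_D_apply hn, cartanMatrix_D_apply hn, hval, hval]
  refine if_congr ?_ rfl (if_congr ?_ rfl rfl)
  · split_ifs <;> omega
  · split_ifs <;> omega

/-- The argument of type `B` for the labels other than `n`, along the chain from `α_1` to
`α_{n-1}`. If `α_n` is in `S`, it is combined with the analogous statement for the other chain, from
`α_1` to `α_n`. The automorphism that exchanges `α_{n-1}` and `α_n` is needed if `σ` is
`α_{n-1}`. -/
theorem Good.listedD (hn : 4 ≤ n) (h : Good (CartanMatrix.D n) S σ) :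
    Listed (CartanMatrix.D n) S {σ} := by
  have hσ := σ.2
  have w (v : Fin n → ℤ) {k : ℕ} (hk : k + 1 < n) : coordD v k = coord v k := by
    rw [coordD, if_neg (by omega), if_neg (by omega)]
  have w1 (v : Fin n → ℤ) : coordD v (n - 1) = coord v (n - 1) + coord v n := by
    rw [coordD, if_neg (by omega), if_pos (by omega)]
  have w0 (v : Fin n → ℤ) : coordD v n = 2 * coord v n := if_pos rfl
  -- the roots `e_a + e_b` and `e_a - e_b`, in coordinates
  have hadd {a b : ℕ} (ha : 1 ≤ a) (hab : a < b) (hb : b ≤ n) :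
      ∃ v, IsRootVec (CartanMatrix.D n) v ∧ coord v n = 1 ∧
        coord v (n - 1) = (if b ≤ n - 1 then 1 else 0) ∧
        ∀ k, k + 1 < n → coord v k = ind a k + ind b k := by
    obtain ⟨v, hv, hform⟩ := hasRoot_D_add hn ha hab hb
    have h₀ := hform n le_rfl
    have h₁ := hform (n - 1) (by omega)
    rw [w0] at h₀
    rw [w1] at h₁
    simp only [ind] at h₀ h₁
    refine ⟨v, hv, by omega, by omega, fun k hk ↦ ?_⟩
    rw [← w v hk, hform k (by omega)]
    ring
  have hsub {a b : ℕ} (ha : 1 ≤ a) (hab : a < b) (hb : b ≤ n) :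
      ∃ v, IsRootVec (CartanMatrix.D n) v ∧ coord v n = 0 ∧
        ∀ k, k < n → coord v k = ind a k - ind b k := by
    obtain ⟨v, hv, hform⟩ := hasRoot_D_sub hn ha hab hb
    have h₀ := hform n le_rfl
    rw [w0] at h₀
    simp only [ind] at h₀
    refine ⟨v, hv, by omega, fun k hk ↦ ?_⟩
    by_cases hk' : k + 1 < n
    · rw [← w v hk', hform k (by omega)]
      ring
    · obtain rfl : k = n - 1 := by omega
      have h₁ := hform (n - 1) (by omega)
      rw [w1] at h₁
      simp only [ind] at h₁ ⊢
      omega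
  generalize ht : (σ : ℕ) + 1 = t at *
  have hm {k : ℕ} (hk : k ∈ labels S) : 1 ≤ k ∧ k ≤ n := le_of_mem_labels hk
  have htS {k : ℕ} (hk : k ∈ labels S) : k ≠ t := by
    rintro rfl
    exact h.notMem (mem_labels.1 (ht ▸ hk))
  have hadj : ∀ r ∈ (labels S).erase n, ∀ s ∈ (labels S).erase n, r < s →
      (∀ k ∈ (labels S).erase n, ¬(r < k ∧ k < s)) → r < t ∧ t < s := by
    intro r hr s hs hrs hT
    have hr' := hm (Finset.mem_of_mem_erase hr)
    have hs' := hm (Finset.mem_of_mem_erase hs)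
    have hsn := Finset.ne_of_mem_erase hs
    obtain ⟨v, hv, hn', hform⟩ := hsub (b := s + 1) hr'.1 (by omega) (by omega)
    rw [← ht]
    refine h.lt_and_lt (Finset.erase_subset _ _) hr hs hrs hT hv (fun k hk ↦ ?_)
      (fun k hk hk' ↦ ?_) ?_
    · have hk' := hm (Finset.mem_of_mem_erase hk)
      have hkn := Finset.ne_of_mem_erase hk
      rw [hform k (by omega)]
      simp only [ind]
      omega
    · obtain rfl : k = n := by simpa [hk] using hk'
      exact hn'
    · by_cases hσn : (σ : ℕ) + 1 = n
      · rw [hσn, hn']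
        omega
      · rw [hform _ (by omega)]
        simp only [ind]
        omega
  -- the second set lies between the last label and the one before it on the chain to `α_n`
  have hadj' : ∀ r ∈ labels S, n ∈ labels S → r + 1 < n → (∀ k ∈ labels S, r < k → n ≤ k + 1) →
      r < t ∧ t + 1 < n := by
    intro r hr hnS hrn hT
    obtain ⟨v, hv, hv0, hv1, hform⟩ := hadd (b := n) (hm hr).1 (by omega) le_rfl
    have h2 : ∑ k ∈ labels S, coord v k = 2 := by
      rw [← Finset.sum_subset (s₁ := {r, n}), Finset.sum_pair (by omega), hv0, hform r hrn]
      · simp only [ind]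
        omega
      · exact Finset.insert_subset hr (Finset.singleton_subset_iff.2 hnS)
      · intro k hk hkrn
        have := hT k hk
        have := hm hk
        simp only [Finset.mem_insert, Finset.mem_singleton] at hkrn
        by_cases hkn : k = n - 1
        · rw [hkn, hv1, if_neg (by omega)]
        · rw [hform k (by omega)]
          simp only [ind]
          omega
    have h1 := h.coord_eq_one hv h2
    rw [ht] at h1
    have := htS hnS
    have := htS hr
    by_cases htn : t = n - 1
    · rw [htn, hv1, if_neg (by omega)] at h1
      omega
    · rw [hform t (by omega)] at h1
      simp only [ind] at h1
      omega
  -- a single label is not the one of an end of the diagram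
  have hsingle {r : ℕ} (hT : labels S = {r}) : 1 < r ∧ r + 1 < n := by
    have hr := hm (show r ∈ labels S by simp [hT])
    obtain ⟨v, hv, h2⟩ := h.exists_sum_eq_two (show r ∈ labels S by simp [hT])
    obtain ⟨a, b, ε, δ, hε, hδ, hab, ha, hb, hform⟩ := hv.form_D hn
    rw [hT, Finset.sum_singleton] at h2
    have h₀ := hform n le_rfl
    have h₁ := hform (n - 1) (by omega)
    rw [w0] at h₀
    rw [w1] at h₁
    have h₂ := hform r (by omega)
    simp only [ind] at h₀ h₁ h₂
    by_contra hne
    rcases (by omega : r = 1 ∨ r = n - 1 ∨ r = n) with rfl | rfl | rfl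
    · rw [w v (by omega)] at h₂
      rcases hε with rfl | rfl <;> rcases hδ with rfl | rfl <;> omega
    · rcases hε with rfl | rfl <;> rcases hδ with rfl | rfl <;> omega
    · rcases hε with rfl | rfl <;> rcases hδ with rfl | rfl <;> omega
  by_cases hnS : n ∈ labels S
  · rw [← Finset.insert_erase hnS] at hsingle
    have hempty : ((labels S).erase n).Nonempty := by
      rw [Finset.nonempty_iff_ne_empty]
      intro he
      have := hsingle (r := n) (by rw [he]; rfl)
      omega
    rcases eq_singleton_or_pair hempty hadj with ⟨r, hT⟩ | ⟨r, s, hr, hs, hT⟩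
    -- the case `S = {α_r, α_n}` does not occur
    · have hrS : r ∈ (labels S).erase n := by simp [hT]
      have hrn := Finset.ne_of_mem_erase hrS
      replace hrS := Finset.mem_of_mem_erase hrS
      have hr' := hm hrS
      have hT' : labels S = {r, n} := by
        rw [← Finset.insert_erase hnS, hT, Finset.pair_comm]
      exfalso
      by_cases hr1 : r = n - 1
      · have htn : t = n - 2 := by
          obtain ⟨v, hv, hv0, hv1, hform⟩ := hadd (a := n - 2) (b := n - 1) (by omega) (by omega)
            (by omega)
          have h₃ := h.coord_eq_one hv
          rw [hT', Finset.sum_pair (by omega), ht, hr1, hv0, hv1, if_pos le_rfl] at h₃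
          have := htS hnS
          have := htS hrS
          have hf := hform t (by omega)
          simp only [ind] at hf
          omega
        -- coordinate `1` at `n - 1` and `n`, and `2` at `t`
        obtain ⟨v, hv, hv0, hv1, hform⟩ := hadd (a := 1) (b := 2) (by omega) (by omega) (by omega)
        have h₃ := h.coord_eq_one hv
        rw [hT', Finset.sum_pair (by omega), ht, hr1, hv0, hv1, if_pos (by omega)] at h₃
        have hf := hform t (by omega)
        simp only [ind] at hf
        omega
      · have htr := hadj' r hrS hnS (by omega) fun k hk hrk ↦ by
          rw [hT', Finset.mem_insert, Finset.mem_singleton] at hk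
          omega
        -- coordinate `1` at `r` and `n`, and `2` at `t`
        obtain ⟨v, hv, hv0, hv1, hform⟩ := hadd (a := r) (b := t) (by omega) (by omega) (by omega)
        have h₃ := h.coord_eq_one hv
        rw [hT', Finset.sum_pair (by omega), ht, hv0, hform r (by omega)] at h₃
        have hf := hform t (by omega)
        simp only [ind] at hf h₃
        omega
    -- if `S = {α_r, α_s, α_n}`, then `s = n - 1`, `t = n - 2` and `r = n - 3`
    · have hrS : r ∈ (labels S).erase n := by simp [hT]
      have hsS : s ∈ (labels S).erase n := by simp [hT]
      have hsn := Finset.ne_of_mem_erase hsS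
      replace hrS := Finset.mem_of_mem_erase hrS
      replace hsS := Finset.mem_of_mem_erase hsS
      have hr' := hm hrS
      have hs' := hm hsS
      have hT' : labels S = {r, s, n} := by
        rw [← Finset.insert_erase hnS, hT, Finset.insert_comm, Finset.pair_comm n s]
      have hs1 : s = n - 1 := by
        by_contra hne
        have := hadj' s hsS hnS (by omega) fun k hk hsk ↦ by
          rw [hT'] at hk
          simp only [Finset.mem_insert, Finset.mem_singleton] at hk
          omega
        omega
      subst hs1
      have hsum (v : Fin n → ℤ) : ∑ k ∈ labels S, coord v k =
          coord v r + (coord v (n - 1) + coord v n) := by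
        rw [hT', Finset.sum_insert (by simp; omega), Finset.sum_pair (by omega)]
      have htn : t = n - 2 := by
        by_contra hne
        obtain ⟨v, hv, hv0, hv1, hform⟩ := hadd (a := n - 2) (b := n - 1) (by omega) (by omega)
          (by omega)
        have h₃ := h.coord_eq_one hv
        rw [hsum, ht, hv0, hv1, if_pos le_rfl, hform r (by omega)] at h₃
        have hf := hform t (by omega)
        simp only [ind] at hf h₃
        omega
      have hrn : r = n - 3 := by
        by_contra hne
        obtain ⟨v, hv, hv0, hv1, hform⟩ := hadd (a := r + 1) (b := t) (by omega) (by omega)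
          (by omega)
        have h₃ := h.coord_eq_one hv
        rw [hsum, ht, hv0, hv1, if_pos (by omega), hform r (by omega)] at h₃
        have hf := hform t (by omega)
        simp only [ind] at hf h₃
        omega
      refine listed_of_labels ?_
      rw [ht, htn, hT', hrn]
      exact .D_branch n hn
  · rw [Finset.erase_eq_of_notMem hnS] at hadj
    rcases eq_singleton_or_pair h.labels_nonempty hadj with ⟨r, hT⟩ | ⟨r, s, hr, hs, hT⟩
    · have hr := hsingle hT
      have hrt := htS (show r ∈ labels S by simp [hT])
      rcases (by omega : t = n ∨ t = n - 1 ∨ t = 1 ∨ (2 ≤ t ∧ t ≤ n - 2)) with htn | htn | htn | htn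
      · refine listed_of_labels ?_
        rw [ht, hT, htn]
        exact .D_last n r hn hr.1 (by omega)
      · refine listed_D_swap hn ?_
        obtain ⟨i, rfl⟩ : ∃ i : Fin n, r = i + 1 := ⟨⟨r - 1, by omega⟩, by simp only; omega⟩
        have hS : S = {i} := by
          ext j
          rw [← mem_labels, hT, Finset.mem_singleton, Finset.mem_singleton, Fin.ext_iff]
          omega
        have hσ' : σ = ⟨n - 2, by omega⟩ := Fin.ext (by simp only; omega)
        rw [hS, hσ', Finset.map_singleton, Finset.map_singleton, Equiv.symm_swap,
          Equiv.coe_toEmbedding, Equiv.swap_apply_left, Equiv.swap_apply_of_ne_of_ne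
            (by rw [ne_eq, Fin.ext_iff]; simp only; omega)
            (by rw [ne_eq, Fin.ext_iff]; simp only; omega)]
        refine listed_of_labels ?_
        rw [labels, Finset.image_singleton, show n - 1 + 1 = n by omega]
        exact .D_last n _ hn hr.1 (by omega)
      · by_cases hr2 : r = 2
        · refine listed_of_labels ?_
          rw [ht, hT, htn, hr2]
          exact .D_first n hn
        obtain ⟨v, hv, hv0, hv1, hform⟩ := hadd (a := 2) (b := 3) (by omega) (by omega) (by omega)
        have h₃ := h.coord_eq_one hv
        rw [hT, Finset.sum_singleton, ht, hform r (by omega), hform t (by omega)] at h₃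
        simp only [ind] at h₃
        omega
      · obtain ⟨v, hv, hv0, hv1, hform⟩ := hadd (a := 1) (b := 2) (by omega) (by omega) (by omega)
        have h₃ := h.coord_eq_one hv
        rw [hT, Finset.sum_singleton, ht, hform r (by omega), hform t (by omega)] at h₃
        simp only [ind] at h₃
        omega
    · have hr' := hm (show r ∈ labels S by simp [hT])
      have hs' := hm (show s ∈ labels S by simp [hT])
      have hsn : s ≠ n := by rintro rfl; exact hnS (by simp [hT])
      have hs1 : s ≠ n - 1 := by
        rintro rfl
        obtain ⟨v, hv, hv0, hv1, hform⟩ := hadd (a := r) (b := t) (by omega) (by omega) (by omega)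
        have h₃ := h.coord_eq_one hv
        rw [hT, Finset.sum_pair (by omega), ht, hform r (by omega), hform t (by omega), hv1] at h₃
        simp only [ind] at h₃
        omega
      have ht₁ : t = r + 1 := by
        by_contra hne
        obtain ⟨v, hv, -, -, hform⟩ := hadd (a := r + 1) (b := t) (by omega) (by omega) (by omega)
        have h₃ := h.coord_eq_one hv
        rw [hT, Finset.sum_pair (by omega), ht, hform r (by omega), hform s (by omega),
          hform t (by omega)] at h₃
        simp only [ind] at h₃
        omega
      have hs₁ : s = r + 2 := by
        by_contra hne
        obtain ⟨v, hv, -, -, hform⟩ := hadd (a := t + 1) (b := s) (by omega) (by omega) (by omega)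
        have h₃ := h.coord_eq_one hv
        rw [hT, Finset.sum_pair (by omega), ht, hform r (by omega), hform s (by omega),
          hform t (by omega)] at h₃
        simp only [ind] at h₃
        omega
      refine listed_of_labels ?_
      rw [ht, hT, hs₁, ht₁]
      exact .D_adjacent n r hn hr'.1 (by omega)

end Completeness

/-! ### Cartan matrices of finite type and their trees -/

section FiniteType

variable {ι : Type*} [Fintype ι] [DecidableEq ι]

/-- The properties of the Cartan matrix of an irreducible root system that determine its type. The
last one is a consequence of positive definiteness: there is no nonzero vector `v ≥ 0` such that
`v A` is nonpositive on the support of `v`. -/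
structure IsFiniteType (A : Matrix ι ι ℤ) : Prop where
  diag : ∀ i, A i i = 2
  nonpos : ∀ i j, i ≠ j → A i j ≤ 0
  zero_symm : ∀ i j, A i j = 0 → A j i = 0
  connected : ∀ S : Finset ι, S.Nonempty → (∀ i ∈ S, ∀ j, A i j ≠ 0 → j ∈ S) → S = Finset.univ
  eq_zero : ∀ v : ι → ℤ, (∀ x, 0 ≤ v x) → (∀ x, 0 < v x → ∑ y, v y * A y x ≤ 0) → v = 0

/-- The contribution of the vertex `x` at the vertex `y` of `K`, for the vector `v` which is `2` on
`K`, and `-∑ A y x` with the sum over `y ∈ K` at the vertices `x ∉ K`: it is a lower bound for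
`-v x * A x y` for `x ≠ y`. -/
def contribution (A : Matrix ι ι ℤ) (K : Finset ι) (y x : ι) : ℤ :=
  if x = y then 0 else if x ∈ K then -2 * A x y else A x y * A y x

namespace IsFiniteType

variable {A : Matrix ι ι ℤ} (hA : IsFiniteType A)
include hA

omit [DecidableEq ι] in
theorem mul_nonneg {i j : ι} (h : i ≠ j) : 0 ≤ A i j * A j i :=
  mul_nonneg_of_nonpos_of_nonpos (hA.nonpos i j h) (hA.nonpos j i h.symm)

omit [DecidableEq ι] in
theorem le_neg_one {i j : ι} (h : i ≠ j) (h0 : A i j ≠ 0) : A i j ≤ -1 := by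
  have := hA.nonpos i j h
  omega

omit [DecidableEq ι] in
theorem ne_zero_symm {i j : ι} (h0 : A i j ≠ 0) : A j i ≠ 0 := fun h ↦ h0 (hA.zero_symm _ _ h)

omit [DecidableEq ι] in
theorem one_le_mul {i j : ι} (h : i ≠ j) (h0 : A i j ≠ 0) : 1 ≤ A i j * A j i := by
  have h₁ := hA.le_neg_one h h0
  have h₂ := hA.le_neg_one h.symm (hA.ne_zero_symm h0)
  nlinarith

theorem contribution_nonneg (K : Finset ι) (y x : ι) : 0 ≤ contribution A K y x := by
  rw [contribution]
  split_ifs with h₁ h₂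
  · exact le_rfl
  · have := hA.nonpos x y h₁
    omega
  · exact hA.mul_nonneg h₁

/-- No set of vertices of a diagram of finite type has contributions of sum at least `4` at all of
its elements. This excludes cycles, two branch points or multiple bonds, and the like. -/
theorem false_of_contribution {K : Finset ι} (hK : K.Nonempty)
    (h : ∀ y ∈ K, ∃ P : Finset ι, 4 ≤ ∑ x ∈ P, contribution A K y x) : False := by
  -- a vector `v ≥ 0` with `v A ≤ 0`: outside `K` it is as large as this allows
  set v : ι → ℤ := fun x ↦ if x ∈ K then 2 else ∑ y ∈ K, -A y x with hv
  have hvK {x} (hx : x ∈ K) : v x = 2 := if_pos hx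
  have hvK' {x} (hx : x ∉ K) : v x = ∑ y ∈ K, -A y x := if_neg hx
  have hterm {x y} (hx : x ∉ K) (hy : y ∈ K) : 0 ≤ -A y x := by
    have := hA.nonpos y x (fun h ↦ hx (h ▸ hy))
    omega
  have hv0 (x) : 0 ≤ v x := by
    by_cases hx : x ∈ K
    · rw [hvK hx]
      norm_num
    · rw [hvK' hx]
      exact Finset.sum_nonneg fun y hy ↦ hterm hx hy
  have hzero : v = 0 := by
    refine hA.eq_zero v hv0 fun x _ ↦ ?_
    rw [← Finset.add_sum_erase _ _ (Finset.mem_univ x), hA.diag]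
    by_cases hx : x ∈ K
    · obtain ⟨P, hP⟩ := h x hx
      have h4 : 4 ≤ ∑ z, contribution A K x z :=
        hP.trans (Finset.sum_le_sum_of_subset_of_nonneg (Finset.subset_univ P)
          fun z _ _ ↦ hA.contribution_nonneg K x z)
      rw [← Finset.add_sum_erase _ _ (Finset.mem_univ x), contribution, if_pos rfl, zero_add] at h4
      have hle : ∑ z ∈ Finset.univ.erase x, v z * A z x ≤
          ∑ z ∈ Finset.univ.erase x, -contribution A K x z := by
        refine Finset.sum_le_sum fun z hz ↦ ?_
        have hzx := Finset.ne_of_mem_erase hz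
        rw [contribution, if_neg hzx]
        split_ifs with hzK
        · rw [hvK hzK]
          linarith
        · have h₁ : -A x z ≤ v z := by
            rw [hvK' hzK]
            exact Finset.single_le_sum (f := fun y ↦ -A y z) (fun y hy ↦ hterm hzK hy) hx
          have := hA.nonpos z x hzx
          nlinarith
      rw [Finset.sum_neg_distrib] at hle
      rw [hvK hx]
      linarith
    · have hle : ∑ z ∈ Finset.univ.erase x, v z * A z x ≤
          ∑ z ∈ Finset.univ.erase x, if z ∈ K then 2 * A z x else 0 := by
        refine Finset.sum_le_sum fun z hz ↦ ?_
        split_ifs with hzK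
        · rw [hvK hzK]
        · exact mul_nonpos_of_nonneg_of_nonpos (hv0 z) (hA.nonpos z x (Finset.ne_of_mem_erase hz))
      rw [← Finset.sum_filter, Finset.filter_mem_eq_inter, Finset.erase_inter, Finset.univ_inter,
        Finset.erase_eq_of_notMem hx, ← Finset.mul_sum] at hle
      have := hvK' hx
      rw [Finset.sum_neg_distrib] at this
      linarith
  obtain ⟨y, hy⟩ := hK
  have := hvK hy
  rw [hzero] at this
  exact two_ne_zero this.symm

/-- No set of vertices carries a cycle: some vertex has at most one neighbour in the set. -/
theorem exists_card_le_one {K : Finset ι} (hK : K.Nonempty) :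
    ∃ y ∈ K, (K.filter fun x ↦ x ≠ y ∧ A x y ≠ 0).card ≤ 1 := by
  by_contra! h
  refine hA.false_of_contribution hK fun y hy ↦ ?_
  obtain ⟨a, ha, b, hb, hab⟩ := Finset.one_lt_card.1 (h y hy)
  rw [Finset.mem_filter] at ha hb
  refine ⟨{a, b}, ?_⟩
  rw [Finset.sum_pair hab, contribution, contribution, if_neg ha.2.1, if_neg hb.2.1, if_pos ha.1,
    if_pos hb.1]
  have := hA.le_neg_one ha.2.1 ha.2.2
  have := hA.le_neg_one hb.2.1 hb.2.2
  omega

omit hA in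
/-- The number of ordered pairs of neighbours in a set of vertices. -/
def edgeCount (A : Matrix ι ι ℤ) (K : Finset ι) : ℕ :=
  ∑ y ∈ K, (K.filter fun x ↦ x ≠ y ∧ A x y ≠ 0).card

theorem edgeCount_insert {K : Finset ι} {w : ι} (hw : w ∉ K) :
    edgeCount A (insert w K) =
      edgeCount A K + 2 * (K.filter fun x ↦ x ≠ w ∧ A x w ≠ 0).card := by
  have h₁ : ∀ y ∈ K, ((insert w K).filter fun x ↦ x ≠ y ∧ A x y ≠ 0).card =
      (K.filter fun x ↦ x ≠ y ∧ A x y ≠ 0).card + if y ≠ w ∧ A y w ≠ 0 then 1 else 0 := by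
    intro y hy
    have hwy : w ≠ y := fun h ↦ hw (h ▸ hy)
    rw [Finset.filter_insert]
    by_cases h : A w y = 0
    · simp [h, hA.zero_symm _ _ h]
    · rw [if_pos ⟨hwy, h⟩, if_pos ⟨hwy.symm, hA.ne_zero_symm h⟩, Finset.card_insert_of_notMem]
      simp [hw]
  have h₂ : (insert w K).filter (fun x ↦ x ≠ w ∧ A x w ≠ 0) =
      K.filter fun x ↦ x ≠ w ∧ A x w ≠ 0 := by
    rw [Finset.filter_insert, if_neg (by simp)]
  rw [edgeCount, Finset.sum_insert hw, h₂, Finset.sum_congr rfl h₁, Finset.sum_add_distrib,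
    ← Finset.card_filter, edgeCount]
  ring

/-- A diagram of finite type is a forest. -/
theorem edgeCount_lt {K : Finset ι} (hK : K.Nonempty) : edgeCount A K + 2 ≤ 2 * K.card := by
  induction hn : K.card generalizing K with
  | zero => simp [hK.ne_empty] at hn
  | succ n ih =>
    obtain ⟨y, hy, h1⟩ := hA.exists_card_le_one hK
    have hy' := Finset.notMem_erase y K
    have hins := hA.edgeCount_insert hy'
    rw [Finset.insert_erase hy] at hins
    have hle : ((K.erase y).filter fun x ↦ x ≠ y ∧ A x y ≠ 0).card ≤ 1 :=
      (Finset.card_le_card (Finset.filter_subset_filter _ (Finset.erase_subset y K))).trans h1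
    have hc := Finset.card_erase_of_mem hy
    rcases (K.erase y).eq_empty_or_nonempty with he | hne
    · rw [he] at hins
      simp only [edgeCount, Finset.sum_empty, Finset.filter_empty, Finset.card_empty] at hins
      simp only [edgeCount]
      omega
    · have := ih hne (by omega)
      omega

omit hA in
/-- A vertex set which carries at least as many edges as a spanning tree. -/
def IsTree (A : Matrix ι ι ℤ) (K : Finset ι) : Prop := 2 * K.card ≤ edgeCount A K + 2

theorem isTree_insert {K : Finset ι} {w x : ι} (hK : IsTree A K) (hw : w ∉ K) (hx : x ∈ K)
    (hxw : A x w ≠ 0) : IsTree A (insert w K) := by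
  have hins := hA.edgeCount_insert hw
  have hpos : 0 < (K.filter fun x ↦ x ≠ w ∧ A x w ≠ 0).card :=
    Finset.card_pos.2 ⟨x, Finset.mem_filter.2 ⟨hx, fun h ↦ hw (h ▸ hx), hxw⟩⟩
  rw [IsTree] at *
  rw [Finset.card_insert_of_notMem hw]
  omega

/-- A new vertex is joined to only one vertex of a tree. -/
theorem eq_of_isTree {K : Finset ι} {w x y : ι} (hK : IsTree A K) (hw : w ∉ K) (hx : x ∈ K)
    (hy : y ∈ K) (hxw : A x w ≠ 0) (hyw : A y w ≠ 0) : x = y := by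
  by_contra hne
  have hins := hA.edgeCount_insert hw
  have hlt := hA.edgeCount_lt (Finset.insert_nonempty w K)
  have hpos : 1 < (K.filter fun x ↦ x ≠ w ∧ A x w ≠ 0).card :=
    Finset.one_lt_card.2 ⟨x, Finset.mem_filter.2 ⟨hx, fun h ↦ hw (h ▸ hx), hxw⟩,
      y, Finset.mem_filter.2 ⟨hy, fun h ↦ hw (h ▸ hy), hyw⟩, hne⟩
  rw [IsTree] at hK
  rw [Finset.card_insert_of_notMem hw] at hlt
  omega

/-- No numbered vertices carry a vector `c ≥ 0`, `c ≠ 0`, such that `c A ≤ 0` on the support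
of `c`. This excludes the diagrams of affine type. -/
theorem false_of_sum_le {n : ℕ} {f : ℕ → ι} (hf : ∀ i < n, ∀ j < n, f i = f j → i = j) (c : ℕ → ℤ)
    (hc : ∀ i, 0 ≤ c i) {k : ℕ} (hk : k < n) (hck : c k ≠ 0)
    (h : ∀ b < n, 0 < c b → ∑ a ∈ Finset.range n, c a * A (f a) (f b) ≤ 0) : False := by
  set v : ι → ℤ := fun x ↦ ∑ a ∈ Finset.range n, if f a = x then c a else 0 with hv
  have hvf {b} (hb : b < n) : v (f b) = c b := by
    rw [hv]
    simp only
    rw [Finset.sum_eq_single b, if_pos rfl]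
    · intro a ha hab
      rw [if_neg fun h ↦ hab (hf a (Finset.mem_range.1 ha) b hb h)]
    · intro hb'
      exact absurd (Finset.mem_range.2 hb) hb'
  have hv0 : v = 0 := by
    refine hA.eq_zero v (fun x ↦ Finset.sum_nonneg fun a _ ↦ ?_) fun x hx ↦ ?_
    · split_ifs
      exacts [hc a, le_rfl]
    obtain ⟨b, hb, hbx⟩ := Finset.exists_ne_zero_of_sum_ne_zero hx.ne'
    obtain rfl : f b = x := by
      by_contra hne
      exact hbx (if_neg hne)
    rw [Finset.mem_range] at hb
    rw [hvf hb] at hx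
    refine le_trans (le_of_eq ?_) (h b hb hx)
    simp only [hv, Finset.sum_mul, ite_mul, zero_mul]
    rw [Finset.sum_comm]
    simp
  have := hvf hk
  rw [hv0] at this
  exact hck this.symm

/-- `false_of_contribution` for numbered vertices. -/
theorem false_of_contribution' {n : ℕ} {f : ℕ → ι} (hf : ∀ i < n, ∀ j < n, f i = f j → i = j)
    {K : Finset ℕ} (hKn : ∀ i ∈ K, i < n) (hK : K.Nonempty)
    (h : ∀ y ∈ K, ∃ P : Finset ℕ, (∀ x ∈ P, x < n) ∧ 4 ≤ ∑ x ∈ P, if x = y then 0 else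
      if x ∈ K then -2 * A (f x) (f y) else A (f x) (f y) * A (f y) (f x)) : False := by
  refine hA.false_of_contribution (hK.image f) fun y hy ↦ ?_
  obtain ⟨y, hyK, rfl⟩ := Finset.mem_image.1 hy
  obtain ⟨P, hP, h4⟩ := h y hyK
  refine ⟨P.image f, h4.trans (le_of_eq ?_)⟩
  rw [Finset.sum_image fun i hi j hj ↦ hf i (hP i hi) j (hP j hj)]
  refine Finset.sum_congr rfl fun x hx ↦ ?_
  have hxy : f x = f y ↔ x = y := ⟨hf x (hP x hx) y (hKn y hyK), congrArg f⟩
  have hxK : f x ∈ K.image f ↔ x ∈ K := by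
    rw [Finset.mem_image]
    exact ⟨fun ⟨z, hz, hzx⟩ ↦ hf z (hKn z hz) x (hP x hx) hzx ▸ hz, fun hx ↦ ⟨x, hx, rfl⟩⟩
  simp only [contribution, hxy, hxK]

end IsFiniteType

end FiniteType

/-! ### The shape of a diagram of finite type -/

section Shape

variable {ι : Type*} [Fintype ι] [DecidableEq ι] {A : Matrix ι ι ℤ}

/-- The edges of a chain of vertices `0, 1, 2, …`. -/
def ChainEdge (i j : ℕ) : Prop := i + 1 = j ∨ j + 1 = i

/-- The edges of a chain of vertices `0, …, n - 2` with one more vertex `n - 1` which is joined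
to `k`. -/
def BranchEdge (n k i j : ℕ) : Prop :=
  (i + 1 = j ∧ j + 1 < n) ∨ (j + 1 = i ∧ i + 1 < n) ∨ (i = k ∧ j + 1 = n) ∨ (j = k ∧ i + 1 = n)

/-- The vertices `f 0, …, f (n - 1)` are distinct, and the relation `R` describes which of them are
joined in the diagram of `A`. -/
structure Realizes (A : Matrix ι ι ℤ) (n : ℕ) (R : ℕ → ℕ → Prop) (f : ℕ → ι) : Prop where
  injective : ∀ i < n, ∀ j < n, f i = f j → i = j
  edge_iff : ∀ i < n, ∀ j < n, i ≠ j → (A (f i) (f j) ≠ 0 ↔ R i j)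

omit [Fintype ι] [DecidableEq ι] in
theorem Realizes.relabel {n : ℕ} {R R' : ℕ → ℕ → Prop} {f : ℕ → ι} (h : Realizes A n R f)
    (π : ℕ → ℕ) (hπ : ∀ i < n, π i < n) (hinj : ∀ i < n, ∀ j < n, π i = π j → i = j)
    (hR : ∀ i < n, ∀ j < n, i ≠ j → (R (π i) (π j) ↔ R' i j)) : Realizes A n R' (f ∘ π) where
  injective i hi j hj hij := hinj i hi j hj (h.injective _ (hπ i hi) _ (hπ j hj) hij)
  edge_iff i hi j hj hij := (h.edge_iff _ (hπ i hi) _ (hπ j hj)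
    fun h ↦ hij (hinj i hi j hj h)).trans (hR i hi j hj hij)

omit [Fintype ι] in
theorem image_comp_range {n : ℕ} {f : ℕ → ι} (π : ℕ → ℕ) (hπ : ∀ i < n, π i < n)
    (hinj : ∀ i < n, ∀ j < n, π i = π j → i = j) :
    (Finset.range n).image (f ∘ π) = (Finset.range n).image f := by
  have : (Finset.range n).image π = Finset.range n := by
    refine Finset.eq_of_subset_of_card_le (fun x hx ↦ ?_) (le_of_eq ?_)
    · obtain ⟨i, hi, rfl⟩ := Finset.mem_image.1 hx
      exact Finset.mem_range.2 (hπ i (Finset.mem_range.1 hi))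
    · rw [Finset.card_image_of_injOn fun i hi j hj ↦ hinj i (by simpa using hi) j
        (by simpa using hj)]
  rw [← Finset.image_image, this]

omit [Fintype ι] [DecidableEq ι] in
/-- Adding the vertex `w`, with number `n`, which is joined to `f j` only. -/
theorem Realizes.extend {n : ℕ} {R : ℕ → ℕ → Prop} {f : ℕ → ι} (h : Realizes A n R f) {w : ι}
    (hw : ∀ i < n, f i ≠ w) {j : ℕ} (hj : ∀ i < n, A (f i) w ≠ 0 ↔ i = j)
    (hj' : ∀ i < n, A w (f i) ≠ 0 ↔ i = j) :
    Realizes A (n + 1) (fun a b ↦ (a < n ∧ b < n ∧ R a b) ∨ (a = j ∧ b = n) ∨ (a = n ∧ b = j))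
      (fun i ↦ if i < n then f i else w) where
  injective a ha b hb hab := by
    split_ifs at hab with h₁ h₂ h₂
    · exact h.injective a h₁ b h₂ hab
    · exact absurd hab (hw a h₁)
    · exact absurd hab.symm (hw b h₂)
    · omega
  edge_iff a ha b hb hab := by
    by_cases h₁ : a < n
    · by_cases h₂ : b < n
      · simp only [h₁, h₂, if_true, h.edge_iff a h₁ b h₂ hab, true_and]
        exact ⟨.inl, fun h ↦ by rcases h with h | h | h <;> [exact h; omega; omega]⟩
      · rw [if_pos h₁, if_neg h₂, hj a h₁]
        omega
    · rw [if_neg h₁, if_pos (by omega), hj' b (by omega)]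
      omega

namespace IsFiniteType

variable (hA : IsFiniteType A)
include hA

/-- The bonds at a vertex have total multiplicity at most `3`. -/
theorem false_of_vertex {n : ℕ} {f : ℕ → ι} (hf : ∀ i < n, ∀ j < n, f i = f j → i = j) {y : ℕ}
    (hy : y < n) {P : Finset ℕ} (hP : ∀ x ∈ P, x < n ∧ x ≠ y)
    (h : 4 ≤ ∑ x ∈ P, A (f x) (f y) * A (f y) (f x)) : False := by
  refine hA.false_of_contribution' hf (K := {y}) (by simpa using hy) (Finset.singleton_nonempty y)
    fun z hz ↦ ⟨P, fun x hx ↦ (hP x hx).1, h.trans (le_of_eq (Finset.sum_congr rfl fun x hx ↦ ?_))⟩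
  rw [Finset.mem_singleton] at hz
  rw [hz, if_neg (hP x hx).2, if_neg (by simpa using (hP x hx).2)]

/-- A path in the diagram cannot have at both ends additional bonds of total multiplicity `2`. -/
theorem false_of_path {n : ℕ} {f : ℕ → ι} (hf : ∀ i < n, ∀ j < n, f i = f j → i = j) {a b : ℕ}
    (hab : a ≤ b) (hb : b < n) (hpath : ∀ i, a ≤ i → i < b → A (f i) (f (i + 1)) ≠ 0)
    (P Q : Finset ℕ) (hPQ : Disjoint P Q) (hP : ∀ x ∈ P, x < n ∧ ¬(a ≤ x ∧ x ≤ b))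
    (hQ : ∀ x ∈ Q, x < n ∧ ¬(a ≤ x ∧ x ≤ b))
    (hPa : 2 ≤ ∑ x ∈ P, A (f x) (f a) * A (f a) (f x))
    (hQb : 2 ≤ ∑ x ∈ Q, A (f x) (f b) * A (f b) (f x)) : False := by
  rcases hab.eq_or_lt with rfl | hab
  · refine hA.false_of_vertex hf hb (P := P ∪ Q) (fun x hx ↦ ?_) ?_
    · rcases Finset.mem_union.1 hx with h | h
      · exact ⟨(hP x h).1, by have := (hP x h).2; omega⟩
      · exact ⟨(hQ x h).1, by have := (hQ x h).2; omega⟩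
    · rw [Finset.sum_union hPQ]
      omega
  have hup {i} (h₁ : a ≤ i) (h₂ : i < b) : 2 ≤ -2 * A (f i) (f (i + 1)) := by
    have := hA.le_neg_one (fun h ↦ by have := hf i (by omega) (i + 1) (by omega) h; omega)
      (hpath i h₁ h₂)
    omega
  have hdown {i} (h₁ : a ≤ i) (h₂ : i < b) : 2 ≤ -2 * A (f (i + 1)) (f i) := by
    have := hA.le_neg_one (fun h ↦ by have := hf (i + 1) (by omega) i (by omega) h; omega)
      (hA.ne_zero_symm (hpath i h₁ h₂))
    omega
  have hend {P : Finset ℕ} {y : ℕ} (hy : a ≤ y ∧ y ≤ b)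
      (hP : ∀ x ∈ P, x < n ∧ ¬(a ≤ x ∧ x ≤ b)) :
      (∑ x ∈ P, if x = y then 0 else if x ∈ Finset.Icc a b then -2 * A (f x) (f y) else
        A (f x) (f y) * A (f y) (f x)) = ∑ x ∈ P, A (f x) (f y) * A (f y) (f x) := by
    refine Finset.sum_congr rfl fun x hx ↦ ?_
    have := (hP x hx).2
    rw [if_neg (by omega), if_neg (by simp; omega)]
  refine hA.false_of_contribution' hf (K := Finset.Icc a b) (fun i hi ↦ ?_)
    (Finset.nonempty_Icc.2 hab.le) fun y hy ↦ ?_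
  · rw [Finset.mem_Icc] at hi
    omega
  rw [Finset.mem_Icc] at hy
  rcases (by omega : y = a ∨ y = b ∨ (a < y ∧ y < b)) with rfl | rfl | hy'
  · refine ⟨insert (y + 1) P, fun x hx ↦ ?_, ?_⟩
    · rcases Finset.mem_insert.1 hx with rfl | hx
      · omega
      · exact (hP x hx).1
    · rw [Finset.sum_insert fun h ↦ (hP _ h).2 (by omega), hend hy hP, if_neg (by omega),
        if_pos (by simp; omega)]
      have := hdown le_rfl hab
      omega
  · obtain ⟨z, rfl⟩ : ∃ z, y = z + 1 := ⟨y - 1, by omega⟩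
    refine ⟨insert z Q, fun x hx ↦ ?_, ?_⟩
    · rcases Finset.mem_insert.1 hx with rfl | hx
      · omega
      · exact (hQ x hx).1
    · rw [Finset.sum_insert fun h ↦ (hQ _ h).2 (by omega), hend hy hQ, if_neg (by omega),
        if_pos (by simp; omega)]
      have := hup (i := z) (by omega) (by omega)
      omega
  · obtain ⟨z, rfl⟩ : ∃ z, y = z + 1 := ⟨y - 1, by omega⟩
    refine ⟨{z, z + 2}, fun x hx ↦ ?_, ?_⟩
    · rcases (by simpa using hx : x = z ∨ x = z + 2) with rfl | rfl <;> omega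
    · rw [Finset.sum_pair (by omega), if_neg (show z ≠ z + 1 by omega),
        if_neg (show z + 2 ≠ z + 1 by omega), if_pos (show z ∈ Finset.Icc a b by simp; omega),
        if_pos (show z + 2 ∈ Finset.Icc a b by simp; omega)]
      have h₁ := hup (i := z) (by omega) (by omega)
      have h₂ := hdown (i := z + 1) (by omega) (by omega)
      rw [show z + 1 + 1 = z + 2 by omega] at h₂
      omega

omit [DecidableEq ι] in
theorem one_le_bond {n : ℕ} {R : ℕ → ℕ → Prop} {f : ℕ → ι} (h : Realizes A n R f) {i j : ℕ}
    (hi : i < n) (hj : j < n) (hij : i ≠ j) (hR : R i j) : 1 ≤ A (f i) (f j) * A (f j) (f i) :=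
  hA.one_le_mul (fun h' ↦ hij (h.injective i hi j hj h')) ((h.edge_iff i hi j hj hij).2 hR)

omit [DecidableEq ι] in
theorem le_neg_one_of_edge {n : ℕ} {R : ℕ → ℕ → Prop} {f : ℕ → ι} (h : Realizes A n R f) {i j : ℕ}
    (hi : i < n) (hj : j < n) (hij : i ≠ j) (hR : R i j) : A (f i) (f j) ≤ -1 :=
  hA.le_neg_one (fun h' ↦ hij (h.injective i hi j hj h')) ((h.edge_iff i hi j hj hij).2 hR)

omit hA [Fintype ι] [DecidableEq ι] in
theorem _root_.CRBigrading.Realizes.eq_zero {n : ℕ} {R : ℕ → ℕ → Prop} {f : ℕ → ι}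
    (h : Realizes A n R f) {i j : ℕ} (hi : i < n) (hj : j < n) (hij : i ≠ j) (hR : ¬R i j) :
    A (f i) (f j) = 0 := by
  by_contra h0
  exact hR ((h.edge_iff i hi j hj hij).1 h0)

/-- The extra vertex of a branched diagram is not joined to an interior vertex of the chain. -/
theorem false_of_second_branch {n k j : ℕ} {F : ℕ → ι} (hk : 1 ≤ k) (hkn : k + 3 ≤ n)
    (hj : 1 ≤ j ∧ j + 3 ≤ n)
    (hF' : Realizes A (n + 1) (fun a b ↦ (a < n ∧ b < n ∧ BranchEdge n k a b) ∨ (a = j ∧ b = n) ∨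
      (a = n ∧ b = j)) F) : False := by
  rcases (by omega : j = k ∨ j < k ∨ k < j) with hj0 | hj0 | hj0
  · refine hA.false_of_path hF'.injective (a := k) (b := k) le_rfl (by omega) (by intros; omega)
      {k - 1, k + 1} {n - 1, n} ?_ ?_ ?_ ?_ ?_
    · simp only [Finset.disjoint_left, Finset.mem_insert, Finset.mem_singleton]
      omega
    · simp only [Finset.mem_insert, Finset.mem_singleton]
      omega
    · simp only [Finset.mem_insert, Finset.mem_singleton]
      omega
    · rw [Finset.sum_pair (by omega)]
      have h₁ := hA.one_le_bond hF' (i := k - 1) (j := k) (by omega) (by omega) (by omega)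
        (by unfold BranchEdge; omega)
      have h₂ := hA.one_le_bond hF' (i := k + 1) (j := k) (by omega) (by omega) (by omega)
        (by unfold BranchEdge; omega)
      omega
    · rw [Finset.sum_pair (by omega)]
      have h₁ := hA.one_le_bond hF' (i := n - 1) (j := k) (by omega) (by omega) (by omega)
        (by unfold BranchEdge; omega)
      have h₂ := hA.one_le_bond hF' (i := n) (j := k) (by omega) (by omega) (by omega)
        (by unfold BranchEdge; omega)
      omega
  · refine hA.false_of_path hF'.injective (a := j) (b := k) (by omega) (by omega)
      (fun i hi hik ↦ (hF'.edge_iff i (by omega) _ (by omega) (by omega)).2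
        (by unfold BranchEdge; omega)) {j - 1, n} {k + 1, n - 1} ?_ ?_ ?_ ?_ ?_
    · simp only [Finset.disjoint_left, Finset.mem_insert, Finset.mem_singleton]
      omega
    · simp only [Finset.mem_insert, Finset.mem_singleton]
      omega
    · simp only [Finset.mem_insert, Finset.mem_singleton]
      omega
    · rw [Finset.sum_pair (by omega)]
      have h₁ := hA.one_le_bond hF' (i := j - 1) (j := j) (by omega) (by omega) (by omega)
        (by unfold BranchEdge; omega)
      have h₂ := hA.one_le_bond hF' (i := n) (j := j) (by omega) (by omega) (by omega)
        (by unfold BranchEdge; omega)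
      omega
    · rw [Finset.sum_pair (by omega)]
      have h₁ := hA.one_le_bond hF' (i := k + 1) (j := k) (by omega) (by omega) (by omega)
        (by unfold BranchEdge; omega)
      have h₂ := hA.one_le_bond hF' (i := n - 1) (j := k) (by omega) (by omega) (by omega)
        (by unfold BranchEdge; omega)
      omega
  · refine hA.false_of_path hF'.injective (a := k) (b := j) (by omega) (by omega)
      (fun i hi hik ↦ (hF'.edge_iff i (by omega) _ (by omega) (by omega)).2
        (by unfold BranchEdge; omega)) {k - 1, n - 1} {j + 1, n} ?_ ?_ ?_ ?_ ?_
    · simp only [Finset.disjoint_left, Finset.mem_insert, Finset.mem_singleton]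
      omega
    · simp only [Finset.mem_insert, Finset.mem_singleton]
      omega
    · simp only [Finset.mem_insert, Finset.mem_singleton]
      omega
    · rw [Finset.sum_pair (by omega)]
      have h₁ := hA.one_le_bond hF' (i := k - 1) (j := k) (by omega) (by omega) (by omega)
        (by unfold BranchEdge; omega)
      have h₂ := hA.one_le_bond hF' (i := n - 1) (j := k) (by omega) (by omega) (by omega)
        (by unfold BranchEdge; omega)
      omega
    · rw [Finset.sum_pair (by omega)]
      have h₁ := hA.one_le_bond hF' (i := j + 1) (j := j) (by omega) (by omega) (by omega)
        (by unfold BranchEdge; omega)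
      have h₂ := hA.one_le_bond hF' (i := n) (j := j) (by omega) (by omega) (by omega)
        (by unfold BranchEdge; omega)
      omega

/-- A diagram of finite type does not contain a simply laced diagram, given by a list of vertices
and a list of edges, with a vector `c ≥ 0` such that twice the entry of `c` at a vertex is at most
the sum of the entries at its neighbours. -/
theorem false_of_edges {n : ℕ} {R : ℕ → ℕ → Prop} {f : ℕ → ι} (h : Realizes A n R f) {m : ℕ}
    (l c : List ℕ) (edges : List (ℕ × ℕ)) (hm : l.length = m) (hl : l.Nodup) (hln : ∀ i ∈ l, i < n)
    (hR : ∀ e ∈ edges, R (l.getD e.1 0) (l.getD e.2 0))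
    (hedges : ∀ e ∈ edges, e.1 < m ∧ e.2 < m ∧ e.1 ≠ e.2)
    (hc : 0 < m ∧ c.getD 0 0 ≠ 0)
    (hsum : ∀ b < m, ∑ a ∈ Finset.range m, (c.getD a 0 : ℤ) * (if a = b then 2 else
      if (a, b) ∈ edges ∨ (b, a) ∈ edges then -1 else 0) ≤ 0) : False := by
  subst hm
  have hget {i} (hi : i < l.length) : l.getD i 0 = l[i] := by simp [hi]
  have hlt {i} (hi : i < l.length) : l.getD i 0 < n := by
    rw [hget hi]
    exact hln _ (List.getElem_mem hi)
  have hne {i j} (hi : i < l.length) (hj : j < l.length) (h : l.getD i 0 = l.getD j 0) : i = j := by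
    rw [hget hi, hget hj] at h
    exact (hl.getElem_inj_iff).1 h
  refine hA.false_of_sum_le (n := l.length) (f := fun i ↦ f (l.getD i 0))
    (fun i hi j hj hij ↦ hne hi hj (h.injective _ (hlt hi) _ (hlt hj) hij))
    (fun a ↦ (c.getD a 0 : ℤ)) (fun i ↦ Int.natCast_nonneg _) hc.1 (by exact_mod_cast hc.2)
    fun b hb _ ↦ le_trans (Finset.sum_le_sum fun a ha ↦ ?_) (hsum b hb)
  rw [Finset.mem_range] at ha
  refine mul_le_mul_of_nonneg_left ?_ (Int.natCast_nonneg _)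
  have key {a b} (he : (a, b) ∈ edges) : l.getD a 0 ≠ l.getD b 0 := fun h ↦
    (hedges _ he).2.2 (hne (hedges _ he).1 (hedges _ he).2.1 h)
  split_ifs with hab he
  · rw [hab, hA.diag]
  · rcases he with he | he
    · exact hA.le_neg_one_of_edge h (hlt ha) (hlt hb) (key he) (hR _ he)
    · refine hA.le_neg_one (fun h' ↦ hab (hne ha hb (h.injective _ (hlt ha) _ (hlt hb) h')))
        (hA.ne_zero_symm ?_)
      exact (h.edge_iff _ (hlt hb) _ (hlt ha) (key he)).2 (hR _ he)
  · exact hA.nonpos _ _ fun h' ↦ hab (hne ha hb (h.injective _ (hlt ha) _ (hlt hb) h'))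

/-- Three arms of length two at a branch point are the affine diagram of type `E₆`. -/
theorem false_of_long_arms {n k j : ℕ} {F : ℕ → ι} (hk : 2 ≤ k) (hkn : k + 4 ≤ n) (hj : j + 1 = n)
    (h : Realizes A (n + 1) (fun a b ↦ (a < n ∧ b < n ∧ BranchEdge n k a b) ∨ (a = j ∧ b = n) ∨
      (a = n ∧ b = j)) F) : False := by
  refine hA.false_of_edges (m := 7) h [k - 2, k - 1, k, k + 1, k + 2, n - 1, n]
    [1, 2, 3, 2, 1, 2, 1]
    [(0, 1), (1, 2), (2, 3), (3, 4), (2, 5), (5, 6)] rfl ?_ ?_ ?_ (by decide) (by simp)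
    (by decide +kernel)
  · simp
    omega
  · simp
    omega
  · simp [BranchEdge]
    omega

set_option maxHeartbeats 2000000 in
/-- The diagram has a connected part of any given size which is a chain, or a chain with one more
vertex attached. Vertices are added one by one. -/
theorem exists_realizes {m : ℕ} (h₁ : 1 ≤ m) (hm : m ≤ Fintype.card ι) :
    ∃ f : ℕ → ι, IsTree A ((Finset.range m).image f) ∧ (Realizes A m ChainEdge f ∨
      ∃ k, 1 ≤ k ∧ k + 3 ≤ m ∧ Realizes A m (BranchEdge m k) f) := by
  induction m, h₁ using Nat.le_induction with
  | base =>
    obtain ⟨x⟩ := Fintype.card_pos_iff.1 hm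
    refine ⟨fun _ ↦ x, by simp [IsTree], .inl ⟨fun i hi j hj _ ↦ by omega, ?_⟩⟩
    intro i hi j hj hij
    omega
  | succ n hn ih =>
    obtain ⟨f, htree, hshape⟩ := ih (by omega)
    -- by connectedness there is a new vertex `w` joined to some `f j`
    obtain ⟨w, hw, j, hjn, hjw⟩ : ∃ w, (∀ i < n, f i ≠ w) ∧ ∃ j < n, A (f j) w ≠ 0 := by
      by_contra! hno
      have huniv := hA.connected ((Finset.range n).image f)
        ⟨f 0, Finset.mem_image_of_mem f (Finset.mem_range.2 hn)⟩ fun x hx y hxy ↦ ?_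
      · have := Finset.card_image_le (s := Finset.range n) (f := f)
        rw [huniv, Finset.card_range, Finset.card_univ] at this
        omega
      · obtain ⟨i, hi, rfl⟩ := Finset.mem_image.1 hx
        by_contra hy
        exact hxy (hno y (fun i hi h ↦ hy (Finset.mem_image.2 ⟨i, Finset.mem_range.2 hi, h⟩)) i
          (Finset.mem_range.1 hi))
    have hwK : w ∉ (Finset.range n).image f := by
      rw [Finset.mem_image]
      rintro ⟨i, hi, h⟩
      exact hw i (Finset.mem_range.1 hi) h
    have hfK {i} (hi : i < n) : f i ∈ (Finset.range n).image f :=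
      Finset.mem_image_of_mem f (Finset.mem_range.2 hi)
    have hinj : ∀ i < n, ∀ j < n, f i = f j → i = j := by
      rcases hshape with h | ⟨_, _, _, h⟩ <;> exact h.injective
    have hj : ∀ i < n, A (f i) w ≠ 0 ↔ i = j := fun i hi ↦
      ⟨fun h ↦ hinj i hi j hjn (hA.eq_of_isTree htree hwK (hfK hi) (hfK hjn) h hjw),
        fun h ↦ h ▸ hjw⟩
    have hj' : ∀ i < n, A w (f i) ≠ 0 ↔ i = j := fun i hi ↦
      Iff.trans ⟨hA.ne_zero_symm, hA.ne_zero_symm⟩ (hj i hi)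
    -- it remains to renumber the vertices
    set F : ℕ → ι := fun i ↦ if i < n then f i else w with hF
    have hFtree : IsTree A ((Finset.range (n + 1)).image F) := by
      have : (Finset.range (n + 1)).image F = insert w ((Finset.range n).image f) := by
        rw [Finset.range_add_one, Finset.image_insert, hF]
        simp only [lt_irrefl, if_false]
        congr 1
        refine Finset.image_congr fun i hi ↦ ?_
        simp only [Finset.coe_range, Set.mem_Iio] at hi
        simp only [hi, if_true]
      rw [this]
      exact hA.isTree_insert htree hwK (hfK hjn) hjw
    have finish {R R' : ℕ → ℕ → Prop} (h : Realizes A (n + 1) R F) (π : ℕ → ℕ)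
        (hπ : ∀ i < n + 1, π i < n + 1) (hπ' : ∀ i < n + 1, ∀ j < n + 1, π i = π j → i = j)
        (hR : ∀ i < n + 1, ∀ j < n + 1, i ≠ j → (R (π i) (π j) ↔ R' i j)) :
        IsTree A ((Finset.range (n + 1)).image (F ∘ π)) ∧ Realizes A (n + 1) R' (F ∘ π) :=
      ⟨by rwa [image_comp_range π hπ hπ'], h.relabel π hπ hπ' hR⟩
    have chain {R : ℕ → ℕ → Prop} (h : Realizes A (n + 1) R F) (π : ℕ → ℕ)
        (hπ : ∀ i < n + 1, π i < n + 1) (hπ' : ∀ i < n + 1, ∀ j < n + 1, π i = π j → i = j)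
        (hR : ∀ i < n + 1, ∀ j < n + 1, i ≠ j → (R (π i) (π j) ↔ ChainEdge i j)) :
        ∃ f : ℕ → ι, IsTree A ((Finset.range (n + 1)).image f) ∧
          (Realizes A (n + 1) ChainEdge f ∨
            ∃ k, 1 ≤ k ∧ k + 3 ≤ n + 1 ∧ Realizes A (n + 1) (BranchEdge (n + 1) k) f) :=
      have := finish h π hπ hπ' hR
      ⟨_, this.1, .inl this.2⟩
    have branch (k : ℕ) (hk : 1 ≤ k) (hkn : k + 3 ≤ n + 1) {R : ℕ → ℕ → Prop}
        (h : Realizes A (n + 1) R F) (π : ℕ → ℕ)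
        (hπ : ∀ i < n + 1, π i < n + 1) (hπ' : ∀ i < n + 1, ∀ j < n + 1, π i = π j → i = j)
        (hR : ∀ i < n + 1, ∀ j < n + 1, i ≠ j → (R (π i) (π j) ↔ BranchEdge (n + 1) k i j)) :
        ∃ f : ℕ → ι, IsTree A ((Finset.range (n + 1)).image f) ∧
          (Realizes A (n + 1) ChainEdge f ∨
            ∃ k, 1 ≤ k ∧ k + 3 ≤ n + 1 ∧ Realizes A (n + 1) (BranchEdge (n + 1) k) f) :=
      have := finish h π hπ hπ' hR
      ⟨_, this.1, .inr ⟨k, hk, hkn, this.2⟩⟩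
    rcases hshape with h | ⟨k, hk, hkn, h⟩
    -- a vertex added to a chain: at its end, at its beginning, or in between
    · have hF' := h.extend hw hj hj'
      rcases (by omega : j + 1 = n ∨ j = 0 ∨ (1 ≤ j ∧ j + 2 ≤ n)) with hj0 | hj0 | hj0
      · exact chain hF' id (fun _ h ↦ h) (fun _ _ _ _ h ↦ h) fun a ha b hb hab ↦ by
          simp only [ChainEdge, id]
          omega
      · refine chain hF' (fun i ↦ if i = 0 then n else i - 1) (by grind) (by grind)
          fun a ha b hb hab ↦ ?_
        simp only [ChainEdge]
        split_ifs <;> omega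
      · refine branch j (by omega) (by omega) hF' id (fun _ h ↦ h) (fun _ _ _ _ h ↦ h)
          fun a ha b hb hab ↦ ?_
        simp only [ChainEdge, BranchEdge, id]
        omega
    -- a vertex added to a branched diagram: at one of the ends of the chain, at the extra vertex,
    -- or in between
    · have hF' := h.extend hw hj hj'
      rcases (by omega : j + 2 = n ∨ j = 0 ∨ j + 1 = n ∨ (1 ≤ j ∧ j + 3 ≤ n)) with
        hj0 | hj0 | hj0 | hj0
      · refine branch k hk (by omega) hF' (fun i ↦ if i + 1 < n then i else if i + 1 = n then n
          else n - 1) (by grind) (by grind) fun a ha b hb hab ↦ ?_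
        unfold BranchEdge
        split_ifs <;> omega
      · refine branch (k + 1) (by omega) (by omega) hF' (fun i ↦ if i = 0 then n else i - 1)
          (by grind) (by grind) fun a ha b hb hab ↦ ?_
        unfold BranchEdge
        split_ifs <;> omega
      -- the third arm can grow only if one of the two others has length one
      · rcases (by omega : k + 3 = n ∨ k = 1 ∨ (2 ≤ k ∧ k + 4 ≤ n)) with hk0 | hk0 | hk0
        · refine branch k hk (by omega) hF' (fun i ↦ if i ≤ k then i else if i = n then n - 2 else
            i + 1) (by grind) (by grind) fun a ha b hb hab ↦ ?_
          unfold BranchEdge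
          split_ifs <;> omega
        · refine branch (n - 3) (by omega) (by omega) hF' (fun i ↦ if i + 3 ≤ n then n - 2 - i else
            if i = n then 0 else i + 1) (by grind) (by grind) fun a ha b hb hab ↦ ?_
          unfold BranchEdge
          split_ifs <;> (try simp only [false_and, false_or]) <;> omega
        · exact (hA.false_of_long_arms hk0.1 hk0.2 hj0 hF').elim
      · exact (hA.false_of_second_branch hk hkn hj0 hF').elim

end IsFiniteType

end Shape

/-! ### The types of the diagrams of finite type -/

section Types

variable {ι : Type*} [Fintype ι] [DecidableEq ι] {A : Matrix ι ι ℤ}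

/-- The table is complete for the Cartan matrix `B`. The type of a diagram is used only through
this property, so that no list of types is needed. -/
def TableComplete {n : ℕ} (B : Matrix (Fin n) (Fin n) ℤ) : Prop :=
  ∀ S σ, Good B S σ → Listed B S {σ}

instance (n k i j : ℕ) : Decidable (BranchEdge n k i j) := by
  unfold BranchEdge
  infer_instance

theorem eq_of_mul_eq_one {x y : ℤ} (hx : x ≤ -1) (hy : y ≤ -1) (h : x * y = 1) :
    x = -1 ∧ y = -1 := by
  constructor <;> nlinarith

theorem eq_of_mul_eq_two {x y : ℤ} (hx : x ≤ -1) (hy : y ≤ -1) (h : x * y = 2) :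
    (x = -1 ∧ y = -2) ∨ (x = -2 ∧ y = -1) := by
  have : -2 ≤ x := by nlinarith
  interval_cases x <;> omega

theorem eq_of_mul_eq_three {x y : ℤ} (hx : x ≤ -1) (hy : y ≤ -1) (h : x * y = 3) :
    (x = -1 ∧ y = -3) ∨ (x = -3 ∧ y = -1) := by
  have : -3 ≤ x := by nlinarith
  interval_cases x <;> omega

theorem cartanMatrix_D_eq {n : ℕ} (hn : 4 ≤ n) (i j : Fin n) : CartanMatrix.D n i j =
    if (i : ℕ) = j then 2 else if BranchEdge n (n - 3) i j then -1 else 0 := by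
  rw [cartanMatrix_D_apply hn]
  refine if_congr Iff.rfl rfl (if_congr ?_ rfl rfl)
  unfold BranchEdge
  omega

namespace IsFiniteType

variable (hA : IsFiniteType A)

omit [Fintype ι] [DecidableEq ι] in
theorem _root_.CRBigrading.Realizes.reverse_chain {n : ℕ} {f : ℕ → ι}
    (h : Realizes A n ChainEdge f) : Realizes A n ChainEdge (f ∘ fun i ↦ n - 1 - i) :=
  h.relabel _ (by intros; omega) (by intros; omega) fun i hi j hj hij ↦ by
    simp only [ChainEdge]
    omega

omit [Fintype ι] [DecidableEq ι] in
theorem _root_.CRBigrading.Realizes.reverse_branch {n k : ℕ} {f : ℕ → ι} (hk : k + 3 ≤ n)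
    (h : Realizes A n (BranchEdge n k) f) : Realizes A n (BranchEdge n (n - 2 - k))
      (f ∘ fun i ↦ if i + 1 < n then n - 2 - i else i) :=
  h.relabel _ (by grind) (by grind) fun i hi j hj hij ↦ by
    unfold BranchEdge
    split_ifs <;> omega

include hA

omit hA [DecidableEq ι] in
theorem exists_equiv_of_eq {n : ℕ} {f : ℕ → ι} (hf : ∀ i < n, ∀ j < n, f i = f j → i = j)
    (hn : n = Fintype.card ι) {B : Matrix (Fin n) (Fin n) ℤ} (hB : TableComplete B)
    (h : ∀ i j : Fin n, A (f i) (f j) = B i j) :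
    ∃ (n : ℕ) (B : Matrix (Fin n) (Fin n) ℤ) (e : Fin n ≃ ι),
      (∀ i j, A (e i) (e j) = B i j) ∧ TableComplete B :=
  ⟨n, B, Equiv.ofBijective (fun i : Fin n ↦ f i) ((Fintype.bijective_iff_injective_and_card _).2
    ⟨fun i j hij ↦ Fin.ext (hf i i.2 j j.2 hij), by simpa using hn⟩), h, hB⟩

theorem bond_le_three {n : ℕ} {f : ℕ → ι} (hf : ∀ i < n, ∀ j < n, f i = f j → i = j) {i j : ℕ}
    (hi : i < n) (hj : j < n) (hij : i ≠ j) : A (f i) (f j) * A (f j) (f i) ≤ 3 := by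
  by_contra! h
  exact hA.false_of_vertex hf hj (P := {i}) (by simpa using ⟨hi, hij⟩) (by
    rw [Finset.sum_singleton]
    exact h)

/-- The affine diagrams of a chain of five vertices with a double bond in the third place. -/
theorem false_of_double {f : ℕ → ι} (h : Realizes A 5 ChainEdge f)
    (h2 : A (f 2) (f 3) * A (f 3) (f 2) = 2) : False := by
  have hle {i j : ℕ} (hi : i < 5) (hj : j < 5) (hij : i + 1 = j) :
      A (f i) (f j) ≤ -1 ∧ A (f j) (f i) ≤ -1 :=
    ⟨hA.le_neg_one_of_edge h hi hj (by omega) (by unfold ChainEdge; omega),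
      hA.le_neg_one_of_edge h hj hi (by omega) (by unfold ChainEdge; omega)⟩
  have h0 {i j : ℕ} (hi : i < 5) (hj : j < 5) (hij : i + 1 < j) :
      A (f i) (f j) = 0 ∧ A (f j) (f i) = 0 :=
    ⟨h.eq_zero hi hj (by omega) (by unfold ChainEdge; omega),
      h.eq_zero hj hi (by omega) (by unfold ChainEdge; omega)⟩
  have h01 := hle (i := 0) (j := 1) (by omega) (by omega) rfl
  have h12 := hle (i := 1) (j := 2) (by omega) (by omega) rfl
  have h23 := hle (i := 2) (j := 3) (by omega) (by omega) rfl
  have h34 := hle (i := 3) (j := 4) (by omega) (by omega) rfl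
  have h02 := h0 (i := 0) (j := 2) (by omega) (by omega) (by omega)
  have h03 := h0 (i := 0) (j := 3) (by omega) (by omega) (by omega)
  have h04 := h0 (i := 0) (j := 4) (by omega) (by omega) (by omega)
  have h13 := h0 (i := 1) (j := 3) (by omega) (by omega) (by omega)
  have h14 := h0 (i := 1) (j := 4) (by omega) (by omega) (by omega)
  have h24 := h0 (i := 2) (j := 4) (by omega) (by omega) (by omega)
  have hd (i : ℕ) := hA.diag (f i)
  rcases eq_of_mul_eq_two h23.1 h23.2 h2 with hx | hx
  · refine hA.false_of_sum_le h.injective (fun i ↦ ([1, 2, 3, 2, 1].getD i 0 : ℕ))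
      (fun i ↦ Int.natCast_nonneg _) (k := 0) (by omega) (by simp) fun b hb _ ↦ ?_
    interval_cases b <;> simp [Finset.sum_range_succ, hd, h02, h03, h04, h13, h14, h24] <;> omega
  · refine hA.false_of_sum_le h.injective (fun i ↦ ([1, 2, 3, 4, 2].getD i 0 : ℕ))
      (fun i ↦ Int.natCast_nonneg _) (k := 0) (by omega) (by simp) fun b hb _ ↦ ?_
    interval_cases b <;> simp [Finset.sum_range_succ, hd, h02, h03, h04, h13, h14, h24] <;> omega

/-- A chain has at most one multiple bond. -/
theorem bond_eq_one_of_ne {n : ℕ} {f : ℕ → ι} (h : Realizes A n ChainEdge f) {i j : ℕ}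
    (hi : i + 1 < n) (hj : j + 1 < n) (hij : i ≠ j)
    (h2 : 2 ≤ A (f i) (f (i + 1)) * A (f (i + 1)) (f i)) :
    A (f j) (f (j + 1)) * A (f (j + 1)) (f j) = 1 := by
  have key {i j : ℕ} (hij : i < j) (hj : j + 1 < n)
      (h₁ : 2 ≤ A (f i) (f (i + 1)) * A (f (i + 1)) (f i))
      (h₂ : 2 ≤ A (f j) (f (j + 1)) * A (f (j + 1)) (f j)) : False := by
    refine hA.false_of_path h.injective (a := i + 1) (b := j) (by omega) (by omega)
      (fun m hm hm' ↦ (h.edge_iff m (by omega) _ (by omega) (by omega)).2 (.inl rfl)) {i} {j + 1}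
      (by simp; omega) (by simp; omega) (by simp; omega) (by simpa using h₁) ?_
    rw [Finset.sum_singleton, mul_comm]
    exact h₂
  have h1 := hA.one_le_bond h (i := j) (j := j + 1) (by omega) hj (by omega) (.inl rfl)
  by_contra hne
  rcases lt_or_gt_of_ne hij with hlt | hlt
  · exact key hlt hj h2 (by omega)
  · exact key hlt hi (by omega) h2

omit [DecidableEq ι] in
/-- The entries of the Cartan matrix away from the multiple bond of a chain. -/
theorem entry_of_chain {n : ℕ} {f : ℕ → ι} (h : Realizes A n ChainEdge f) {i : ℕ}
    (h1 : ∀ j, j + 1 < n → j ≠ i → A (f j) (f (j + 1)) * A (f (j + 1)) (f j) = 1) (a b : Fin n)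
    (ha : ¬((a : ℕ) = i ∧ (b : ℕ) = i + 1)) (hb : ¬((b : ℕ) = i ∧ (a : ℕ) = i + 1)) :
    A (f a) (f b) = CartanMatrix.A n a b := by
  have key {j : ℕ} (hj : j + 1 < n) (hji : j ≠ i) := eq_of_mul_eq_one
    (hA.le_neg_one_of_edge h (i := j) (j := j + 1) (by omega) hj (by omega) (.inl rfl))
    (hA.le_neg_one_of_edge h (i := j + 1) (j := j) hj (by omega) (by omega) (.inr rfl))
    (h1 j hj hji)
  obtain ⟨a, ha'⟩ := a
  obtain ⟨b, hb'⟩ := b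
  simp only at ha hb
  simp only [CartanMatrix.A, Matrix.of_apply, Fin.mk.injEq]
  split_ifs with hab hab'
  · rw [hab, hA.diag]
  · rcases hab' with rfl | rfl
    · exact (key hb' (by omega)).1
    · exact (key ha' (by omega)).2
  · exact h.eq_zero ha' hb' hab hab'

/-- A chain with a double bond in its second half has type `B`, `C` or `F₄`. -/
theorem exists_equiv_of_double {n : ℕ} {f : ℕ → ι} (h : Realizes A n ChainEdge f)
    (hn : n = Fintype.card ι) {i : ℕ} (hi : i + 1 < n) (hin : n ≤ 2 * i + 2)
    (h2 : A (f i) (f (i + 1)) * A (f (i + 1)) (f i) = 2) :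
    ∃ (n : ℕ) (B : Matrix (Fin n) (Fin n) ℤ) (e : Fin n ≃ ι),
      (∀ i j, A (e i) (e j) = B i j) ∧ TableComplete B := by
  have h1 : ∀ j, j + 1 < n → j ≠ i → A (f j) (f (j + 1)) * A (f (j + 1)) (f j) = 1 :=
    fun j hj hji ↦ hA.bond_eq_one_of_ne h hi hj hji.symm (by omega)
  have hentry := hA.entry_of_chain h h1
  have hcases := eq_of_mul_eq_two
    (hA.le_neg_one_of_edge h (i := i) (j := i + 1) (by omega) hi (by omega) (.inl rfl))
    (hA.le_neg_one_of_edge h (i := i + 1) (j := i) hi (by omega) (by omega) (.inr rfl)) h2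
  -- the double bond is at the end for types `B` and `C`, and in the middle for type `F₄`
  by_cases hend : i + 2 = n
  · rcases hcases with ⟨hx, hy⟩ | ⟨hx, hy⟩
    · refine exists_equiv_of_eq h.injective hn (B := CartanMatrix.C n) (fun S σ ↦ Good.listedC)
        fun a b ↦ ?_
      by_cases hab : (a : ℕ) = i ∧ (b : ℕ) = i + 1
      · rw [hab.1, hab.2, hx]
        simp only [CartanMatrix.C, Matrix.of_apply, Fin.ext_iff]
        omega
      by_cases hba : (b : ℕ) = i ∧ (a : ℕ) = i + 1
      · rw [hba.1, hba.2, hy]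
        simp only [CartanMatrix.C, Matrix.of_apply, Fin.ext_iff]
        omega
      rw [hentry a b hab hba]
      simp only [CartanMatrix.A, CartanMatrix.C, Matrix.of_apply, Fin.ext_iff]
      omega
    · refine exists_equiv_of_eq h.injective hn (B := CartanMatrix.B n) (fun S σ ↦ Good.listedB)
        fun a b ↦ ?_
      by_cases hab : (a : ℕ) = i ∧ (b : ℕ) = i + 1
      · rw [hab.1, hab.2, hx]
        simp only [CartanMatrix.B, Matrix.of_apply, Fin.ext_iff]
        omega
      by_cases hba : (b : ℕ) = i ∧ (a : ℕ) = i + 1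
      · rw [hba.1, hba.2, hy]
        simp only [CartanMatrix.B, Matrix.of_apply, Fin.ext_iff]
        omega
      rw [hentry a b hab hba]
      simp only [CartanMatrix.A, CartanMatrix.B, Matrix.of_apply, Fin.ext_iff]
      omega
  by_cases hn4 : n = 4
  · subst hn4
    obtain rfl : i = 1 := by omega
    have hF₄ : ∀ a b : Fin 4, ¬((a : ℕ) = 1 ∧ (b : ℕ) = 1 + 1) → ¬((b : ℕ) = 1 ∧ (a : ℕ) = 1 + 1) →
      CartanMatrix.A 4 a b - cartanF₄ a b = 0 := by decide
    have hF₄' : ∀ a b : Fin 4, ¬((a : ℕ) = 1 ∧ (b : ℕ) = 1 + 1) →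
      ¬((b : ℕ) = 1 ∧ (a : ℕ) = 1 + 1) → CartanMatrix.A 4 a b - cartanF₄ a.rev b.rev = 0 := by
        decide
    rcases hcases with ⟨hx, hy⟩ | ⟨hx, hy⟩
    · refine exists_equiv_of_eq h.reverse_chain.injective hn (fun S σ ↦ Good.listedF₄) fun a b ↦ ?_
      have hrev (a : Fin 4) : (f ∘ fun i ↦ 4 - 1 - i) a = f (a.rev : Fin 4) := by
        rw [Fin.val_rev, Function.comp_apply]
        congr 1
        omega
      rw [hrev, hrev]
      by_cases hab : (a.rev : ℕ) = 1 ∧ (b.rev : ℕ) = 1 + 1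
      · rw [hab.1, hab.2, hx]
        obtain rfl : a = 2 := Fin.ext (by simp only [Fin.val_rev] at *; omega)
        obtain rfl : b = 1 := Fin.ext (by simp only [Fin.val_rev] at *; omega)
        rfl
      by_cases hba : (b.rev : ℕ) = 1 ∧ (a.rev : ℕ) = 1 + 1
      · rw [hba.1, hba.2, hy]
        obtain rfl : a = 1 := Fin.ext (by simp only [Fin.val_rev] at *; omega)
        obtain rfl : b = 2 := Fin.ext (by simp only [Fin.val_rev] at *; omega)
        rfl
      rw [hentry _ _ hab hba, sub_eq_zero.1 (hF₄' _ _ hab hba), Fin.rev_rev, Fin.rev_rev]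
    · refine exists_equiv_of_eq h.injective hn (fun S σ ↦ Good.listedF₄) fun a b ↦ ?_
      by_cases hab : (a : ℕ) = 1 ∧ (b : ℕ) = 1 + 1
      · rw [hab.1, hab.2, hx]
        obtain rfl : a = 1 := by omega
        obtain rfl : b = 2 := by omega
        rfl
      by_cases hba : (b : ℕ) = 1 ∧ (a : ℕ) = 1 + 1
      · rw [hba.1, hba.2, hy]
        obtain rfl : a = 2 := by omega
        obtain rfl : b = 1 := by omega
        rfl
      rw [hentry a b hab hba, sub_eq_zero.1 (hF₄ a b hab hba)]
  · refine (hA.false_of_double (f := fun m ↦ f (m + (i - 2))) ⟨fun a ha b hb hab ↦ ?_,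
      fun a ha b hb hab ↦ ?_⟩ ?_).elim
    · have := h.injective _ (by omega) _ (by omega) hab
      omega
    · rw [h.edge_iff _ (by omega) _ (by omega) (by omega)]
      unfold ChainEdge
      omega
    · rwa [show 2 + (i - 2) = i by omega, show 3 + (i - 2) = i + 1 by omega]

/-- A chain has type `A`, `B`, `C`, `F₄` or `G₂`. -/
theorem exists_equiv_of_chain {n : ℕ} {f : ℕ → ι} (h : Realizes A n ChainEdge f)
    (hn : n = Fintype.card ι) : ∃ (n : ℕ) (B : Matrix (Fin n) (Fin n) ℤ) (e : Fin n ≃ ι),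
      (∀ i j, A (e i) (e j) = B i j) ∧ TableComplete B := by
  by_cases hmult : ∃ i, i + 1 < n ∧ A (f i) (f (i + 1)) * A (f (i + 1)) (f i) ≠ 1
  · obtain ⟨i, hi, hne⟩ := hmult
    have h1 := hA.one_le_bond h (i := i) (j := i + 1) (by omega) hi (by omega) (.inl rfl)
    have h3 := hA.bond_le_three h.injective (i := i) (j := i + 1) (by omega) hi (by omega)
    rcases (by omega : A (f i) (f (i + 1)) * A (f (i + 1)) (f i) = 2 ∨
      A (f i) (f (i + 1)) * A (f (i + 1)) (f i) = 3) with h2 | h3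
    · by_cases hin : n ≤ 2 * i + 2
      · exact hA.exists_equiv_of_double h hn hi hin h2
      · refine hA.exists_equiv_of_double h.reverse_chain hn (i := n - 2 - i) (by omega)
          (by omega) ?_
        simp only [Function.comp_apply]
        rwa [show n - 1 - (n - 2 - i) = i + 1 by omega, show n - 1 - (n - 2 - i + 1) = i by omega,
          mul_comm]
    · -- a triple bond leaves no room for another vertex
      obtain rfl : i = 0 := by
        by_contra h0
        refine hA.false_of_vertex h.injective (y := i) (by omega) (P := {i - 1, i + 1}) ?_ ?_
        · simp
          omega
        · have := hA.one_le_bond h (i := i - 1) (j := i) (by omega) (by omega) (by omega)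
            (.inl (by omega))
          rw [Finset.sum_pair (by omega), mul_comm (A (f (i + 1)) _)]
          omega
      obtain rfl : n = 2 := by
        by_contra h0
        refine hA.false_of_vertex h.injective (y := 1) (by omega) (P := {0, 2}) ?_ ?_
        · simp
          omega
        · have := hA.one_le_bond h (i := 2) (j := 1) (by omega) (by omega) (by omega)
            (.inr (by omega))
          rw [zero_add] at h3
          rw [Finset.sum_pair (by omega)]
          omega
      rcases eq_of_mul_eq_three
        (hA.le_neg_one_of_edge h (i := 0) (j := 0 + 1) (by omega) hi (by omega) (.inl rfl))
        (hA.le_neg_one_of_edge h (i := 0 + 1) (j := 0) hi (by omega) (by omega) (.inr rfl)) h3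
        with hxy | hxy
      · refine exists_equiv_of_eq h.injective hn (fun S σ ↦ Good.listedG₂) fun a b ↦ ?_
        fin_cases a <;> fin_cases b
        exacts [hA.diag _, hxy.1, hxy.2, hA.diag _]
      · refine exists_equiv_of_eq h.reverse_chain.injective hn (fun S σ ↦ Good.listedG₂)
          fun a b ↦ ?_
        fin_cases a <;> fin_cases b
        exacts [hA.diag _, hxy.2, hxy.1, hA.diag _]
  · push Not at hmult
    exact exists_equiv_of_eq h.injective hn (fun S σ ↦ Good.listedA) fun a b ↦
      hA.entry_of_chain h (i := n) (fun j hj _ ↦ hmult j hj) a b (by omega) (by omega)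

/-- A branched diagram has no multiple bonds. -/
theorem entry_of_branch {n k : ℕ} {f : ℕ → ι} (hk : 1 ≤ k) (hkn : k + 3 ≤ n)
    (h : Realizes A n (BranchEdge n k) f) {a b : ℕ} (ha : a < n) (hb : b < n) :
    A (f a) (f b) = if a = b then 2 else if BranchEdge n k a b then -1 else 0 := by
  have hedge {a b : ℕ} (ha : a < n) (hb : b < n) (hab : a ≠ b) (he : BranchEdge n k a b) :
      1 ≤ A (f a) (f b) * A (f b) (f a) := hA.one_le_bond h ha hb hab he
  have hpath {a b : ℕ} (hb : b + 1 < n) (i : ℕ) (_ : a ≤ i) (_ : i < b) :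
      A (f i) (f (i + 1)) ≠ 0 :=
    (h.edge_iff i (by omega) _ (by omega) (by omega)).2 (by unfold BranchEdge; omega)
  have hleg := hedge (a := n - 1) (b := k) (by omega) (by omega) (by omega)
    (by unfold BranchEdge; omega)
  have hlow := hedge (a := k - 1) (b := k) (by omega) (by omega) (by omega)
    (by unfold BranchEdge; omega)
  have hhigh := hedge (a := k + 1) (b := k) (by omega) (by omega) (by omega)
    (by unfold BranchEdge; omega)
  have key {i : ℕ} (hi : i + 2 < n) : A (f i) (f (i + 1)) * A (f (i + 1)) (f i) ≤ 1 := by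
    by_contra! h2
    by_cases hik : k ≤ i
    · refine hA.false_of_path h.injective hik (by omega) (hpath (by omega)) {k - 1, n - 1} {i + 1}
        (by simp; omega) (by simp; omega) (by simp; omega) ?_ ?_
      · rw [Finset.sum_pair (by omega)]
        omega
      · rw [Finset.sum_singleton, mul_comm]
        exact h2
    · refine hA.false_of_path h.injective (a := i + 1) (b := k) (by omega) (by omega)
        (hpath (by omega)) {i} {k + 1, n - 1} (by simp; omega) (by simp; omega)
        (by simp; omega) ?_ ?_
      · rw [Finset.sum_singleton]
        exact h2
      · rw [Finset.sum_pair (by omega)]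
        omega
  have key' : A (f k) (f (n - 1)) * A (f (n - 1)) (f k) ≤ 1 := by
    by_contra! h2
    refine hA.false_of_vertex h.injective (y := k) (by omega) (P := {k - 1, k + 1, n - 1})
      (by simp; omega) ?_
    rw [Finset.sum_insert (by simp; omega), Finset.sum_pair (by omega), mul_comm (A (f (n - 1)) _)]
    omega
  have hone {a b : ℕ} (ha : a < n) (hb : b < n) (hab : a ≠ b) (he : BranchEdge n k a b)
      (he' : BranchEdge n k b a) (hle : A (f a) (f b) * A (f b) (f a) ≤ 1) : A (f a) (f b) = -1 :=
    (eq_of_mul_eq_one (hA.le_neg_one_of_edge h ha hb hab he)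
      (hA.le_neg_one_of_edge h hb ha hab.symm he') (le_antisymm hle (hedge ha hb hab he))).1
  split_ifs with hab he
  · rw [hab, hA.diag]
  · have he' : BranchEdge n k b a := by
      unfold BranchEdge at he ⊢
      omega
    refine hone ha hb hab he he' ?_
    rcases he with h | h | h | h
    · obtain rfl := h.1
      exact key (by omega)
    · obtain rfl := h.1
      rw [mul_comm]
      exact key (by omega)
    · obtain rfl : b = n - 1 := by omega
      rw [h.1]
      exact key'
    · obtain rfl : a = n - 1 := by omega
      rw [h.1, mul_comm]
      exact key'
  · exact h.eq_zero ha hb hab he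

/-- A branched diagram whose first arm is at least as long as its second one has type `D`, `E₆`,
`E₇` or `E₈`. -/
theorem exists_equiv_of_long_branch {n k : ℕ} {f : ℕ → ι} (hk : 1 ≤ k) (hkn : k + 3 ≤ n)
    (hn : n = Fintype.card ι) (h : Realizes A n (BranchEdge n k) f) (hle : n ≤ 2 * k + 2) :
    ∃ (n : ℕ) (B : Matrix (Fin n) (Fin n) ℤ) (e : Fin n ≃ ι),
      (∀ i j, A (e i) (e j) = B i j) ∧ TableComplete B := by
  have hentry (a b : Fin n) := hA.entry_of_branch hk hkn h a.2 b.2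
  rcases (by omega : k + 3 = n ∨ (k = 2 ∧ n = 6) ∨ (k = 3 ∧ n = 7) ∨ (k = 4 ∧ n = 8) ∨
    (5 ≤ k ∧ k + 4 = n) ∨ k + 5 ≤ n) with hn' | ⟨rfl, rfl⟩ | ⟨rfl, rfl⟩ | ⟨rfl, rfl⟩ | hn' | hn'
  · obtain rfl : k = n - 3 := by omega
    exact exists_equiv_of_eq h.injective hn (fun S σ ↦ Good.listedD (by omega)) fun a b ↦ by
      rw [hentry, cartanMatrix_D_eq (by omega)]
  · exact exists_equiv_of_eq h.injective hn (fun S σ ↦ Good.listedE₆) fun a b ↦ by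
      rw [hentry, ← sub_eq_zero]
      revert a b
      decide
  · exact exists_equiv_of_eq h.injective hn (fun S σ ↦ Good.listedE₇) fun a b ↦ by
      rw [hentry, ← sub_eq_zero]
      revert a b
      decide
  · exact exists_equiv_of_eq h.injective hn (fun S σ ↦ Good.listedE₈) fun a b ↦ by
      rw [hentry, ← sub_eq_zero]
      revert a b
      decide
  · -- the affine diagram of type `E₈`
    refine (hA.false_of_edges (m := 9) h
      [k - 5, k - 4, k - 3, k - 2, k - 1, k, k + 1, k + 2, n - 1] [1, 2, 3, 4, 5, 6, 4, 2, 3]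
      [(0, 1), (1, 2), (2, 3), (3, 4), (4, 5), (5, 6), (6, 7), (5, 8)] rfl ?_ ?_ ?_ (by decide)
      (by simp) (by decide +kernel)).elim
    · simp
      omega
    · simp
      omega
    · simp [BranchEdge]
      omega
  · -- the affine diagram of type `E₇`
    refine (hA.false_of_edges (m := 8) h [k - 3, k - 2, k - 1, k, k + 1, k + 2, k + 3, n - 1]
      [1, 2, 3, 4, 3, 2, 1, 2] [(0, 1), (1, 2), (2, 3), (3, 4), (4, 5), (5, 6), (3, 7)] rfl ?_ ?_ ?_
      (by decide) (by simp) (by decide +kernel)).elim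
    · simp
      omega
    · simp
      omega
    · simp [BranchEdge]
      omega

/-- The table is complete for every diagram of finite type, up to the numbering of its vertices. -/
theorem exists_equiv [Nonempty ι] : ∃ (n : ℕ) (B : Matrix (Fin n) (Fin n) ℤ) (e : Fin n ≃ ι),
    (∀ i j, A (e i) (e j) = B i j) ∧ TableComplete B := by
  obtain ⟨f, -, h | ⟨k, hk, hkn, h⟩⟩ := hA.exists_realizes Fintype.card_pos le_rfl
  · exact hA.exists_equiv_of_chain h rfl
  · by_cases hle : Fintype.card ι ≤ 2 * k + 2
    · exact hA.exists_equiv_of_long_branch hk hkn rfl h hle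
    · exact hA.exists_equiv_of_long_branch (by omega) (by omega) rfl (h.reverse_branch hkn)
        (by omega)

/-- The table contains all pairs that satisfy the combinatorial form of admissibility. -/
theorem listed_of_good {S : Finset ι} {σ : ι} (h : Good A S σ) : Listed A S {σ} := by
  have : Nonempty ι := ⟨σ⟩
  obtain ⟨n, B, e, he, hB⟩ := hA.exists_equiv
  refine Listed.of_equiv e he ?_
  rw [Finset.map_singleton]
  exact hB _ _ (h.comp_equiv e he)

end IsFiniteType

/-- The pairs in the table satisfy the combinatorial form of admissibility. -/
theorem Listed.exists_good {S₁ S₂ : Finset ι} (h : Listed A S₁ S₂) :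
    ∃ σ, S₂ = {σ} ∧ Good A S₁ σ := by
  obtain ⟨n, B, T₁, T₂, e, hT, hB, h₁, h₂⟩ := h
  obtain ⟨σ, rfl, hσ⟩ := hT.good
  refine ⟨e σ, ?_, ?_⟩
  · ext x
    obtain ⟨i, rfl⟩ := e.surjective x
    rw [h₂, Finset.mem_singleton, Finset.mem_singleton, e.injective.eq_iff, Fin.ext_iff]
    omega
  · have := hσ.comp_equiv e.symm (B := A) fun i j ↦ by simp [← hB]
    rw [Equiv.symm_symm] at this
    convert this using 1
    ext x
    obtain ⟨i, rfl⟩ := e.surjective x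
    simp [h₁, labelled]

end Types

/-! ### The combinatorial form of admissibility -/

section Combinatorics

variable {ι : Type*} [Fintype ι] [DecidableEq ι]

/-- The properties of the roots of a simple Lie algebra with Cartan matrix `A`, in coordinates with
respect to the simple roots, on which the classification depends. The field `jacobi` is what the
Jacobi identity says about nonzero brackets of root vectors: if `[[x, y], z]` is not zero, then
`[x, z]` or `[y, z]` is not zero. -/
structure IsRootDatum (A : Matrix ι ι ℤ) : Prop extends IsFiniteType A where
  ne_zero : ∀ v, IsRootVec A v → v ≠ 0
  nonneg_or_nonpos : ∀ v, IsRootVec A v → 0 ≤ v ∨ v ≤ 0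
  add_single : ∀ v j, IsRootVec A v → ∑ i, v i * A i j < 0 → v ≠ -Pi.single j 1 →
    IsRootVec A (v + Pi.single j 1)
  jacobi : ∀ u v w, IsRootVec A u → IsRootVec A v → IsRootVec A w → IsRootVec A (u + v) →
    IsRootVec A (u + v + w) → u + w ≠ 0 → v + w ≠ 0 → IsRootVec A (u + w) ∨ IsRootVec A (v + w)

/-- Admissibility of the bigrading determined by `S₁` and `S₂`, in terms of the coordinate vectors
of the roots. -/
structure IsCombAdmissible (A : Matrix ι ι ℤ) (S₁ S₂ : Finset ι) : Prop where
  zero : ∀ v, IsRootVec A v → ∑ i ∈ S₁, v i = 0 → ∑ i ∈ S₂, v i ≤ 1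
  one : ∀ v, IsRootVec A v → ∑ i ∈ S₁, v i = 1 → ∑ i ∈ S₂, v i = 0 ∨ ∑ i ∈ S₂, v i = 1
  two : ∀ v, IsRootVec A v → ∑ i ∈ S₁, v i = 2 → ∑ i ∈ S₂, v i = 1
  nondegenerate : ∀ v, IsRootVec A v → ∑ i ∈ S₁, v i = 1 →
    ∃ w, IsRootVec A w ∧ ∑ i ∈ S₁, w i = 1 ∧ IsRootVec A (v + w)
  exists_root : ∃ v, IsRootVec A v ∧ ∑ i ∈ S₁, v i = 0 ∧ ∑ i ∈ S₂, v i = 1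
  injective : ∀ v, IsRootVec A v → ∑ i ∈ S₁, v i = 0 → ∑ i ∈ S₂, v i = 1 ∨ ∑ i ∈ S₂, v i = -1 →
    ∃ w, IsRootVec A w ∧ ∑ i ∈ S₁, w i = -1 ∧ IsRootVec A (v + w)

/-- The sum of the simple roots in a list. -/
def listVec (l : List ι) : ι → ℤ := (l.map fun i ↦ Pi.single i 1).sum

omit [Fintype ι] in
theorem listVec_cons (x : ι) (l : List ι) : listVec (x :: l) = Pi.single x 1 + listVec l := by
  simp [listVec]

omit [Fintype ι] in
theorem listVec_append_singleton (l : List ι) (x : ι) :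
    listVec (l ++ [x]) = listVec l + Pi.single x 1 := by
  simp [listVec]

omit [Fintype ι] in
theorem listVec_nonneg (l : List ι) : 0 ≤ listVec l := by
  induction l with
  | nil => simp [listVec]
  | cons x l ih =>
    rw [listVec_cons]
    exact add_nonneg (Pi.single_nonneg.2 zero_le_one) ih

omit [Fintype ι] in
theorem sum_single_eq (S : Finset ι) (j : ι) :
    ∑ i ∈ S, (Pi.single j 1 : ι → ℤ) i = if j ∈ S then 1 else 0 := by
  simp [Pi.single_apply]

omit [Fintype ι] [DecidableEq ι] in
theorem sum_add_eq (S : Finset ι) (v w : ι → ℤ) :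
    ∑ i ∈ S, (v + w) i = ∑ i ∈ S, v i + ∑ i ∈ S, w i := by
  simp [Finset.sum_add_distrib]

omit [Fintype ι] [DecidableEq ι] in
theorem sum_neg_eq (S : Finset ι) (v : ι → ℤ) : ∑ i ∈ S, (-v) i = -∑ i ∈ S, v i := by
  simp

theorem sum_listVec_mul (A : Matrix ι ι ℤ) (l : List ι) (j : ι) :
    ∑ i, listVec l i * A i j = (l.map fun i ↦ A i j).sum := by
  induction l with
  | nil => simp [listVec]
  | cons x l ih =>
    simp only [listVec_cons, Pi.add_apply, add_mul, Finset.sum_add_distrib, ih, List.map_cons,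
      List.sum_cons]
    simp [Pi.single_apply]

namespace IsRootDatum

variable {A : Matrix ι ι ℤ} (hA : IsRootDatum A)
include hA

theorem neg {v : ι → ℤ} (hv : IsRootVec A v) : IsRootVec A (-v) := hv.neg hA.diag

/-- A root with a positive coordinate is positive. -/
theorem nonneg_of_sum_pos {v : ι → ℤ} (hv : IsRootVec A v) {S : Finset ι} (h : 0 < ∑ i ∈ S, v i) :
    0 ≤ v := by
  rcases hA.nonneg_or_nonpos v hv with h' | h'
  · exact h'
  · exact absurd (Finset.sum_nonpos fun i _ ↦ h' i) (not_le.2 h)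

/-- Every positive root is obtained from a simple root by adding simple roots one by one. -/
theorem induction_nonneg {p : (ι → ℤ) → Prop} (simple : ∀ i, p (Pi.single i 1))
    (add : ∀ v j, IsRootVec A v → 0 ≤ v → IsRootVec A (v + Pi.single j 1) → p v →
      p (v + Pi.single j 1)) {v : ι → ℤ} (hv : IsRootVec A v) (h0 : 0 ≤ v) : p v := by
  induction hn : (∑ i, v i).toNat using Nat.strong_induction_on generalizing v with
  | _ n ih =>
    obtain ⟨x, hx, hpos⟩ : ∃ x, 0 < v x ∧ 0 < ∑ y, v y * A y x := by
      by_contra! hno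
      exact hA.ne_zero v hv (hA.eq_zero v h0 hno)
    by_cases hvx : v = Pi.single x 1
    · rw [hvx]
      exact simple x
    have hroot : IsRootVec A (v - Pi.single x 1) := by
      have h₁ := hA.add_single (-v) x (hA.neg hv)
        (by simpa [Finset.sum_neg_distrib] using hpos) (fun h ↦ hvx (neg_injective h))
      simpa [sub_eq_add_neg, add_comm] using hA.neg h₁
    have h0' : 0 ≤ v - Pi.single x 1 := by
      intro i
      rw [Pi.sub_apply, Pi.single_apply]
      have : (0 : ℤ) ≤ v i := h0 i
      split_ifs with hi
      · subst hi
        simp only [Pi.zero_apply]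
        omega
      · simpa using this
    have hsum : ∑ i, (v - Pi.single x 1 : ι → ℤ) i = ∑ i, v i - 1 := by
      simp [Finset.sum_sub_distrib]
    have hpos' : 0 < ∑ i, v i := Finset.sum_pos' (fun i _ ↦ h0 i) ⟨x, Finset.mem_univ x, hx⟩
    have := add _ x hroot h0' (by simpa using hv) (ih _ (by omega) hroot h0' rfl)
    simpa using this

/-- The sum of the simple roots along a path in the Dynkin diagram is a root. -/
theorem isRootVec_listVec {l : List ι} (hl : l ≠ []) (hnodup : l.Nodup)
    (hchain : l.IsChain fun i j ↦ A i j ≠ 0) : IsRootVec A (listVec l) := by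
  induction l with
  | nil => exact absurd rfl hl
  | cons x l ih =>
    match l, hnodup, hchain, ih with
    | [], _, _, _ => simpa [listVec] using IsRootVec.simple (A := A) x
    | y :: l, hnodup, hchain, ih =>
      rw [listVec_cons, add_comm]
      rw [List.isChain_cons_cons] at hchain
      rw [List.nodup_cons] at hnodup
      refine hA.add_single _ _ (ih (by simp) hnodup.2 hchain.2) ?_ fun h ↦ ?_
      · have hle {z} (hz : z ∈ y :: l) : A z x ≤ 0 := hA.nonpos z x fun h ↦ hnodup.1 (h ▸ hz)
        have hlt : A y x < 0 :=
          lt_of_le_of_ne (hle (by simp)) (hA.ne_zero_symm hchain.1)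
        rw [sum_listVec_mul, List.map_cons, List.sum_cons]
        have : (l.map fun i ↦ A i x).sum ≤ (l.map fun _ ↦ (0 : ℤ)).sum :=
          List.sum_le_sum fun z hz ↦ hle (by simp [hz])
        rw [List.map_const', List.sum_replicate, smul_zero] at this
        omega
      · have h₁ := listVec_nonneg (y :: l) x
        rw [h] at h₁
        simp at h₁

/-- Any two simple roots are joined by a path in the Dynkin diagram. -/
theorem exists_path (σ τ : ι) (h : τ ≠ σ) : ∃ l : List ι, (τ :: l ++ [σ]).Nodup ∧
    (τ :: l ++ [σ]).IsChain fun i j ↦ A i j ≠ 0 := by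
  classical
  let S : Finset ι := {τ | τ = σ ∨ ∃ l : List ι, (τ :: l ++ [σ]).Nodup ∧
    (τ :: l ++ [σ]).IsChain fun i j ↦ A i j ≠ 0}
  have hS : S = Finset.univ := by
    refine hA.connected S ⟨σ, by simp [S]⟩ fun i hi j hij ↦ ?_
    simp only [S, Finset.mem_filter, Finset.mem_univ, true_and] at hi ⊢
    by_cases hjσ : j = σ
    · exact .inl hjσ
    refine .inr ?_
    rcases hi with rfl | ⟨l, hnodup, hchain⟩
    · exact ⟨[], by simpa using hjσ, by simpa using hA.ne_zero_symm hij⟩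
    · by_cases hjl : j ∈ i :: l
      · obtain ⟨s, t, hst⟩ := List.append_of_mem hjl
        have hsuf : j :: t ++ [σ] <:+ i :: l ++ [σ] := ⟨s, by rw [hst]; simp⟩
        exact ⟨t, hnodup.sublist hsuf.sublist, hchain.suffix hsuf⟩
      · refine ⟨i :: l, ?_, ?_⟩
        · rw [List.cons_append, List.nodup_cons]
          exact ⟨by simpa [hjσ] using hjl, hnodup⟩
        · exact List.isChain_cons_cons.2 ⟨hA.ne_zero_symm hij, hchain⟩
  have hτ : τ ∈ S := hS ▸ Finset.mem_univ τ
  simp only [S, Finset.mem_filter, Finset.mem_univ, true_and] at hτ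
  exact hτ.resolve_left h

/-- In the admissible case the second set consists of one simple root, which is not in the
first set. -/
theorem exists_eq_singleton {S₁ S₂ : Finset ι} (h : IsCombAdmissible A S₁ S₂) :
    ∃ σ, S₂ = {σ} ∧ σ ∉ S₁ := by
  obtain ⟨v, hv, h1, h2⟩ := h.exists_root
  have h0 := hA.nonneg_of_sum_pos hv (h2 ▸ zero_lt_one)
  obtain ⟨σ, hσ, hvσ⟩ := Finset.exists_ne_zero_of_sum_ne_zero (h2 ▸ one_ne_zero : ∑ i ∈ S₂, v i ≠ 0)
  have hσ₁ : σ ∉ S₁ := fun hσ₁ ↦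
    hvσ ((Finset.sum_eq_zero_iff_of_nonneg fun i _ ↦ h0 i).1 h1 σ hσ₁)
  refine ⟨σ, Finset.eq_singleton_iff_unique_mem.2 ⟨hσ, fun τ hτ ↦ ?_⟩, hσ₁⟩
  by_contra hne
  -- along a path that ends in `σ`, the first set is met at most once and the second set only at
  -- `σ`: at the first exception, the root along the path, or the one along the path without `σ`,
  -- violates `zero`, `one` or `two`
  have key (l : List ι) (hnodup : (l ++ [σ]).Nodup)
      (hchain : (l ++ [σ]).IsChain fun i j ↦ A i j ≠ 0) :
      ∑ i ∈ S₂, listVec l i = 0 ∧ ∑ i ∈ S₁, listVec l i ≤ 1 := by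
    induction l with
    | nil => simp [listVec]
    | cons x l ih =>
      obtain ⟨ih₂, ih₁⟩ := ih (List.nodup_cons.1 hnodup).2 hchain.of_cons
      have hroot := hA.isRootVec_listVec (by simp) hnodup hchain
      have hroot' := hA.isRootVec_listVec (l := x :: l) (by simp)
        (hnodup.sublist (List.sublist_append_left _ _)) (hchain.prefix (List.prefix_append _ _))
      have hnn : 0 ≤ ∑ i ∈ S₁, listVec l i := Finset.sum_nonneg fun i _ ↦ listVec_nonneg l i
      have e1 : ∑ i ∈ S₁, listVec (x :: l) i =
          (if x ∈ S₁ then 1 else 0) + ∑ i ∈ S₁, listVec l i := by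
        rw [listVec_cons, sum_add_eq, sum_single_eq]
      have e2 : ∑ i ∈ S₂, listVec (x :: l) i = (if x ∈ S₂ then 1 else 0) := by
        rw [listVec_cons, sum_add_eq, sum_single_eq, ih₂, add_zero]
      have f1 : ∑ i ∈ S₁, listVec (x :: l ++ [σ]) i = ∑ i ∈ S₁, listVec (x :: l) i := by
        rw [listVec_append_singleton, sum_add_eq, sum_single_eq, if_neg hσ₁, add_zero]
      have f2 : ∑ i ∈ S₂, listVec (x :: l ++ [σ]) i = ∑ i ∈ S₂, listVec (x :: l) i + 1 := by
        rw [listVec_append_singleton, sum_add_eq, sum_single_eq, if_pos hσ]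
      have c0 := h.zero _ hroot
      have c1 := h.one _ hroot
      have c2 := h.two _ hroot
      have c2' := h.two _ hroot'
      rw [f1, f2] at c0 c1 c2
      split_ifs at e1 e2 <;> omega
  obtain ⟨l, hnodup, hchain⟩ := hA.exists_path σ τ hne
  have := (key (τ :: l) hnodup hchain).1
  rw [listVec_cons, sum_add_eq, sum_single_eq, if_pos hτ] at this
  have hnn : 0 ≤ ∑ i ∈ S₂, listVec l i := Finset.sum_nonneg fun i _ ↦ listVec_nonneg l i
  omega

omit hA in
/-- Two roots are linked if one arises from the other by adding roots of degree `0`, with respect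
to the grading determined by `S`, such that all intermediate sums are roots. -/
def Linked (A : Matrix ι ι ℤ) (S : Finset ι) : (ι → ℤ) → (ι → ℤ) → Prop :=
  Relation.ReflTransGen fun v v' ↦ IsRootVec A v ∧ IsRootVec A v' ∧ IsRootVec A (v' - v) ∧
    ∑ i ∈ S, (v' - v) i = 0

theorem linked_symm {S : Finset ι} {v v' : ι → ℤ} (h : Linked A S v v') : Linked A S v' v := by
  induction h with
  | refl => exact .refl
  | tail _ hstep ih =>
    obtain ⟨h₁, h₂, h₃, h₄⟩ := hstep
    refine .head ⟨h₂, h₁, ?_, ?_⟩ ih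
    · simpa using hA.neg h₃
    · rw [← neg_sub, sum_neg_eq, h₄, neg_zero]

theorem linked_neg {S : Finset ι} {v v' : ι → ℤ} (h : Linked A S v v') : Linked A S (-v) (-v') := by
  induction h with
  | refl => exact .refl
  | tail _ hstep ih =>
    obtain ⟨h₁, h₂, h₃, h₄⟩ := hstep
    refine ih.tail ⟨hA.neg h₁, hA.neg h₂, ?_, ?_⟩
    · simpa [neg_add_eq_sub] using hA.neg h₃
    · rw [← neg_sub', sum_neg_eq, h₄, neg_zero]

/-- A positive root is linked to a simple root of the first set in its support, if that is the only
one and has coefficient `1`. -/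
theorem linked_single {S : Finset ι} {i : ι} {v : ι → ℤ} (hv : IsRootVec A v) (h0 : 0 ≤ v)
    (hi : v i = 1) (hS : ∀ j ∈ S, j ≠ i → v j = 0) : Linked A S (Pi.single i 1) v := by
  refine hA.induction_nonneg (p := fun v ↦ v i = 1 → (∀ j ∈ S, j ≠ i → v j = 0) →
    Linked A S (Pi.single i 1) v) (fun j hj _ ↦ ?_) (fun v j hv h0 hvj ih hi hS ↦ ?_) hv h0 hi hS
  · obtain rfl : i = j := by
      by_contra hne
      simp [hne] at hj
    exact .refl
  · have hnn (k : ι) : 0 ≤ v k := h0 k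
    by_cases hji : j = i
    · subst hji
      refine .single ⟨.simple j, hvj, by simpa using hv, ?_⟩
      rw [add_sub_cancel_right]
      refine Finset.sum_eq_zero fun k hk ↦ ?_
      by_cases hkj : k = j
      · subst hkj
        simpa using hi
      · simpa [hkj] using hS k hk hkj
    · have hjS : j ∉ S := fun hjS ↦ by
        have := hS j hjS hji
        have := hnn j
        simp only [Pi.add_apply, Pi.single_eq_same] at *
        omega
      refine (ih ?_ fun k hk hki ↦ ?_).tail ⟨hv, hvj, ?_, ?_⟩
      · simpa [Pi.single_apply, Ne.symm hji] using hi
      · have := hS k hk hki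
        simpa [Pi.single_apply, show k ≠ j from fun h ↦ hjS (h ▸ hk)] using this
      · simpa using IsRootVec.simple (A := A) j
      · rw [add_sub_cancel_left, sum_single_eq, if_neg hjS]

/-- By the Jacobi identity, if no root of degree `d` can be added to `v`, then the same is true for
every root that is linked to `v`. -/
theorem not_add_of_linked {S : Finset ι} {v v' : ι → ℤ} (h : Linked A S v v') {d : ℤ} (hd : d ≠ 0)
    (hvd : ∑ i ∈ S, v i + d ≠ 0)
    (hv : ∀ w, IsRootVec A w → ∑ i ∈ S, w i = d → ¬IsRootVec A (v + w)) :
    ∀ w, IsRootVec A w → ∑ i ∈ S, w i = d → ¬IsRootVec A (v' + w) := by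
  suffices ∑ i ∈ S, v' i = ∑ i ∈ S, v i ∧
      ∀ w, IsRootVec A w → ∑ i ∈ S, w i = d → ¬IsRootVec A (v' + w) from this.2
  induction h with
  | refl => exact ⟨rfl, hv⟩
  | @tail v' v'' _ hstep ih =>
    obtain ⟨h₁, h₂, h₃, h₄⟩ := hstep
    obtain ⟨hsum, ih⟩ := ih
    have hne {u w : ι → ℤ} (h : ∑ i ∈ S, u i + ∑ i ∈ S, w i ≠ 0) : u + w ≠ 0 := fun h0 ↦ h (by
      rw [← sum_add_eq, h0]
      simp)
    refine ⟨?_, fun w hw hwd hroot ↦ ?_⟩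
    · rw [← hsum, ← sub_eq_zero, ← h₄]
      simp
    rcases hA.jacobi v' (v'' - v') w h₁ h₃ hw (by simpa using h₂) (by simpa using hroot)
      (hne (by rwa [hsum, hwd])) (hne (by rwa [h₄, hwd, zero_add])) with h | h
    · exact ih w hw hwd h
    · refine ih _ h (by rw [sum_add_eq, h₄, hwd, zero_add]) ?_
      rwa [← add_assoc, add_sub_cancel]

/-- A root of degree `n ≥ 2` is the sum of a root of degree `n - 1` and a root of degree `1`. -/
theorem exists_add_eq_of_two_le {S : Finset ι} {v : ι → ℤ} (hv : IsRootVec A v)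
    (h2 : 2 ≤ ∑ i ∈ S, v i) : ∃ a b, IsRootVec A a ∧ IsRootVec A b ∧
      ∑ i ∈ S, a i = ∑ i ∈ S, v i - 1 ∧ ∑ i ∈ S, b i = 1 ∧ a + b = v := by
  refine hA.induction_nonneg (p := fun v ↦ 2 ≤ ∑ i ∈ S, v i → ∃ a b, IsRootVec A a ∧
    IsRootVec A b ∧ ∑ i ∈ S, a i = ∑ i ∈ S, v i - 1 ∧ ∑ i ∈ S, b i = 1 ∧ a + b = v)
    (fun j hj ↦ ?_) (fun v j hv _ hvj ih hi ↦ ?_) hv (hA.nonneg_of_sum_pos (S := S) hv (by omega))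
    h2
  · rw [sum_single_eq] at hj
    split_ifs at hj <;> omega
  · rw [sum_add_eq, sum_single_eq] at hi ⊢
    split_ifs at hi ⊢ with hj
    · exact ⟨v, _, hv, .simple j, by omega, by rw [sum_single_eq, if_pos hj], rfl⟩
    · obtain ⟨a, b, ha, hb, ha1, hb1, rfl⟩ := ih (by omega)
      have hne {u : ι → ℤ} (h : 1 ≤ ∑ i ∈ S, u i) : u + Pi.single j 1 ≠ 0 := fun h0 ↦ by
        have : ∑ i ∈ S, (u + Pi.single j 1 : ι → ℤ) i = 0 := by rw [h0]; simp
        rw [sum_add_eq, sum_single_eq, if_neg hj] at this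
        omega
      rcases hA.jacobi a b _ ha hb (.simple j) hv hvj (hne (by omega)) (hne hb1.ge) with h | h
      · exact ⟨_, b, h, hb, by rw [sum_add_eq _ a, sum_single_eq, if_neg hj, ha1]; omega, hb1,
          by abel⟩
      · exact ⟨a, _, ha, h, by omega, by rw [sum_add_eq, sum_single_eq, if_neg hj, hb1, add_zero],
          by abel⟩

/-- A root of degree `2` is a sum of two roots of degree `1`. -/
theorem exists_add_eq {S : Finset ι} {v : ι → ℤ} (hv : IsRootVec A v) (h2 : ∑ i ∈ S, v i = 2) :
    ∃ a b, IsRootVec A a ∧ IsRootVec A b ∧ ∑ i ∈ S, a i = 1 ∧ ∑ i ∈ S, b i = 1 ∧ a + b = v := by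
  obtain ⟨a, b, ha, hb, ha1, hb1, h⟩ := hA.exists_add_eq_of_two_le hv h2.ge
  exact ⟨a, b, ha, hb, by omega, hb1, h⟩

omit [Fintype ι] hA in
/-- A sum of nonnegative integers which is `1`. -/
theorem exists_eq_one {S : Finset ι} {v : ι → ℤ} (h0 : 0 ≤ v) (h1 : ∑ i ∈ S, v i = 1) :
    ∃ i ∈ S, v i = 1 ∧ ∀ j ∈ S, j ≠ i → v j = 0 := by
  obtain ⟨i, hi, hvi⟩ := Finset.exists_ne_zero_of_sum_ne_zero (h1 ▸ one_ne_zero)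
  have hpos : 0 < v i := lt_of_le_of_ne (h0 i) (Ne.symm hvi)
  rw [← Finset.add_sum_erase _ _ hi] at h1
  have hnn : 0 ≤ ∑ j ∈ S.erase i, v j := Finset.sum_nonneg fun j _ ↦ h0 j
  refine ⟨i, hi, by omega, fun j hj hji ↦ ?_⟩
  exact (Finset.sum_eq_zero_iff_of_nonneg fun j _ ↦ h0 j).1 (by omega) j
    (Finset.mem_erase.2 ⟨hji, hj⟩)

/-- Nondegeneracy at the simple roots of the first set, and faithfulness at `-α_σ`, give the two
existence statements in `Good`. -/
theorem exists_good_of_isCombAdmissible {S₁ S₂ : Finset ι} (h : IsCombAdmissible A S₁ S₂) :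
    ∃ σ, S₂ = {σ} ∧ Good A S₁ σ := by
  obtain ⟨σ, rfl, hσ⟩ := hA.exists_eq_singleton h
  have hone := h.one
  have hzero := h.zero
  have htwo := h.two
  have hinj := h.injective
  simp only [Finset.sum_singleton] at hone hzero htwo hinj
  refine ⟨σ, rfl, hσ, hzero, hone, htwo, fun i hi ↦ ?_, ?_⟩
  · have hi1 : ∑ j ∈ S₁, (Pi.single i 1 : ι → ℤ) j = 1 := by rw [sum_single_eq, if_pos hi]
    obtain ⟨w, hw, hw1, hroot⟩ := h.nondegenerate _ (.simple i) hi1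
    refine ⟨_, hroot, by rw [sum_add_eq, hi1, hw1]; norm_num, ?_⟩
    have : 0 ≤ w i := hA.nonneg_of_sum_pos hw (hw1 ▸ zero_lt_one) i
    simp only [Pi.add_apply, Pi.single_eq_same]
    omega
  · obtain ⟨w, hw, hw1, hroot⟩ := hinj (-Pi.single σ 1) (hA.neg (.simple σ))
      (by rw [sum_neg_eq, sum_single_eq, if_neg hσ, neg_zero]) (by simp)
    have hroot' := hA.neg hroot
    have e1 : ∑ i ∈ S₁, (-(-Pi.single σ 1 + w) : ι → ℤ) i = 1 := by
      rw [sum_neg_eq, sum_add_eq, sum_neg_eq, sum_single_eq, if_neg hσ, hw1]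
      norm_num
    have e2 : ∑ i ∈ S₁, (-w) i = 1 := by rw [sum_neg_eq, hw1, neg_neg]
    have c1 := hone _ hroot' e1
    have c2 := hone _ (hA.neg hw) e2
    refine ⟨_, hroot', e1, ?_⟩
    simp only [Pi.neg_apply, Pi.add_apply, Pi.single_eq_same] at c1 c2 ⊢
    omega

/-- The existence statements in `Good` concern one root for every simple root of the first set, and
for `σ`. They carry over to all roots of the same degrees by `not_add_of_linked`. -/
theorem isCombAdmissible_of_good {S : Finset ι} {σ : ι} (h : Good A S σ) :
    IsCombAdmissible A S {σ} := by
  have hσ := h.notMem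
  -- all roots of bidegree `(0, 1)` are linked to `α_σ`
  have hlink {v : ι → ℤ} (hv : IsRootVec A v) (hS : ∑ i ∈ S, v i = 0) (hvσ : v σ = 1) :
      Linked A S (Pi.single σ 1) v := by
    have h0 : 0 ≤ v := hA.nonneg_of_sum_pos (S := {σ}) hv (by simp [hvσ])
    exact hA.linked_single hv h0 hvσ fun j hj _ ↦
      (Finset.sum_eq_zero_iff_of_nonneg fun i _ ↦ h0 i).1 hS j hj
  -- A root of degree `1` to which `α_σ` can be added: the root of bidegree `(1, 1)` arises from a
  -- simple root by adding simple roots. The step from degree `0` to degree `1` settles the case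
  -- that `α_σ` is present before, by `not_add_of_linked`.
  obtain ⟨u, hu, hu1, huσ⟩ : ∃ u, IsRootVec A u ∧ ∑ i ∈ S, u i = 1 ∧
      IsRootVec A (u + Pi.single σ 1) := by
    obtain ⟨r, hr, hr1, hrσ⟩ := h.exists_one
    refine hA.induction_nonneg (p := fun r ↦ ∑ i ∈ S, r i = 1 → r σ = 1 → ∃ u, IsRootVec A u ∧
      ∑ i ∈ S, u i = 1 ∧ IsRootVec A (u + Pi.single σ 1)) (fun j hj hjσ ↦ ?_)
      (fun v j hv h0 hvj ih hi hjσ ↦ ?_) hr (hA.nonneg_of_sum_pos hr (hr1 ▸ zero_lt_one)) hr1 hrσ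
    · rw [sum_single_eq] at hj
      obtain rfl : σ = j := by
        by_contra hne
        simp [hne] at hjσ
      rw [if_neg hσ] at hj
      omega
    · rw [sum_add_eq, sum_single_eq] at hi
      by_cases hjσ' : j = σ
      · subst hjσ'
        rw [if_neg hσ, add_zero] at hi
        exact ⟨v, hv, hi, hvj⟩
      have hvσ : v σ = 1 := by simpa [Pi.single_apply, Ne.symm hjσ'] using hjσ
      by_cases hjS : j ∈ S
      · rw [if_pos hjS] at hi
        by_contra! hno
        refine hA.not_add_of_linked (hA.linked_neg (hlink hv (by omega) hvσ)) (d := -1)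
          (by norm_num) (by rw [sum_neg_eq, sum_single_eq, if_neg hσ]; norm_num)
          (fun w hw hw1 hroot ↦ ?_)
          (-Pi.single j 1) (hA.neg (.simple j)) (by rw [sum_neg_eq, sum_single_eq, if_pos hjS]) ?_
        · refine hno (-w) (hA.neg hw) (by rw [sum_neg_eq, hw1, neg_neg]) ?_
          simpa [add_comm] using hA.neg hroot
        · rw [← neg_add]
          exact hA.neg hvj
      · rw [if_neg hjS, add_zero] at hi
        exact ih hi hvσ
  refine ⟨?_, ?_, ?_, fun v hv hv1 ↦ ?_, ⟨_, .simple σ, ?_, ?_⟩, fun v hv hv0 hvσ ↦ ?_⟩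
  · simpa using h.zero
  · simpa using h.one
  · simpa using h.two
  · obtain ⟨i, hi, hvi, hvS⟩ := exists_eq_one
      (hA.nonneg_of_sum_pos hv (hv1 ▸ zero_lt_one)) hv1
    -- a decomposition of a root of degree `2` gives a root `a` which is linked to `α_i`
    obtain ⟨r, hr, hr2, hri⟩ := h.exists_two i hi
    obtain ⟨a, b, ha, hb, hai, ha1, hb1, hab⟩ : ∃ a b, IsRootVec A a ∧ IsRootVec A b ∧ 0 < a i ∧
        ∑ i ∈ S, a i = 1 ∧ ∑ i ∈ S, b i = 1 ∧ IsRootVec A (a + b) := by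
      obtain ⟨a, b, ha, hb, ha1, hb1, rfl⟩ := hA.exists_add_eq hr hr2
      rw [Pi.add_apply] at hri
      rcases (by omega : 0 < a i ∨ 0 < b i) with h | h
      · exact ⟨a, b, ha, hb, h, ha1, hb1, hr⟩
      · exact ⟨b, a, hb, ha, h, hb1, ha1, add_comm a b ▸ hr⟩
    have ha0 := hA.nonneg_of_sum_pos ha (ha1 ▸ zero_lt_one)
    obtain ⟨i', hi', hai', haS⟩ := exists_eq_one ha0 ha1
    obtain rfl : i = i' := by
      by_contra hne
      have := haS i hi hne
      omega
    by_contra! hno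
    have hl := (hA.linked_symm (hA.linked_single hv
      (hA.nonneg_of_sum_pos hv (hv1 ▸ zero_lt_one)) hvi hvS)).trans
      (hA.linked_single ha ha0 hai' haS)
    exact hA.not_add_of_linked hl one_ne_zero (by omega) hno b hb hb1 hab
  · rw [sum_single_eq, if_neg hσ]
  · simp
  · rw [Finset.sum_singleton] at hvσ
    have hσ0 : ∑ i ∈ S, (Pi.single σ 1 : ι → ℤ) i = 0 := by rw [sum_single_eq, if_neg hσ]
    by_contra! hno
    rcases hvσ with hvσ | hvσ
    · refine hA.not_add_of_linked (hA.linked_symm (hlink hv hv0 hvσ)) (d := -1) (by norm_num)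
        (by omega) hno (-(u + Pi.single σ 1)) (hA.neg huσ)
        (by rw [sum_neg_eq, sum_add_eq, hu1, hσ0, add_zero]) ?_
      simpa using hA.neg hu
    · have hl := hA.linked_neg
        (hlink (hA.neg hv) (by rw [sum_neg_eq, hv0, neg_zero]) (by simp [hvσ]))
      rw [neg_neg] at hl
      refine hA.not_add_of_linked (hA.linked_symm hl) (d := -1) (by norm_num)
        (by omega) hno (-u) (hA.neg hu) (by rw [sum_neg_eq, hu1]) ?_
      rw [← neg_add_rev]
      exact hA.neg huσ

/-- The combinatorial form of the classification. -/
theorem isCombAdmissible_iff_listed {S₁ S₂ : Finset ι} :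
    IsCombAdmissible A S₁ S₂ ↔ Listed A S₁ S₂ := by
  constructor
  · intro h
    obtain ⟨σ, rfl, hσ⟩ := hA.exists_good_of_isCombAdmissible h
    exact hA.listed_of_good hσ
  · intro h
    obtain ⟨σ, rfl, hσ⟩ := h.exists_good
    exact hA.isCombAdmissible_of_good hσ

end IsRootDatum

end Combinatorics

/-! ### Root systems and their Cartan matrices -/

section RootSystem

open Set

variable {ι R M N : Type*} [Finite ι] [Field R] [CharZero R] [AddCommGroup M] [Module R M]
  [AddCommGroup N] [Module R N] {P : RootPairing ι R M N} [P.IsRootSystem] [P.IsCrystallographic]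
  (b : P.Base)

/-- The linear combination of the simple roots with the given integral coefficients. -/
def combination (v : b.support → ℤ) : M := ∑ i, v i • P.root i

omit [Finite ι] [CharZero R] [P.IsRootSystem] [P.IsCrystallographic]

theorem combination_add (v w : b.support → ℤ) :
    combination b (v + w) = combination b v + combination b w := by
  simp [combination, add_smul, Finset.sum_add_distrib]

theorem combination_neg (v : b.support → ℤ) : combination b (-v) = -combination b v := by
  simp [combination]

theorem combination_zero : combination b 0 = 0 := by
  simp [combination]

theorem combination_single [DecidableEq b.support] (j : b.support) :
    combination b (Pi.single j 1) = P.root j := by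
  rw [combination, Finset.sum_eq_single j (fun k _ hk ↦ by simp [hk]) (by simp)]
  simp

theorem combination_injective [CharZero R] : Function.Injective (combination b) := by
  intro v w h
  have h' : combination b (v - w) = 0 := by
    rw [sub_eq_add_neg, combination_add, combination_neg, h, add_neg_cancel]
  have := Fintype.linearIndependent_iff.1
    (b.linearIndepOn_root.linearIndependent.restrict_scalars' ℤ) (v - w) h'
  exact sub_eq_zero.1 (funext this)

theorem toWeightBasis_repr_combination [P.IsRootSystem] (v : b.support → ℤ) (i : b.support) :
    b.toWeightBasis.repr (combination b v) i = v i := by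
  rw [combination, map_sum, Finsupp.finsetSum_apply, Finset.sum_eq_single i]
  · simp
  · intro k _ hk
    simp [hk.symm]
  · simp

theorem combination_simpleReflection [DecidableEq b.support] [CharZero R] [P.IsCrystallographic]
    (j : b.support) (v : b.support → ℤ) :
    combination b (simpleReflection b.cartanMatrix j v) = P.reflection j (combination b v) := by
  have h : simpleReflection b.cartanMatrix j v =
      v + (-∑ i, v i * b.cartanMatrix i j) • Pi.single j 1 := by
    ext k
    by_cases hk : k = j
    · subst hk
      simp [simpleReflection, sub_eq_add_neg]
    · simp [simpleReflection, hk]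
  have hc : combination b ((-∑ i, v i * b.cartanMatrix i j) • Pi.single j 1) =
      (-∑ i, v i * b.cartanMatrix i j) • P.root j := by
    rw [← combination_single, combination, combination, Finset.smul_sum]
    simp [mul_smul]
  rw [h, combination_add, hc, RootPairing.reflection_apply, sub_eq_add_neg, neg_smul]
  congr 2
  simp only [combination, map_sum, Finset.sum_smul, map_zsmul, RootPairing.root_coroot'_eq_pairing]
  refine Finset.sum_congr rfl fun i _ ↦ ?_
  rw [mul_smul, zsmul_eq_mul, ← P.algebraMap_pairingIn ℤ, mul_smul, ← Int.cast_smul_eq_zsmul R]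
  simp [RootPairing.Base.cartanMatrixIn_def, Int.cast_smul_eq_zsmul]

variable [Finite ι] [CharZero R] [P.IsRootSystem] [P.IsCrystallographic] [DecidableEq b.support]

omit [P.IsRootSystem] in
theorem exists_isRootVec [P.IsReduced] (i : ι) :
    ∃ v, IsRootVec b.cartanMatrix v ∧ combination b v = P.root i := by
  refine b.induction_reflect i (p := fun i ↦ ∃ v, IsRootVec b.cartanMatrix v ∧
    combination b v = P.root i) ?_ ?_ ?_
  · rintro i ⟨v, hv, h⟩
    exact ⟨-v, hv.neg b.cartanMatrix_apply_same, by simp [combination_neg, h]⟩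
  · exact fun i hi ↦ ⟨_, .simple ⟨i, hi⟩, combination_single b _⟩
  · rintro i j ⟨v, hv, h⟩ hj
    exact ⟨_, .reflect v ⟨j, hj⟩ hv, by rw [combination_simpleReflection, h, P.root_reflectionPerm]⟩

omit [P.IsRootSystem] in
/-- The inductively defined root vectors are the coordinate vectors of the roots. -/
theorem isRootVec_iff [P.IsReduced] (v : b.support → ℤ) :
    IsRootVec b.cartanMatrix v ↔ combination b v ∈ range P.root := by
  constructor
  · intro hv
    induction hv with
    | simple i => exact ⟨i, (combination_single b i).symm⟩
    | reflect v j _ ih =>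
      obtain ⟨i, hi⟩ := ih
      exact ⟨P.reflectionPerm j i, by
        rw [combination_simpleReflection, ← hi, P.root_reflectionPerm]⟩
  · rintro ⟨i, hi⟩
    obtain ⟨w, hw, hwi⟩ := exists_isRootVec b i
    rwa [combination_injective b (hi.symm.trans hwi.symm)]

omit [P.IsRootSystem] in
theorem nonneg_or_nonpos_of_isRootVec [P.IsReduced] {v : b.support → ℤ}
    (hv : IsRootVec b.cartanMatrix v) : 0 ≤ v ∨ v ≤ 0 := by
  classical
  obtain ⟨i, hi⟩ := (isRootVec_iff b v).1 hv
  obtain ⟨f, -, hf⟩ := b.exists_root_eq_sum_nat_or_neg i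
  set w : b.support → ℤ := fun j ↦ f j with hw
  have hw0 : 0 ≤ w := fun j ↦ by simp [hw]
  have hwc : combination b w = ∑ j ∈ b.support, f j • P.root j := by
    rw [combination, ← Finset.sum_coe_sort b.support]
    simp [hw]
  rw [← hwc, hi] at hf
  rcases hf with hf | hf
  · exact .inl (combination_injective b hf ▸ hw0)
  · rw [← combination_neg] at hf
    exact .inr (combination_injective b hf ▸ neg_nonpos.2 hw0)

omit [P.IsRootSystem] in
theorem isRootVec_add_single [P.IsReduced] {v : b.support → ℤ} {j : b.support}
    (hv : IsRootVec b.cartanMatrix v) (h : ∑ i, v i * b.cartanMatrix i j < 0)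
    (hne : v ≠ -Pi.single j 1) : IsRootVec b.cartanMatrix (v + Pi.single j 1) := by
  obtain ⟨i, hi⟩ := (isRootVec_iff b v).1 hv
  rw [isRootVec_iff, combination_add, combination_single, ← hi]
  have hp : P.pairingIn ℤ i j = ∑ i, v i * b.cartanMatrix i j := by
    apply FaithfulSMul.algebraMap_injective ℤ R
    rw [P.algebraMap_pairingIn, ← P.root_coroot'_eq_pairing, hi, combination]
    simp [RootPairing.Base.cartanMatrixIn_def, ← P.algebraMap_pairingIn ℤ]
  refine P.root_add_root_mem_of_pairingIn_neg (hp ▸ h) fun h' ↦ hne ?_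
  apply combination_injective b
  rw [← hi, h', combination_neg, combination_single]

omit [DecidableEq b.support] in
/-- The last property of `IsFiniteType` holds because the product of the Cartan matrix with some
positive diagonal matrix is positive definite. -/
theorem isFiniteType_cartanMatrix [P.IsReduced] [P.IsIrreducible] :
    IsFiniteType b.cartanMatrix where
  diag := b.cartanMatrix_apply_same
  nonpos i j h := b.cartanMatrix_le_zero_of_ne i j h
  zero_symm _ _ h := (b.cartanMatrix_apply_eq_zero_iff_symm).1 h
  connected S hS h := by
    obtain ⟨i, hi⟩ := hS
    refine Finset.eq_univ_iff_forall.2 fun j ↦ b.induction_on_cartanMatrix (· ∈ S) hi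
      fun k l hk hlk ↦ h k hk l fun h0 ↦ hlk (b.cartanMatrix_apply_eq_zero_iff_symm.1 h0)
  eq_zero v hv h := by
    classical
    -- for `v ≠ 0` the value of the quadratic form at `v` would be positive
    obtain ⟨d, hd, hpos⟩ := b.exists_cartanMatrix_mul_diagaonal_posDef
    by_contra h0
    refine absurd (hpos.dotProduct_mulVec_pos h0) (not_lt.2 ?_)
    simp only [dotProduct, Matrix.mulVec, Matrix.mul_diagonal, Finset.mul_sum, star_trivial]
    rw [Finset.sum_comm]
    refine Finset.sum_nonpos fun x _ ↦ ?_
    have : ∑ y, v y * (b.cartanMatrix y x * d x * v x) =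
        v x * d x * ∑ y, v y * b.cartanMatrix y x := by
      rw [Finset.mul_sum]
      exact Finset.sum_congr rfl fun _ _ ↦ by ring
    rw [this]
    rcases (hv x).eq_or_lt with hx | hx
    · simp [← hx]
    · exact mul_nonpos_of_nonneg_of_nonpos (mul_pos hx (hd x)).le (h x hx)

end RootSystem

/-! ### Brackets of root vectors -/

section Brackets

open LieAlgebra LieAlgebra.IsKilling LieModule Module

variable {L : Type*} [LieRing L] [LieAlgebra ℂ L] [FiniteDimensional ℂ L] [IsKilling ℂ L]
  {H : LieSubalgebra ℂ L} [H.IsCartanSubalgebra]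

/-- If `α`, `β` and `α + β` are roots, brackets of nonzero elements of the root spaces of `α` and
`β` are not zero. -/
theorem lie_ne_zero_of_add_isRoot {α β : Weight ℂ H L} (hα : α.IsNonZero) (hβ : β.IsNonZero)
    (hαβ : rootSpace H (α + β) ≠ ⊥) {x y : L} (hx : x ∈ rootSpace H α) (hy : y ∈ rootSpace H β)
    (hx0 : x ≠ 0) (hy0 : y ≠ 0) : ⁅x, y⁆ ≠ 0 := by
  obtain ⟨h, e, f, ht, he, hf⟩ := exists_isSl2Triple_of_weight_isNonZero hα
  obtain rfl := ht.h_eq_coroot hα he hf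
  obtain ⟨z, hz, hz0⟩ := (chainTop α β).exists_ne_zero
  have prim : ht.HasPrimitiveVectorWith z (chainLength α β : ℂ) :=
    have := lie_mem_genWeightSpace_of_mem_genWeightSpace he hz
    ⟨hz0, (chainLength_smul _ _ hz).symm, by rwa [genWeightSpace_add_chainTop _ _ hα] at this⟩
  -- The element `β` of the `α`-chain is not its top, so that `y` is a multiple of `f ^ (n + 1) z`.
  obtain ⟨n, hn⟩ : ∃ n, chainTopCoeff α β = n + 1 := by
    have h1 := (rootSpace_zsmul_add_ne_bot_iff α β hα 1).1 (by rwa [one_smul])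
    exact ⟨chainTopCoeff α β - 1, by omega⟩
  have hlen : n + 1 ≤ chainLength α β := hn ▸ chainTopCoeff_le_chainLength α β
  have hmem := toEnd_pow_apply_mem hf hz (n + 1)
  have hne := prim.pow_toEnd_f_ne_zero_of_eq_nat rfl hlen
  have hwt : (n + 1) • (-α : H → ℂ) + chainTop α β = β := by
    rw [coe_chainTop', hn, smul_neg, neg_add_cancel_left]
  rw [hwt] at hmem
  obtain ⟨c, hc⟩ := (finrank_eq_one_iff_of_nonzero' (⟨_, hmem⟩ : rootSpace H β)
    (by simpa [← Subtype.coe_ne_coe] using hne)).1 (finrank_rootSpace_eq_one β hβ) ⟨y, hy⟩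
  obtain ⟨d, hd⟩ := (finrank_eq_one_iff_of_nonzero' (⟨e, he⟩ : rootSpace H α)
    (by simpa [← Subtype.coe_ne_coe] using ht.e_ne_zero)).1 (finrank_rootSpace_eq_one α hα) ⟨x, hx⟩
  obtain rfl := congrArg Subtype.val hc
  obtain rfl := congrArg Subtype.val hd
  simp only [LieSubmodule.coe_smul] at hx0 hy0 ⊢
  rw [smul_lie, lie_smul, prim.lie_e_pow_succ_toEnd_f]
  have hlt : ((chainLength α β : ℂ) - n) ≠ 0 := sub_ne_zero.2 (by exact_mod_cast (by omega))
  exact smul_ne_zero (left_ne_zero_of_smul hx0) (smul_ne_zero (left_ne_zero_of_smul hy0)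
    (smul_ne_zero (mul_ne_zero (by exact_mod_cast n.succ_ne_zero) hlt)
      (prim.pow_toEnd_f_ne_zero_of_eq_nat rfl (by omega))))

end Brackets

/-! ### Sums of weight spaces -/

section WeightSums

open LieAlgebra LieAlgebra.IsKilling LieModule Module

variable {L : Type*} [LieRing L] [LieAlgebra ℂ L] {H : LieSubalgebra ℂ L}
  [H.IsCartanSubalgebra]

/-- The sum of the weight spaces of the weights in a set. -/
def weightSum (I : Set (Weight ℂ H L)) : Submodule ℂ L := ⨆ α ∈ I, (rootSpace H α).toSubmodule

theorem rootSpace_le_weightSum {I : Set (Weight ℂ H L)} {α : Weight ℂ H L} (h : α ∈ I) :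
    (rootSpace H α).toSubmodule ≤ weightSum I :=
  le_iSup₂_of_le α h le_rfl

theorem weightSum_le {I : Set (Weight ℂ H L)} {N : Submodule ℂ L} :
    weightSum I ≤ N ↔ ∀ α ∈ I, (rootSpace H α).toSubmodule ≤ N :=
  iSup₂_le_iff

theorem weightSum_union (I J : Set (Weight ℂ H L)) :
    weightSum (I ∪ J) = weightSum I ⊔ weightSum J :=
  iSup_union

theorem weightSum_iUnion {κ : Sort*} (I : κ → Set (Weight ℂ H L)) :
    weightSum (⋃ i, I i) = ⨆ i, weightSum (I i) :=
  iSup_iUnion _ _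

theorem weightSum_univ [FiniteDimensional ℂ L] : weightSum (Set.univ : Set (Weight ℂ H L)) = ⊤ := by
  have h := congrArg LieSubmodule.toSubmodule (iSup_genWeightSpace_eq_top' ℂ H L)
  rw [LieSubmodule.iSup_toSubmodule, LieSubmodule.top_toSubmodule] at h
  simpa [weightSum] using h

theorem iSupIndep_rootSpace :
    iSupIndep fun α : Weight ℂ H L ↦ (rootSpace H α).toSubmodule :=
  LieSubmodule.iSupIndep_toSubmodule.2 (iSupIndep_genWeightSpace' ℂ H L)

theorem rootSpace_ne_bot (α : Weight ℂ H L) : (rootSpace H α).toSubmodule ≠ ⊥ := by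
  simpa using α.genWeightSpace_ne_bot

variable [FiniteDimensional ℂ L]

theorem disjoint_weightSum {I J : Set (Weight ℂ H L)} (h : Disjoint I J) :
    Disjoint (weightSum I) (weightSum J) :=
  iSupIndep_rootSpace.disjoint_biSup_biSup' h I.toFinite

theorem weightSum_le_weightSum {I J : Set (Weight ℂ H L)} :
    weightSum I ≤ weightSum J ↔ I ⊆ J := by
  refine ⟨fun h α hα ↦ ?_, fun h ↦ biSup_mono h⟩
  by_contra hα'
  have hd := disjoint_weightSum (Set.disjoint_singleton_left.2 hα')
  have hle : (rootSpace H α).toSubmodule ≤ weightSum {α} := rootSpace_le_weightSum rfl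
  exact rootSpace_ne_bot α (disjoint_self.1 (hd.mono hle ((rootSpace_le_weightSum hα).trans h)))

theorem weightSum_injective : Function.Injective (weightSum (H := H)) := fun _ _ h ↦
  (weightSum_le_weightSum.1 h.le).antisymm (weightSum_le_weightSum.1 h.ge)

theorem weightSum_eq_bot {I : Set (Weight ℂ H L)} : weightSum I = ⊥ ↔ I = ∅ := by
  rw [← weightSum_injective.eq_iff (b := ∅)]
  simp [weightSum]

omit [FiniteDimensional ℂ L] in
theorem exists_finsupp_of_mem_weightSum {I : Set (Weight ℂ H L)} {x : L} (hx : x ∈ weightSum I) :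
    ∃ f : Weight ℂ H L →₀ L, (∀ α : Weight ℂ H L, f α ∈ rootSpace H α) ∧
      (∀ α : Weight ℂ H L, f α ≠ 0 → α ∈ I) ∧
      f.sum (fun _ y ↦ y) = x := by
  obtain ⟨f, hf, h⟩ := (Submodule.mem_iSup_iff_exists_finsupp
    (fun α : Weight ℂ H L ↦ ⨆ _ : α ∈ I, (rootSpace H α).toSubmodule) x).1 hx
  refine ⟨f, fun α ↦ ?_, fun α hα ↦ ?_, h⟩
  · have := hf α
    by_cases hI : α ∈ I
    · simpa [hI] using this
    · simp only [hI, iSup_false, Submodule.mem_bot] at this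
      simp [this]
  · by_contra hI
    have := hf α
    simp only [hI, iSup_false, Submodule.mem_bot] at this
    exact hα this

omit [FiniteDimensional ℂ L] in
theorem lie_mem_of_mem_weightSum {I J : Set (Weight ℂ H L)} {N : Submodule ℂ L}
    (h : ∀ α ∈ I, ∀ β ∈ J, ∀ x ∈ rootSpace H α, ∀ y ∈ rootSpace H β, ⁅x, y⁆ ∈ N) {x y : L}
    (hx : x ∈ weightSum I) (hy : y ∈ weightSum J) : ⁅x, y⁆ ∈ N := by
  have h₁ : weightSum I ≤ ⨅ z ∈ weightSum J, N.comap (ad ℂ L z) := by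
    refine weightSum_le.2 fun α hα u hu ↦ ?_
    simp only [Submodule.mem_iInf, Submodule.mem_comap, ad_apply]
    intro z hz
    have h₂ : weightSum J ≤ N.comap (ad ℂ L u) :=
      weightSum_le.2 fun β hβ v hv ↦ h α hα β hβ u hu v hv
    rw [← lie_skew]
    exact N.neg_mem (h₂ hz)
  have := h₁ hx
  simp only [Submodule.mem_iInf, Submodule.mem_comap, ad_apply] at this
  rw [← lie_skew]
  exact N.neg_mem (this y hy)

/-- A sum of root spaces acts faithfully on another one if and only if to every root of the first
one a root of the second one can be added. -/
theorem forall_weightSum_iff [IsKilling ℂ L] {I J : Set (Weight ℂ H L)} (hI : ∀ α ∈ I, α.IsNonZero)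
    (hJ : ∀ α ∈ J, α.IsNonZero) :
    (∀ x ∈ weightSum I, (∀ y ∈ weightSum J, ⁅x, y⁆ = 0) → x = 0) ↔
      ∀ α ∈ I, ∃ β ∈ J, rootSpace H (α + β) ≠ ⊥ := by
  constructor
  · intro h α hα
    obtain ⟨x, hx, hx0⟩ := α.exists_ne_zero
    by_contra! hno
    refine hx0 (h x (rootSpace_le_weightSum hα hx) fun y hy ↦ ?_)
    have : weightSum J ≤ LinearMap.ker (ad ℂ L x) := by
      refine weightSum_le.2 fun β hβ z hz ↦ ?_
      have : ⁅x, z⁆ ∈ rootSpace H (α + β) := lie_mem_genWeightSpace_of_mem_genWeightSpace hx hz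
      rw [hno β hβ] at this
      simpa using this
    exact this hy
  · intro h x hx hxy
    obtain ⟨f, hf, hfI, rfl⟩ := exists_finsupp_of_mem_weightSum hx
    suffices f = 0 by simp [this]
    ext α
    by_contra h0
    obtain ⟨β, hβ, hαβ⟩ := h α (hfI α h0)
    obtain ⟨y, hy, hy0⟩ := β.exists_ne_zero
    refine lie_ne_zero_of_add_isRoot (hI α (hfI α h0)) (hJ β hβ) hαβ (hf α) hy h0 hy0 ?_
    have hsum := hxy y (rootSpace_le_weightSum hβ hy)
    rw [Finsupp.sum, sum_lie] at hsum
    -- The brackets of `y` with the components of `x` lie in different weight spaces.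
    have hind : iSupIndep fun γ : Weight ℂ H L ↦ (rootSpace H (γ + β : H → ℂ)).toSubmodule :=
      LieSubmodule.iSupIndep_toSubmodule.2 ((iSupIndep_genWeightSpace ℂ H L).comp
        (f := fun γ : Weight ℂ H L ↦ (γ + β : H → ℂ)) fun γ δ h ↦ by simpa using h)
    exact (iSupIndep_iff_finsetSum_eq_zero_imp_eq_zero _).1 hind f.support (fun γ ↦ ⁅f γ, y⁆)
      (fun γ _ ↦ lie_mem_genWeightSpace_of_mem_genWeightSpace (hf γ) hy) hsum α
      (Finsupp.mem_support_iff.2 h0)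

end WeightSums

/-! ### Coordinates of weights -/

section Coordinates

open LieAlgebra LieAlgebra.IsKilling LieModule Module

variable {L : Type*} [LieRing L] [LieAlgebra ℂ L] [FiniteDimensional ℂ L] [IsKilling ℂ L]
  {H : LieSubalgebra ℂ L} [H.IsCartanSubalgebra] (Δ : (rootSystem H).Base)

theorem exists_combination_eq (α : Weight ℂ H L) :
    ∃ v, combination Δ v = α.toLinear := by
  classical
  by_cases hα : α.IsZero
  · exact ⟨0, by ext; simp [combination_zero, hα.eq]⟩
  · obtain ⟨v, -, hv⟩ := exists_isRootVec Δ ⟨α, by simpa using hα⟩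
    exact ⟨v, hv⟩

/-- The coordinate vector of a weight of the adjoint representation with respect to the simple
roots. -/
noncomputable def coordVec (α : Weight ℂ H L) : Δ.support → ℤ := (exists_combination_eq Δ α).choose

theorem combination_coordVec (α : Weight ℂ H L) : combination Δ (coordVec Δ α) = α.toLinear :=
  (exists_combination_eq Δ α).choose_spec

theorem coordVec_eq_iff {α : Weight ℂ H L} {v : Δ.support → ℤ} :
    coordVec Δ α = v ↔ combination Δ v = α.toLinear := by
  rw [← combination_coordVec, (combination_injective Δ).eq_iff, eq_comm]

theorem coordVec_add {α β γ : Weight ℂ H L} (h : (γ : H → ℂ) = α + β) :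
    coordVec Δ γ = coordVec Δ α + coordVec Δ β := by
  rw [coordVec_eq_iff, combination_add, combination_coordVec, combination_coordVec]
  ext x
  exact (congrFun h x).symm

theorem coordVec_neg (α : Weight ℂ H L) : coordVec Δ (-α) = -coordVec Δ α := by
  rw [coordVec_eq_iff, combination_neg, combination_coordVec]
  rfl

theorem coordVec_eq_zero {α : Weight ℂ H L} : coordVec Δ α = 0 ↔ α.IsZero := by
  rw [coordVec_eq_iff, combination_zero]
  refine ⟨fun h ↦ ?_, fun h ↦ ?_⟩
  · ext x
    exact (DFunLike.congr_fun h x).symm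
  · ext x
    simp [h.eq]

variable [DecidableEq Δ.support]

theorem isRootVec_coordVec_iff {α : Weight ℂ H L} :
    IsRootVec Δ.cartanMatrix (coordVec Δ α) ↔ α.IsNonZero := by
  rw [isRootVec_iff, combination_coordVec]
  constructor
  · rintro ⟨⟨β, hβ⟩, h⟩
    have : β = α := by
      ext x
      exact DFunLike.congr_fun h x
    simpa [this] using hβ
  · exact fun h ↦ ⟨⟨α, by simpa using h⟩, rfl⟩

theorem exists_coordVec_eq {v : Δ.support → ℤ} (hv : IsRootVec Δ.cartanMatrix v) :
    ∃ α : Weight ℂ H L, α.IsNonZero ∧ coordVec Δ α = v := by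
  obtain ⟨⟨α, hα⟩, h⟩ := (isRootVec_iff Δ v).1 hv
  exact ⟨α, by simpa using hα, (coordVec_eq_iff Δ).2 h.symm⟩

/-- A sum of two weights which is not zero is a weight if and only if its coordinate vector is the
one of a root. -/
theorem rootSpace_add_ne_bot_iff {α β : Weight ℂ H L} (h0 : coordVec Δ α + coordVec Δ β ≠ 0) :
    rootSpace H (α + β) ≠ ⊥ ↔ IsRootVec Δ.cartanMatrix (coordVec Δ α + coordVec Δ β) := by
  constructor
  · intro h
    have hc := coordVec_add Δ (γ := ⟨α + β, h⟩) rfl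
    rw [← hc] at h0 ⊢
    exact (isRootVec_coordVec_iff Δ).2 fun h ↦ h0 ((coordVec_eq_zero Δ).2 h)
  · intro h
    obtain ⟨γ, -, hγ⟩ := exists_coordVec_eq Δ h
    have : (γ : H → ℂ) = α + β := by
      rw [coordVec_eq_iff, combination_add, combination_coordVec, combination_coordVec] at hγ
      ext x
      exact (DFunLike.congr_fun hγ x).symm
    rw [← this]
    exact γ.genWeightSpace_ne_bot

/-- The coordinate vectors of the roots of a simple Lie algebra satisfy the assumptions of the
combinatorial classification. -/
theorem isRootDatum_cartanMatrix [LieAlgebra.IsSimple ℂ L] : IsRootDatum Δ.cartanMatrix where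
  toIsFiniteType := isFiniteType_cartanMatrix Δ
  ne_zero v hv := by
    obtain ⟨α, hα, rfl⟩ := exists_coordVec_eq Δ hv
    exact fun h ↦ hα ((coordVec_eq_zero Δ).1 h)
  nonneg_or_nonpos _ hv := nonneg_or_nonpos_of_isRootVec Δ hv
  add_single _ _ hv h hne := isRootVec_add_single Δ hv h hne
  jacobi u v w hu hv hw huv huvw hne hne' := by
    obtain ⟨α, hα, rfl⟩ := exists_coordVec_eq Δ hu
    obtain ⟨β, hβ, rfl⟩ := exists_coordVec_eq Δ hv
    obtain ⟨γ, hγ, rfl⟩ := exists_coordVec_eq Δ hw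
    by_contra! hno
    -- root vectors with `⁅⁅x, y⁆, z⁆ ≠ 0`, for which one of `⁅x, z⁆` and `⁅y, z⁆` is not zero
    obtain ⟨x, hx, hx0⟩ := α.exists_ne_zero
    obtain ⟨y, hy, hy0⟩ := β.exists_ne_zero
    obtain ⟨z, hz, hz0⟩ := γ.exists_ne_zero
    have hnz {v : Δ.support → ℤ} (h : IsRootVec Δ.cartanMatrix v) : v ≠ 0 := by
      obtain ⟨δ, hδ, rfl⟩ := exists_coordVec_eq Δ h
      exact fun h ↦ hδ ((coordVec_eq_zero Δ).1 h)
    have hαβ := (rootSpace_add_ne_bot_iff Δ (hnz huv)).2 huv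
    set δ : Weight ℂ H L := ⟨α + β, hαβ⟩ with hδ
    have hc : coordVec Δ δ = coordVec Δ α + coordVec Δ β := coordVec_add Δ rfl
    rw [← hc] at huvw huv
    have hxy := lie_ne_zero_of_add_isRoot hα hβ hαβ hx hy hx0 hy0
    have hxyz := lie_ne_zero_of_add_isRoot ((isRootVec_coordVec_iff Δ).1 huv) hγ
      ((rootSpace_add_ne_bot_iff Δ (hnz huvw)).2 huvw)
      (lie_mem_genWeightSpace_of_mem_genWeightSpace hx hy) hz hxy hz0
    have hxz : ⁅x, z⁆ ∈ rootSpace H (α + γ) :=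
      lie_mem_genWeightSpace_of_mem_genWeightSpace hx hz
    rw [not_not.1 fun h ↦ hno.1 ((rootSpace_add_ne_bot_iff Δ hne).1 h)] at hxz
    have hyz : ⁅y, z⁆ ∈ rootSpace H (β + γ) :=
      lie_mem_genWeightSpace_of_mem_genWeightSpace hy hz
    rw [not_not.1 fun h ↦ hno.2 ((rootSpace_add_ne_bot_iff Δ hne').1 h)] at hyz
    refine hxyz ?_
    rw [lie_lie, (LieSubmodule.mem_bot _).1 hxz, (LieSubmodule.mem_bot _).1 hyz, lie_zero, lie_zero,
      sub_zero]

end Coordinates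

/-! ### Admissibility of the bigrading determined by two sets of simple roots -/

section Bridge

open LieAlgebra LieAlgebra.IsKilling LieModule Module

variable {L : Type*} [LieRing L] [LieAlgebra ℂ L] [FiniteDimensional ℂ L] [IsKilling ℂ L]
  {H : LieSubalgebra ℂ L} [H.IsCartanSubalgebra] (Δ : (rootSystem H).Base)
  (S S₁ S₂ : Finset Δ.support)

/-- The sum of the coordinates of a weight at the simple roots in `S`, as an integer. -/
noncomputable def degree (α : Weight ℂ H L) : ℤ := ∑ i ∈ S, coordVec Δ α i

theorem multiplicity_eq_degree (α : Weight ℂ H L) :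
    multiplicity Δ S α.toLinear = degree Δ S α := by
  simp only [multiplicity, ← combination_coordVec Δ, toWeightBasis_repr_combination, degree,
    Int.cast_sum]

theorem degree_add {α β γ : Weight ℂ H L} (h : (γ : H → ℂ) = α + β) :
    degree Δ S γ = degree Δ S α + degree Δ S β := by
  rw [degree, coordVec_add Δ h, sum_add_eq]
  rfl

theorem degree_neg (α : Weight ℂ H L) : degree Δ S (-α) = -degree Δ S α := by
  rw [degree, coordVec_neg, sum_neg_eq]
  rfl

variable {S} in
theorem isNonZero_of_degree_ne_zero {α : Weight ℂ H L} (h : degree Δ S α ≠ 0) : α.IsNonZero := by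
  intro h0
  apply h
  rw [degree, (coordVec_eq_zero Δ).2 h0]
  simp

theorem degree_eq_zero_of_isZero {α : Weight ℂ H L} (h : α.IsZero) : degree Δ S α = 0 := by
  rw [degree, (coordVec_eq_zero Δ).2 h]
  simp

theorem ofSimpleRoots_eq_weightSum (p : ℤ × ℤ) : ofSimpleRoots Δ S₁ S₂ p =
    weightSum {α | degree Δ S₁ α = p.1 ∧ degree Δ S₂ α = p.2} := by
  simp only [ofSimpleRoots, weightSum, multiplicity_eq_degree, Int.cast_inj, Set.mem_ofPred_eq]

theorem gr_ofSimpleRoots (a : ℤ) :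
    gr (ofSimpleRoots Δ S₁ S₂) a = weightSum {α | degree Δ S₁ α = a} := by
  simp only [gr, ofSimpleRoots_eq_weightSum]
  rw [← weightSum_iUnion]
  congr 1
  ext α
  simp

theorem isBigrading_ofSimpleRoots : IsBigrading (ofSimpleRoots Δ S₁ S₂) where
  isInternal := by
    refine DirectSum.isInternal_submodule_of_iSupIndep_of_iSup_eq_top (fun p ↦ ?_) ?_
    · rw [ofSimpleRoots_eq_weightSum]
      refine (disjoint_weightSum (Set.disjoint_compl_right_iff_subset.2 subset_rfl)).mono_right
        (iSup₂_le fun q hq ↦ ?_)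
      rw [ofSimpleRoots_eq_weightSum, weightSum_le_weightSum]
      exact fun α h h' ↦ hq (Prod.ext (h.1.symm.trans h'.1) (h.2.symm.trans h'.2))
    · rw [iSup_congr (ofSimpleRoots_eq_weightSum Δ S₁ S₂), ← weightSum_iUnion,
        ← weightSum_univ (H := H)]
      congr 1
      ext α
      simp
  gradedBracket := ⟨fun {p q x y} hx hy ↦ by
    rw [ofSimpleRoots_eq_weightSum] at hx hy ⊢
    refine lie_mem_of_mem_weightSum (fun α hα β hβ u hu v hv ↦ ?_) hx hy
    have h := lie_mem_genWeightSpace_of_mem_genWeightSpace hu hv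
    by_cases h0 : genWeightSpace L (α + β : H → ℂ) = ⊥
    · rw [h0, LieSubmodule.mem_bot] at h
      simp [h]
    · refine rootSpace_le_weightSum (α := ⟨_, h0⟩) ?_ h
      simp only [Set.mem_ofPred_eq] at hα hβ ⊢
      rw [degree_add Δ S₁ rfl, hα.1, hβ.1, degree_add Δ S₂ rfl, hα.2, hβ.2]
      exact ⟨rfl, rfl⟩⟩

/-- The Levi kernel is the sum of the root spaces of bidegree `(0, ±1)`. -/
theorem leviKernel_ofSimpleRoots : leviKernel (ofSimpleRoots Δ S₁ S₂) =
    weightSum {α | degree Δ S₁ α = 0 ∧ (degree Δ S₂ α = 1 ∨ degree Δ S₂ α = -1)} := by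
  simp only [leviKernel, ofSimpleRoots_eq_weightSum, ← weightSum_union]
  congr 1
  ext α
  simp only [Set.mem_union, Set.mem_ofPred_eq]
  tauto

theorem gr_zero_ofSimpleRoots_iff : gr (ofSimpleRoots Δ S₁ S₂) 0 =
    ofSimpleRoots Δ S₁ S₂ (0, -1) ⊔ ofSimpleRoots Δ S₁ S₂ (0, 0) ⊔ ofSimpleRoots Δ S₁ S₂ (0, 1) ↔
    ∀ α : Weight ℂ H L, degree Δ S₁ α = 0 → degree Δ S₂ α = -1 ∨ degree Δ S₂ α = 0 ∨
      degree Δ S₂ α = 1 := by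
  simp only [gr_ofSimpleRoots, ofSimpleRoots_eq_weightSum, ← weightSum_union,
    weightSum_injective.eq_iff, Set.ext_iff, Set.mem_union, Set.mem_ofPred_eq]
  refine forall_congr' fun α ↦ ?_
  tauto

theorem gr_neg_one_ofSimpleRoots_iff : gr (ofSimpleRoots Δ S₁ S₂) (-1) =
    ofSimpleRoots Δ S₁ S₂ (-1, -1) ⊔ ofSimpleRoots Δ S₁ S₂ (-1, 0) ↔
    ∀ α : Weight ℂ H L, degree Δ S₁ α = -1 → degree Δ S₂ α = -1 ∨ degree Δ S₂ α = 0 := by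
  simp only [gr_ofSimpleRoots, ofSimpleRoots_eq_weightSum, ← weightSum_union,
    weightSum_injective.eq_iff, Set.ext_iff, Set.mem_union, Set.mem_ofPred_eq]
  refine forall_congr' fun α ↦ ?_
  tauto

theorem gr_neg_two_ofSimpleRoots_iff : gr (ofSimpleRoots Δ S₁ S₂) (-2) =
    ofSimpleRoots Δ S₁ S₂ (-2, -1) ↔
    ∀ α : Weight ℂ H L, degree Δ S₁ α = -2 → degree Δ S₂ α = -1 := by
  simp only [gr_ofSimpleRoots, ofSimpleRoots_eq_weightSum,
    weightSum_injective.eq_iff, Set.ext_iff, Set.mem_ofPred_eq]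
  refine forall_congr' fun α ↦ ?_
  tauto

theorem nondegenerate_ofSimpleRoots_iff :
    (∀ x ∈ gr (ofSimpleRoots Δ S₁ S₂) (-1),
      (∀ y ∈ gr (ofSimpleRoots Δ S₁ S₂) (-1), ⁅x, y⁆ = 0) → x = 0) ↔
    ∀ α : Weight ℂ H L, degree Δ S₁ α = -1 →
      ∃ β : Weight ℂ H L, degree Δ S₁ β = -1 ∧ rootSpace H (α + β) ≠ ⊥ := by
  have hnz : ∀ α ∈ {α : Weight ℂ H L | degree Δ S₁ α = -1}, α.IsNonZero := fun α hα ↦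
    isNonZero_of_degree_ne_zero Δ (S := S₁) (by rw [hα]; decide)
  rw [gr_ofSimpleRoots, forall_weightSum_iff hnz hnz]
  rfl

theorem injective_ofSimpleRoots_iff :
    (∀ x ∈ leviKernel (ofSimpleRoots Δ S₁ S₂),
      (∀ y ∈ gr (ofSimpleRoots Δ S₁ S₂) (-1), ⁅x, y⁆ = 0) → x = 0) ↔
    ∀ α : Weight ℂ H L, degree Δ S₁ α = 0 ∧ (degree Δ S₂ α = 1 ∨ degree Δ S₂ α = -1) →
      ∃ β : Weight ℂ H L, degree Δ S₁ β = -1 ∧ rootSpace H (α + β) ≠ ⊥ := by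
  have hnz : ∀ α ∈ {α : Weight ℂ H L | degree Δ S₁ α = -1}, α.IsNonZero := fun α hα ↦
    isNonZero_of_degree_ne_zero Δ (S := S₁) (by rw [hα]; decide)
  have hnz' : ∀ α ∈ {α : Weight ℂ H L | degree Δ S₁ α = 0 ∧
      (degree Δ S₂ α = 1 ∨ degree Δ S₂ α = -1)}, α.IsNonZero := fun α hα ↦
    isNonZero_of_degree_ne_zero Δ (S := S₂) (by rcases hα.2 with h | h <;> rw [h] <;> decide)
  rw [gr_ofSimpleRoots, leviKernel_ofSimpleRoots, forall_weightSum_iff hnz' hnz]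
  rfl

variable [DecidableEq Δ.support]

/-- Root spaces multiply: if `α`, `β` and `γ = α + β` are roots, a subalgebra which contains the
root spaces of `α` and `β` also contains the one of `γ`. -/
theorem rootSpace_le_of_add {α β γ : Weight ℂ H L} (hα : α.IsNonZero) (hβ : β.IsNonZero)
    (hγ : γ.IsNonZero) (h : (γ : H → ℂ) = α + β) {K : LieSubalgebra ℂ L}
    (hKα : (rootSpace H α).toSubmodule ≤ K.toSubmodule)
    (hKβ : (rootSpace H β).toSubmodule ≤ K.toSubmodule) :
    (rootSpace H γ).toSubmodule ≤ K.toSubmodule := by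
  obtain ⟨x, hx, hx0⟩ := α.exists_ne_zero
  obtain ⟨y, hy, hy0⟩ := β.exists_ne_zero
  have hne := lie_ne_zero_of_add_isRoot hα hβ (h ▸ γ.genWeightSpace_ne_bot) hx hy hx0 hy0
  have hmem : ⁅x, y⁆ ∈ rootSpace H γ := by
    rw [h]
    exact lie_mem_genWeightSpace_of_mem_genWeightSpace hx hy
  intro z hz
  obtain ⟨c, hc⟩ := (finrank_eq_one_iff_of_nonzero' (⟨_, hmem⟩ : rootSpace H γ)
    (by simpa [← Subtype.coe_ne_coe] using hne)).1 (finrank_rootSpace_eq_one γ hγ) ⟨z, hz⟩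
  have hz' : c • ⁅x, y⁆ = z := congrArg Subtype.val hc
  rw [← hz']
  exact K.smul_mem c (K.lie_mem (hKα hx) (hKβ hy))

/-- The negative part of the grading by multiplicities is generated by the component of
degree `-1`. -/
theorem lieSpan_weightSum_degree [LieAlgebra.IsSimple ℂ L] :
    (LieSubalgebra.lieSpan ℂ L
      (weightSum {α | degree Δ S α = -1} : Set L)).toSubmodule =
    weightSum {α | degree Δ S α < 0} := by
  have hA := isRootDatum_cartanMatrix Δ
  apply le_antisymm
  · let K : LieSubalgebra ℂ L :=
      { weightSum {α : Weight ℂ H L | degree Δ S α < 0} with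
        lie_mem' := fun {x y} hx hy ↦ by
          refine lie_mem_of_mem_weightSum (fun α hα β hβ u hu v hv ↦ ?_) hx hy
          have h := lie_mem_genWeightSpace_of_mem_genWeightSpace hu hv
          by_cases h0 : genWeightSpace L (α + β : H → ℂ) = ⊥
          · rw [h0, LieSubmodule.mem_bot] at h
            simp [h]
          · refine rootSpace_le_weightSum (α := ⟨_, h0⟩) ?_ h
            simp only [Set.mem_ofPred_eq] at hα hβ ⊢
            rw [degree_add Δ S rfl]
            omega }
    have hK : LieSubalgebra.lieSpan ℂ L (weightSum {α : Weight ℂ H L | degree Δ S α = -1} : Set L)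
        ≤ K := LieSubalgebra.lieSpan_le.2 <| weightSum_le_weightSum.2 fun α hα ↦ by
      simp only [Set.mem_ofPred_eq] at hα ⊢
      omega
    exact hK
  · set K := LieSubalgebra.lieSpan ℂ L (weightSum {α : Weight ℂ H L | degree Δ S α = -1} : Set L)
    have h1 {α : Weight ℂ H L} (hα : degree Δ S α = -1) :
        (rootSpace H α).toSubmodule ≤ K.toSubmodule :=
      (rootSpace_le_weightSum hα).trans LieSubalgebra.subset_lieSpan
    suffices ∀ n : ℕ, ∀ α : Weight ℂ H L, degree Δ S α = -(n + 1) →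
        (rootSpace H α).toSubmodule ≤ K.toSubmodule by
      refine weightSum_le.2 fun α hα ↦ this (-degree Δ S α - 1).toNat α ?_
      simp only [Set.mem_ofPred_eq] at hα
      omega
    intro n
    induction n with
    | zero => exact fun α hα ↦ h1 (by simpa using hα)
    | succ n ih =>
      intro α hα
      have hα0 := isNonZero_of_degree_ne_zero Δ (S := S) (α := α) (by omega)
      have hneg := degree_neg Δ S α
      obtain ⟨a, b, ha, hb, ha1, hb1, hab⟩ := hA.exists_add_eq_of_two_le (S := S)
        ((isRootVec_coordVec_iff Δ).2 (Weight.IsNonZero.neg hα0)) (by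
          change 2 ≤ degree Δ S (-α)
          push_cast at hα
          omega)
      obtain ⟨β, hβ, rfl⟩ := exists_coordVec_eq Δ ha
      obtain ⟨γ, hγ, rfl⟩ := exists_coordVec_eq Δ hb
      change degree Δ S β = degree Δ S (-α) - 1 at ha1
      change degree Δ S γ = 1 at hb1
      have hβn := degree_neg Δ S β
      have hγn := degree_neg Δ S γ
      push_cast at hα
      refine rootSpace_le_of_add hβ.neg hγ.neg hα0 ?_ (ih (-β) (by omega)) (h1 (by omega))
      have hsum : combination Δ (coordVec Δ β + coordVec Δ γ) = (-α).toLinear := by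
        rw [hab, combination_coordVec]
      rw [combination_add, combination_coordVec, combination_coordVec] at hsum
      ext x
      have hx : β x + γ x = -α x := DFunLike.congr_fun hsum x
      simp only [Weight.coe_neg, Pi.add_apply, Pi.neg_apply]
      linear_combination hx

theorem generated_ofSimpleRoots [LieAlgebra.IsSimple ℂ L] :
    (LieSubalgebra.lieSpan ℂ L (gr (ofSimpleRoots Δ S₁ S₂) (-1) : Set L)).toSubmodule =
      ⨆ (a : ℤ) (_ : a < 0), gr (ofSimpleRoots Δ S₁ S₂) a := by
  simp only [gr_ofSimpleRoots, lieSpan_weightSum_degree]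
  refine le_antisymm (weightSum_le.2 fun α hα ↦ ?_) (iSup₂_le fun a ha ↦ ?_)
  · exact (rootSpace_le_weightSum (I := {β | degree Δ S₁ β = degree Δ S₁ α}) rfl).trans
      (le_iSup₂_of_le (degree Δ S₁ α) hα le_rfl)
  · refine weightSum_le_weightSum.2 fun α hα ↦ ?_
    simp only [Set.mem_ofPred_eq] at hα ⊢
    omega

variable {Δ}

theorem rootSpace_add_ne_bot_iff_of_degree {S : Finset Δ.support} {α β : Weight ℂ H L}
    (h : degree Δ S α + degree Δ S β ≠ 0) :
    rootSpace H (α + β) ≠ ⊥ ↔ IsRootVec Δ.cartanMatrix (coordVec Δ α + coordVec Δ β) := by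
  refine rootSpace_add_ne_bot_iff Δ fun h0 ↦ h ?_
  have := sum_add_eq S (coordVec Δ α) (coordVec Δ β)
  rw [h0] at this
  simpa [degree] using this.symm

/-- A root vector is the negative of the coordinate vector of a root. The sign accounts for the
components of negative degree in the definition of admissibility. -/
theorem exists_neg_coordVec_eq {v : Δ.support → ℤ} (hv : IsRootVec Δ.cartanMatrix v) :
    ∃ α : Weight ℂ H L, α.IsNonZero ∧ -coordVec Δ α = v ∧
      ∀ S, degree Δ S α = -∑ i ∈ S, v i := by
  obtain ⟨α, hα, rfl⟩ := exists_coordVec_eq Δ hv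
  exact ⟨-α, hα.neg, by rw [coordVec_neg, neg_neg], fun S ↦ degree_neg Δ S α⟩

theorem isRootVec_neg_coordVec {α : Weight ℂ H L} (hα : α.IsNonZero) :
    IsRootVec Δ.cartanMatrix (-coordVec Δ α) ∧ ∀ S, ∑ i ∈ S, (-coordVec Δ α) i = -degree Δ S α :=
  ⟨((isRootVec_coordVec_iff Δ).2 hα).neg Δ.cartanMatrix_apply_same, fun S ↦ sum_neg_eq S _⟩

theorem IsAdmissible.isCombAdmissible {S₁ S₂ : Finset Δ.support}
    (h : IsAdmissible (ofSimpleRoots Δ S₁ S₂)) : IsCombAdmissible Δ.cartanMatrix S₁ S₂ where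
  zero v hv h0 := by
    obtain ⟨α, -, -, hαd⟩ := exists_neg_coordVec_eq hv
    have := (gr_zero_ofSimpleRoots_iff Δ S₁ S₂).1 h.gr_zero α (by rw [hαd]; omega)
    rw [hαd] at this
    omega
  one v hv h1 := by
    obtain ⟨α, -, -, hαd⟩ := exists_neg_coordVec_eq hv
    have := (gr_neg_one_ofSimpleRoots_iff Δ S₁ S₂).1 h.gr_neg_one α (by rw [hαd]; omega)
    rw [hαd] at this
    omega
  two v hv h2 := by
    obtain ⟨α, -, -, hαd⟩ := exists_neg_coordVec_eq hv
    have := (gr_neg_two_ofSimpleRoots_iff Δ S₁ S₂).1 h.gr_neg_two α (by rw [hαd]; omega)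
    rw [hαd] at this
    omega
  nondegenerate v hv h1 := by
    obtain ⟨α, -, rfl, hαd⟩ := exists_neg_coordVec_eq hv
    have hα1 : degree Δ S₁ α = -1 := by rw [hαd]; omega
    obtain ⟨β, hβ, hαβ⟩ := (nondegenerate_ofSimpleRoots_iff Δ S₁ S₂).1 h.nondegenerate α hα1
    have hβ0 := isRootVec_neg_coordVec (Δ := Δ)
      (isNonZero_of_degree_ne_zero Δ (S := S₁) (α := β) (by omega))
    refine ⟨-coordVec Δ β, hβ0.1, by rw [hβ0.2]; omega, ?_⟩
    rw [rootSpace_add_ne_bot_iff_of_degree (S := S₁) (by omega)] at hαβ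
    rw [← neg_add]
    exact hαβ.neg Δ.cartanMatrix_apply_same
  exists_root := by
    have hbot := h.leviKernel_ne_bot
    rw [leviKernel_ofSimpleRoots, ne_eq, weightSum_eq_bot, ← ne_eq,
      ← Set.nonempty_iff_ne_empty] at hbot
    obtain ⟨α, hα1, hα2⟩ := hbot
    have hα0 := isNonZero_of_degree_ne_zero Δ (S := S₂) (α := α) (by omega)
    rcases hα2 with h | h
    · exact ⟨_, (isRootVec_coordVec_iff Δ).2 hα0, hα1, h⟩
    · have hα0 := isRootVec_neg_coordVec (Δ := Δ) hα0
      exact ⟨_, hα0.1, by rw [hα0.2]; omega, by rw [hα0.2]; omega⟩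
  injective v hv h0 h2 := by
    obtain ⟨α, hα, rfl⟩ := exists_coordVec_eq Δ hv
    change degree Δ S₁ α = 0 at h0
    obtain ⟨β, hβ, hαβ⟩ := (injective_ofSimpleRoots_iff Δ S₁ S₂).1 h.injective α ⟨h0, h2⟩
    rw [rootSpace_add_ne_bot_iff_of_degree (S := S₁) (by omega)] at hαβ
    exact ⟨_, (isRootVec_coordVec_iff Δ).2
      (isNonZero_of_degree_ne_zero Δ (S := S₁) (by omega)), hβ, hαβ⟩

theorem IsCombAdmissible.isAdmissible [LieAlgebra.IsSimple ℂ L] {S₁ S₂ : Finset Δ.support}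
    (h : IsCombAdmissible Δ.cartanMatrix S₁ S₂) : IsAdmissible (ofSimpleRoots Δ S₁ S₂) where
  toIsBigrading := isBigrading_ofSimpleRoots Δ S₁ S₂
  gr_zero := (gr_zero_ofSimpleRoots_iff Δ S₁ S₂).2 fun α hα ↦ by
    by_cases hα0 : α.IsZero
    · exact .inr (.inl (degree_eq_zero_of_isZero Δ S₂ hα0))
    · have hr := isRootVec_neg_coordVec (Δ := Δ) hα0
      have h₁ := h.zero _ hr.1 (by rw [hr.2]; omega)
      have h₂ : degree Δ S₂ α ≤ 1 := h.zero _ ((isRootVec_coordVec_iff Δ).2 hα0) hα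
      rw [hr.2] at h₁
      omega
  gr_neg_one := (gr_neg_one_ofSimpleRoots_iff Δ S₁ S₂).2 fun α hα ↦ by
    have hr := isRootVec_neg_coordVec (Δ := Δ)
      (isNonZero_of_degree_ne_zero Δ (S := S₁) (α := α) (by omega))
    have := h.one _ hr.1 (by rw [hr.2]; omega)
    rw [hr.2] at this
    omega
  gr_neg_two := (gr_neg_two_ofSimpleRoots_iff Δ S₁ S₂).2 fun α hα ↦ by
    have hr := isRootVec_neg_coordVec (Δ := Δ)
      (isNonZero_of_degree_ne_zero Δ (S := S₁) (α := α) (by omega))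
    have := h.two _ hr.1 (by rw [hr.2]; omega)
    rw [hr.2] at this
    omega
  generated := generated_ofSimpleRoots Δ S₁ S₂
  nondegenerate := (nondegenerate_ofSimpleRoots_iff Δ S₁ S₂).2 fun α hα ↦ by
    have hr := isRootVec_neg_coordVec (Δ := Δ)
      (isNonZero_of_degree_ne_zero Δ (S := S₁) (α := α) (by omega))
    obtain ⟨w, hw, hw1, hvw⟩ := h.nondegenerate _ hr.1 (by rw [hr.2]; omega)
    obtain ⟨β, hβ, rfl, hβd⟩ := exists_neg_coordVec_eq hw
    have hβ1 : degree Δ S₁ β = -1 := by rw [hβd]; omega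
    refine ⟨β, hβ1, (rootSpace_add_ne_bot_iff_of_degree (S := S₁) (by omega)).2 ?_⟩
    have := hvw.neg Δ.cartanMatrix_apply_same
    rwa [neg_add, neg_neg, neg_neg] at this
  leviKernel_ne_bot := by
    rw [leviKernel_ofSimpleRoots, ne_eq, weightSum_eq_bot, ← ne_eq, ← Set.nonempty_iff_ne_empty]
    obtain ⟨v, hv, hv1, hv2⟩ := h.exists_root
    obtain ⟨α, -, rfl⟩ := exists_coordVec_eq Δ hv
    exact ⟨α, hv1, .inl hv2⟩
  injective := (injective_ofSimpleRoots_iff Δ S₁ S₂).2 fun α ⟨hα1, hα2⟩ ↦ by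
    obtain ⟨w, hw, hw1, hvw⟩ := h.injective _ ((isRootVec_coordVec_iff Δ).2
      (isNonZero_of_degree_ne_zero Δ (S := S₂) (α := α) (by omega))) hα1 hα2
    obtain ⟨β, -, rfl⟩ := exists_coordVec_eq Δ hw
    change degree Δ S₁ β = -1 at hw1
    exact ⟨β, hw1, (rootSpace_add_ne_bot_iff_of_degree (S := S₁) (by omega)).2 hvw⟩

variable (Δ)

/-- The bigrading determined by two sets of simple roots is admissible if and only if the pair of
sets is in the table. -/
theorem isAdmissible_ofSimpleRoots_iff [LieAlgebra.IsSimple ℂ L] :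
    IsAdmissible (ofSimpleRoots Δ S₁ S₂) ↔ InTable Δ S₁ S₂ :=
  (Iff.intro IsAdmissible.isCombAdmissible IsCombAdmissible.isAdmissible).trans
    (isRootDatum_cartanMatrix Δ).isCombAdmissible_iff_listed

end Bridge

/-! ### Gradings of Lie algebras with nondegenerate Killing form are inner -/

section Gradings

open LieAlgebra LieAlgebra.IsKilling LieModule Module DirectSum

variable {L : Type*} [LieRing L] [LieAlgebra ℂ L] {𝒢 : ℤ × ℤ → Submodule ℂ L}

/-- `E` is a grading element of `𝒢` for the additive function `φ` on bidegrees: it acts on the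
component of bidegree `p` as multiplication by `φ p`. -/
def IsGradingElement (𝒢 : ℤ × ℤ → Submodule ℂ L) (φ : ℤ × ℤ →+ ℤ) (E : L) : Prop :=
  ∀ p, ∀ x ∈ 𝒢 p, ⁅E, x⁆ = (φ p : ℂ) • x

variable [Decomposition 𝒢]

/-- The linear map which multiplies the component of bidegree `p` by `φ p`. -/
def degreeMap (𝒢 : ℤ × ℤ → Submodule ℂ L) [Decomposition 𝒢] (φ : ℤ × ℤ →+ ℤ) : L →ₗ[ℂ] L :=
  (DirectSum.toModule ℂ _ L fun p ↦ (φ p : ℂ) • (𝒢 p).subtype) ∘ₗ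
    (decomposeLinearEquiv 𝒢).toLinearMap

theorem degreeMap_apply (φ : ℤ × ℤ →+ ℤ) {p : ℤ × ℤ} {x : L} (hx : x ∈ 𝒢 p) :
    degreeMap 𝒢 φ x = (φ p : ℂ) • x := by
  lift x to 𝒢 p using hx
  simp only [degreeMap, LinearMap.comp_apply, LinearEquiv.coe_coe, decomposeLinearEquiv_apply_coe]
  rw [toModule_lof]
  simp

/-- The map `degreeMap 𝒢 φ` is a derivation, hence inner. -/
theorem exists_isGradingElement [FiniteDimensional ℂ L] [IsKilling ℂ L]
    (h : SetLike.GradedBracket 𝒢) (φ : ℤ × ℤ →+ ℤ) : ∃ E, IsGradingElement 𝒢 φ E := by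
  have leibniz (a b : L) : degreeMap 𝒢 φ ⁅a, b⁆ = ⁅a, degreeMap 𝒢 φ b⁆ - ⁅b, degreeMap 𝒢 φ a⁆ := by
    induction a using Decomposition.inductionOn 𝒢 with
    | zero => simp
    | add a a' ha ha' =>
      rw [add_lie, map_add, ha, ha', add_lie, map_add, lie_add]
      abel
    | @homogeneous p a =>
      induction b using Decomposition.inductionOn 𝒢 with
      | zero => simp
      | add b b' hb hb' =>
        rw [lie_add, map_add, hb, hb', add_lie, map_add, lie_add]
        abel
      | @homogeneous q b =>
        rw [degreeMap_apply φ (h.bracket_mem a.2 b.2), degreeMap_apply φ a.2,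
          degreeMap_apply φ b.2, lie_smul, lie_smul, ← lie_skew (b : L), smul_neg, sub_neg_eq_add,
          ← add_smul, map_add, Int.cast_add, add_comm]
  obtain ⟨E, hE⟩ := LieDerivation.IsKilling.exists_eq_ad
    ({ toLinearMap := degreeMap 𝒢 φ, leibniz' := leibniz } : LieDerivation ℂ L L)
  refine ⟨E, fun p x hx ↦ ?_⟩
  rw [← degreeMap_apply φ hx]
  have hEx := DFunLike.congr_fun hE x
  rwa [LieDerivation.ad_apply_apply] at hEx

variable {φ : ℤ × ℤ →+ ℤ} {E : L}

theorem IsGradingElement.decompose_lie (hE : IsGradingElement 𝒢 φ E) (x : L) (p : ℤ × ℤ) :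
    (decompose 𝒢 ⁅E, x⁆ p : L) = (φ p : ℂ) • (decompose 𝒢 x p : L) := by
  induction x using Decomposition.inductionOn 𝒢 with
  | zero => simp
  | add x y hx hy => simp [lie_add, decompose_add, hx, hy]
  | @homogeneous q x =>
    rw [hE q x x.2]
    by_cases hpq : q = p
    · subst hpq
      rw [decompose_of_mem_same 𝒢 ((𝒢 q).smul_mem _ x.2), decompose_of_mem_same 𝒢 x.2]
    · rw [decompose_of_mem_ne 𝒢 ((𝒢 q).smul_mem _ x.2) hpq, decompose_of_mem_ne 𝒢 x.2 hpq,
        smul_zero]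

theorem mem_of_decompose_eq_zero {x : L} {q : ℤ × ℤ}
    (h : ∀ p ≠ q, (decompose 𝒢 x p : L) = 0) : x ∈ 𝒢 q := by
  classical
  rw [← sum_support_decompose 𝒢 x]
  refine Submodule.sum_mem _ fun p hp ↦ ?_
  by_cases hpq : p = q
  · exact hpq ▸ (decompose 𝒢 x p).2
  · rw [h p hpq]
    exact Submodule.zero_mem _

/-- The centralizer of the two grading elements is the component of bidegree `0`. -/
theorem mem_zero_of_lie_mem {E₁ E₂ : L} (h₁ : IsGradingElement 𝒢 (AddMonoidHom.fst ℤ ℤ) E₁)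
    (h₂ : IsGradingElement 𝒢 (AddMonoidHom.snd ℤ ℤ) E₂) {x : L} (hx₁ : ⁅E₁, x⁆ ∈ 𝒢 0)
    (hx₂ : ⁅E₂, x⁆ ∈ 𝒢 0) : x ∈ 𝒢 0 := by
  refine mem_of_decompose_eq_zero fun p hp ↦ ?_
  have e₁ := h₁.decompose_lie x p
  have e₂ := h₂.decompose_lie x p
  rw [decompose_of_mem_ne 𝒢 hx₁ hp.symm] at e₁
  rw [decompose_of_mem_ne 𝒢 hx₂ hp.symm] at e₂
  by_contra h0
  have z₁ := (smul_eq_zero.1 e₁.symm).resolve_right h0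
  have z₂ := (smul_eq_zero.1 e₂.symm).resolve_right h0
  exact hp (Prod.ext (by exact_mod_cast z₁) (by exact_mod_cast z₂))

/-- An eigenvector of both grading elements is homogeneous. -/
theorem exists_mem_of_lie_eq_smul {E₁ E₂ : L}
    (h₁ : IsGradingElement 𝒢 (AddMonoidHom.fst ℤ ℤ) E₁)
    (h₂ : IsGradingElement 𝒢 (AddMonoidHom.snd ℤ ℤ) E₂) {x : L} {c₁ c₂ : ℂ}
    (hx₁ : ⁅E₁, x⁆ = c₁ • x) (hx₂ : ⁅E₂, x⁆ = c₂ • x) (hx : x ≠ 0) :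
    ∃ p : ℤ × ℤ, c₁ = p.1 ∧ c₂ = p.2 := by
  obtain ⟨p, hp⟩ : ∃ p, (decompose 𝒢 x p : L) ≠ 0 := by
    by_contra! h
    have h0 := mem_of_decompose_eq_zero (q := 0) fun p _ ↦ h p
    rw [← decompose_of_mem_same 𝒢 h0] at hx
    exact hx (h 0)
  have e₁ := h₁.decompose_lie x p
  have e₂ := h₂.decompose_lie x p
  rw [hx₁, decompose_smul] at e₁
  rw [hx₂, decompose_smul] at e₂
  exact ⟨p, smul_left_injective ℂ hp e₁, smul_left_injective ℂ hp e₂⟩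

theorem mem_of_lie_eq_smul {E₁ E₂ : L}
    (h₁ : IsGradingElement 𝒢 (AddMonoidHom.fst ℤ ℤ) E₁)
    (h₂ : IsGradingElement 𝒢 (AddMonoidHom.snd ℤ ℤ) E₂) {x : L} {p : ℤ × ℤ}
    (hx₁ : ⁅E₁, x⁆ = (p.1 : ℂ) • x) (hx₂ : ⁅E₂, x⁆ = (p.2 : ℂ) • x) : x ∈ 𝒢 p := by
  refine mem_of_decompose_eq_zero fun q hq ↦ ?_
  by_contra h0
  have e₁ := h₁.decompose_lie x q
  have e₂ := h₂.decompose_lie x q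
  rw [hx₁, decompose_smul] at e₁
  rw [hx₂, decompose_smul] at e₂
  have z₁ := smul_left_injective ℂ h0 e₁
  have z₂ := smul_left_injective ℂ h0 e₂
  exact hq (Prod.ext (by exact_mod_cast z₁.symm) (by exact_mod_cast z₂.symm))

/-- Grading elements commute, as their bracket acts as `0` and the center is trivial. -/
theorem lie_eq_zero_of_isGradingElement [FiniteDimensional ℂ L] [IsKilling ℂ L] {ψ : ℤ × ℤ →+ ℤ}
    {E' : L} (h : IsGradingElement 𝒢 φ E) (h' : IsGradingElement 𝒢 ψ E') : ⁅E, E'⁆ = 0 := by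
  have had : ∀ x : L, ⁅⁅E, E'⁆, x⁆ = 0 := fun x ↦ by
    induction x using Decomposition.inductionOn 𝒢 with
    | zero => simp
    | add x y hx hy => rw [lie_add, hx, hy, add_zero]
    | @homogeneous p x =>
      rw [lie_lie, h' p x x.2, h p x x.2, lie_smul, lie_smul, h' p x x.2, h p x x.2, smul_comm,
        sub_self]
  have hc : ⁅E, E'⁆ ∈ LieAlgebra.center ℂ L := by
    rw [LieModule.mem_maxTrivSubmodule]
    intro x
    rw [← lie_skew, had, neg_zero]
  rwa [LieAlgebra.center_eq_bot, LieSubmodule.mem_bot] at hc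

/-- There is a Cartan subalgebra which contains both grading elements: a Cartan subalgebra of their
centralizer, the subalgebra of bidegree `0`. -/
theorem exists_isCartanSubalgebra_mem [FiniteDimensional ℂ L] [IsKilling ℂ L]
    (h : SetLike.GradedBracket 𝒢) {E₁ E₂ : L}
    (h₁ : IsGradingElement 𝒢 (AddMonoidHom.fst ℤ ℤ) E₁)
    (h₂ : IsGradingElement 𝒢 (AddMonoidHom.snd ℤ ℤ) E₂) :
    ∃ H : LieSubalgebra ℂ L, H.IsCartanSubalgebra ∧ E₁ ∈ H ∧ E₂ ∈ H := by
  have h0 {x : L} (hx₁ : ⁅E₁, x⁆ = 0) (hx₂ : ⁅E₂, x⁆ = 0) : x ∈ 𝒢 0 :=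
    mem_zero_of_lie_mem h₁ h₂ (hx₁ ▸ Submodule.zero_mem _) (hx₂ ▸ Submodule.zero_mem _)
  have hE₁ : E₁ ∈ 𝒢 0 := h0 (lie_self _) (lie_eq_zero_of_isGradingElement h₂ h₁)
  have hE₂ : E₂ ∈ 𝒢 0 := h0 (lie_eq_zero_of_isGradingElement h₁ h₂) (lie_self _)
  let K : LieSubalgebra ℂ L :=
    { 𝒢 0 with
      lie_mem' := fun {x y} hx hy ↦ by
        have := h.bracket_mem hx hy
        rwa [add_zero] at this }
  have hK {x : L} : x ∈ K ↔ x ∈ 𝒢 0 := Iff.rfl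
  obtain ⟨z, hz⟩ := exists_isCartanSubalgebra_engel ℂ K
  set H₀ := LieSubalgebra.engel ℂ z with hH₀
  let f : H₀ →ₗ⁅ℂ⁆ L := K.incl.comp H₀.incl
  have hf {x : L} : x ∈ f.range ↔ ∃ hx : x ∈ K, (⟨x, hx⟩ : K) ∈ H₀ := by
    constructor
    · rintro ⟨⟨⟨y, hy⟩, hy'⟩, rfl⟩
      exact ⟨hy, hy'⟩
    · rintro ⟨hx, hx'⟩
      exact ⟨⟨⟨x, hx⟩, hx'⟩, rfl⟩
  -- The grading elements are central in `K`, so that they normalize the Cartan subalgebra of `K`.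
  have hmem {E : L} {φ : ℤ × ℤ →+ ℤ} (hE : IsGradingElement 𝒢 φ E) (hE0 : E ∈ 𝒢 0) :
      E ∈ f.range := by
    refine hf.2 ⟨hE0, ?_⟩
    rw [← hz.self_normalizing, LieSubalgebra.mem_normalizer_iff]
    intro y hy
    have : ⁅(⟨E, hE0⟩ : K), y⁆ = 0 := Subtype.ext (by
      have := hE 0 y y.2
      rw [map_zero, Int.cast_zero, zero_smul] at this
      exact this)
    rw [this]
    exact H₀.zero_mem
  refine ⟨f.range, ⟨?_, ?_⟩, hmem h₁ hE₁, hmem h₂ hE₂⟩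
  · have := hz.nilpotent
    exact f.isNilpotent_range
  · refine le_antisymm (fun x hx ↦ ?_) (LieSubalgebra.le_normalizer _)
    rw [LieSubalgebra.mem_normalizer_iff] at hx
    have hx' {E : L} (hE : E ∈ f.range) : ⁅E, x⁆ ∈ 𝒢 0 := by
      rw [← lie_skew]
      exact Submodule.neg_mem _ (hf.1 (hx E hE)).1
    have hx0 : x ∈ K := mem_zero_of_lie_mem h₁ h₂ (hx' (hmem h₁ hE₁)) (hx' (hmem h₂ hE₂))
    refine hf.2 ⟨hx0, ?_⟩
    rw [← hz.self_normalizing, LieSubalgebra.mem_normalizer_iff]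
    intro y hy
    obtain ⟨_, hxy⟩ := hf.1 (hx y (hf.2 ⟨y.2, hy⟩))
    exact hxy

end Gradings

/-! ### Bases adapted to two additive functions -/

section LexBase

open Set IsAddIndecomposable Module

variable {ι R M N : Type*} [Finite ι] [Field R] [CharZero R] [AddCommGroup M] [Module R M]
  [AddCommGroup N] [Module R N] (P : RootPairing ι R M N)

omit [CharZero R] in
/-- For `K` large, the sign of `K f + g` at the roots is the sign of `f`, or the sign of `g` where
`f` vanishes. -/
theorem exists_lex (f g : M →+ ℚ) (hfg : ∀ i, f (P.root i) = 0 → g (P.root i) ≠ 0) :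
    ∃ h : M →+ ℚ, ∀ i, h (P.root i) ≠ 0 ∧
      (0 < h (P.root i) → 0 < f (P.root i) ∨ f (P.root i) = 0 ∧ 0 < g (P.root i)) := by
  have := Fintype.ofFinite ι
  set K : ℚ := ∑ i, |g (P.root i)| / |f (P.root i)| + 1 with hK
  have hKi (i : ι) (hi : f (P.root i) ≠ 0) : |g (P.root i)| < K * |f (P.root i)| := by
    have h₁ : |g (P.root i)| / |f (P.root i)| ≤ ∑ i, |g (P.root i)| / |f (P.root i)| :=
      Finset.single_le_sum (f := fun i ↦ |g (P.root i)| / |f (P.root i)|)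
        (fun _ _ ↦ by positivity) (Finset.mem_univ i)
    rw [← div_lt_iff₀ (abs_pos.2 hi)]
    linarith
  refine ⟨K • f + g, fun i ↦ ?_⟩
  have hval : (K • f + g) (P.root i) = K * f (P.root i) + g (P.root i) := rfl
  rw [hval]
  rcases lt_trichotomy (f (P.root i)) 0 with hi | hi | hi
  · have := hKi i hi.ne
    rw [abs_of_neg hi] at this
    have hneg : K * f (P.root i) + g (P.root i) < 0 := by
      have := le_abs_self (g (P.root i))
      linarith
    exact ⟨hneg.ne, fun h ↦ absurd h hneg.not_gt⟩
  · rw [hi, mul_zero, zero_add]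
    exact ⟨hfg i hi, fun h ↦ .inr ⟨rfl, h⟩⟩
  · have := hKi i hi.ne'
    rw [abs_of_pos hi] at this
    have hpos : 0 < K * f (P.root i) + g (P.root i) := by
      have := neg_abs_le (g (P.root i))
      linarith
    exact ⟨hpos.ne', fun _ ↦ .inl hi⟩

/-- There is a base whose simple roots are nonnegative for the lexicographic order given by two
additive functions. -/
theorem exists_base_lex [P.IsRootSystem] [P.IsCrystallographic] [P.IsReduced] (f₁ f₂ : M →+ ℚ) :
    ∃ b : P.Base, ∀ i ∈ b.support,
      0 < f₁ (P.root i) ∨ f₁ (P.root i) = 0 ∧ 0 ≤ f₂ (P.root i) := by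
  let _i : Module ℚ M := Module.compHom M (algebraMap ℚ R)
  obtain ⟨f₀, hf₀⟩ : ∃ f : Dual ℚ M, ∀ i, f (P.root i) ≠ 0 :=
    exists_dual_forall_apply_ne_zero P.root <| by simp [P.ne_zero]
  obtain ⟨h₂, hh₂⟩ := exists_lex P f₂ (f₀ : M →+ ℚ) fun i _ ↦ hf₀ i
  obtain ⟨h₁, hh₁⟩ := exists_lex P f₁ h₂ fun i _ ↦ (hh₂ i).1
  let := P.indexNeg
  refine ⟨RootPairing.Base.mk' P (baseOf P.root h₁)
    (P.linearIndepOn_root_baseOf h₁ fun i ↦ (hh₁ i).1)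
    (fun i ↦ mem_or_neg_mem_closure_baseOf P.root h₁ i (hh₁ i).1 (by simp)), fun i hi ↦ ?_⟩
  have hi' : i ∈ baseOf P.root h₁ := by simpa [RootPairing.Base.mk'] using hi
  have hpos : 0 < h₁ (P.root i) := hi'.1
  rcases (hh₁ i).2 hpos with h | ⟨h, h'⟩
  · exact .inl h
  · refine .inr ⟨h, ?_⟩
    rcases (hh₂ i).2 h' with h | h
    · exact h.le
    · exact h.1.ge

end LexBase

section Adapted

open LieAlgebra LieAlgebra.IsKilling LieModule Module

variable {L : Type*} [LieRing L] [LieAlgebra ℂ L] [FiniteDimensional ℂ L] [IsKilling ℂ L]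
  {H : LieSubalgebra ℂ L} [H.IsCartanSubalgebra]

/-- The version of `exists_base_lex` for the values of the roots at two elements of the Cartan
subalgebra where they are integers. -/
theorem exists_base_lex_of_apply {E₁ E₂ : H} {d₁ d₂ : Weight ℂ H L → ℤ}
    (h₁ : ∀ α, α E₁ = (d₁ α : ℂ)) (h₂ : ∀ α, α E₂ = (d₂ α : ℂ)) :
    ∃ Δ : (rootSystem H).Base, ∀ i : Δ.support,
      0 < d₁ i.1.1 ∨ d₁ i.1.1 = 0 ∧ 0 ≤ d₂ i.1.1 := by
  -- A `ℚ`-linear projection of `ℂ` onto `ℚ` turns evaluations into rational functionals.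
  obtain ⟨π, hπ⟩ := (Algebra.linearMap ℚ ℂ).exists_leftInverse_of_injective
    (LinearMap.ker_eq_bot.2 (algebraMap ℚ ℂ).injective)
  have hπn (n : ℤ) : π n = n := by
    have := LinearMap.congr_fun hπ (n : ℚ)
    simpa using this
  let ev (E : H) : Dual ℂ H →+ ℚ :=
    { toFun := fun φ ↦ π (φ E), map_zero' := by simp, map_add' := by simp }
  obtain ⟨Δ, hΔ⟩ := exists_base_lex (rootSystem H) (ev E₁) (ev E₂)
  refine ⟨Δ, fun i ↦ ?_⟩
  have hev₁ : ev E₁ ((rootSystem H).root i) = d₁ i.1.1 := by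
    change π (i.1.1 E₁) = _
    rw [h₁, hπn]
  have hev₂ : ev E₂ ((rootSystem H).root i) = d₂ i.1.1 := by
    change π (i.1.1 E₂) = _
    rw [h₂, hπn]
  have := hΔ i i.2
  rw [hev₁, hev₂] at this
  exact_mod_cast this

end Adapted

/-! ### Admissible bigradings are determined by simple roots -/

section Standard

open LieAlgebra LieAlgebra.IsKilling LieModule Module

variable {L : Type*} [LieRing L] [LieAlgebra ℂ L] {𝒢 : ℤ × ℤ → Submodule ℂ L}

variable [FiniteDimensional ℂ L] [IsKilling ℂ L]

/-- A bigrading of a Lie algebra with nondegenerate Killing form is compatible with the weight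
space decomposition of some Cartan subalgebra: the bidegrees of the weights are their values at two
grading elements. -/
theorem IsBigrading.exists_weight_degrees (h : IsBigrading 𝒢) :
    ∃ (H : LieSubalgebra ℂ L) (_ : H.IsCartanSubalgebra) (E₁ E₂ : H)
      (d₁ d₂ : Weight ℂ H L → ℤ), (∀ α, α E₁ = (d₁ α : ℂ)) ∧ (∀ α, α E₂ = (d₂ α : ℂ)) ∧
        ∀ p : ℤ × ℤ, 𝒢 p = weightSum {α | d₁ α = p.1 ∧ d₂ α = p.2} := by
  let := h.isInternal.chooseDecomposition
  obtain ⟨E₁, hE₁⟩ := exists_isGradingElement h.gradedBracket (AddMonoidHom.fst ℤ ℤ)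
  obtain ⟨E₂, hE₂⟩ := exists_isGradingElement h.gradedBracket (AddMonoidHom.snd ℤ ℤ)
  obtain ⟨H, hH, hm₁, hm₂⟩ := exists_isCartanSubalgebra_mem h.gradedBracket hE₁ hE₂
  have hlie {α : Weight ℂ H L} {x : L} (hx : x ∈ rootSpace H α) {E : L} (hE : E ∈ H) :
      ⁅E, x⁆ = α ⟨E, hE⟩ • x := lie_eq_smul_of_mem_rootSpace hx ⟨E, hE⟩
  have hd (α : Weight ℂ H L) : ∃ p : ℤ × ℤ, α ⟨E₁, hm₁⟩ = p.1 ∧ α ⟨E₂, hm₂⟩ = p.2 := by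
    obtain ⟨x, hx, hx0⟩ := α.exists_ne_zero
    exact exists_mem_of_lie_eq_smul hE₁ hE₂ (hlie hx hm₁) (hlie hx hm₂) hx0
  choose d hd₁ hd₂ using hd
  refine ⟨H, hH, ⟨E₁, hm₁⟩, ⟨E₂, hm₂⟩, fun α ↦ (d α).1, fun α ↦ (d α).2, hd₁, hd₂, fun p ↦ ?_⟩
  have hle : (fun p : ℤ × ℤ ↦ weightSum {α | (d α).1 = p.1 ∧ (d α).2 = p.2}) ≤ 𝒢 := by
    refine fun p ↦ weightSum_le.2 fun α hα x hx ↦ mem_of_lie_eq_smul hE₁ hE₂ ?_ ?_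
    · rw [hlie hx hm₁, hd₁, hα.1]
    · rw [hlie hx hm₂, hd₂, hα.2]
  have htop : ⨆ p : ℤ × ℤ, weightSum {α | (d α).1 = p.1 ∧ (d α).2 = p.2} = ⊤ := by
    rw [← weightSum_iUnion, ← weightSum_univ (H := H)]
    congr 1
    ext α
    simp
  exact (congrFun ((h.isInternal.submodule_iSupIndep.le_iff_eq_of_iSup_eq_top htop).1 hle) p).symm

variable {H : LieSubalgebra ℂ L} [H.IsCartanSubalgebra] (Δ : (rootSystem H).Base)

/-- The value of a weight at an element of the Cartan subalgebra, in terms of its coordinates. -/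
theorem apply_eq_sum_coordVec {E : H} {d : Weight ℂ H L → ℤ} (h : ∀ α, α E = (d α : ℂ))
    (α : Weight ℂ H L) : d α = ∑ i, coordVec Δ α i * d i.1.1 := by
  have h₁ := LinearMap.congr_fun (combination_coordVec Δ α) E
  have h₂ : (Weight.toLinear ℂ H L α) E = (d α : ℂ) := h α
  rw [h₂, combination, LinearMap.sum_apply] at h₁
  have h₃ (i : Δ.support) : (coordVec Δ α i • (rootSystem H).root i) E =
      ((coordVec Δ α i * d i.1.1 : ℤ) : ℂ) := by
    rw [LinearMap.smul_apply, rootSystem_root_apply, Weight.toLinear_apply, h, zsmul_eq_mul]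
    push_cast
    rfl
  simp only [h₃] at h₁
  exact_mod_cast h₁.symm

/-- A simple root whose degree is at least `2` is not a sum of roots of positive degree, so that
its negative is missing in the subalgebra generated by the component of degree `-1`. -/
theorem le_one_of_generated {E : H} {d : Weight ℂ H L → ℤ} (h : ∀ α, α E = (d α : ℂ))
    (hΔ : ∀ i : Δ.support, 0 ≤ d i.1.1)
    (hgen : weightSum {α | d α < 0} ≤
      (LieSubalgebra.lieSpan ℂ L (weightSum {α | d α = -1} : Set L)).toSubmodule)
    (i : Δ.support) : d i.1.1 ≤ 1 := by
  classical
  by_contra! hi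
  have hsum := apply_eq_sum_coordVec Δ h
  have hneg (α : Weight ℂ H L) : d (-α) = -d α := by
    have h₁ := h (-α)
    rw [Weight.coe_neg, Pi.neg_apply, h] at h₁
    exact_mod_cast h₁.symm
  have hpos {α : Weight ℂ H L} (hα : d α < 0) :
      0 ≤ coordVec Δ (-α) ∧ coordVec Δ (-α) ≠ 0 := by
    have hα0 : (-α).IsNonZero := fun h0 ↦ by
      have h₁ := hsum (-α)
      rw [(coordVec_eq_zero Δ).2 h0, hneg] at h₁
      simp at h₁
      omega
    refine ⟨(nonneg_or_nonpos_of_isRootVec Δ ((isRootVec_coordVec_iff Δ).2 hα0)).resolve_right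
      fun hle ↦ ?_, fun h0 ↦ hα0 ((coordVec_eq_zero Δ).1 h0)⟩
    have h₁ := hsum (-α)
    have h₂ : ∑ i, coordVec Δ (-α) i * d i.1.1 ≤ 0 :=
      Finset.sum_nonpos fun i _ ↦ mul_nonpos_of_nonpos_of_nonneg (hle i) (hΔ i)
    rw [hneg] at h₁
    omega
  -- the other root spaces of negative degree span a subalgebra, since `α_i` is not a sum of two
  -- positive roots
  set I : Set (Weight ℂ H L) := {α | d α < 0 ∧ α ≠ -i.1.1} with hI
  let K : LieSubalgebra ℂ L :=
    { weightSum I with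
      lie_mem' := fun {x y} hx hy ↦ by
        refine lie_mem_of_mem_weightSum (fun α hα β hβ u hu v hv ↦ ?_) hx hy
        have huv := lie_mem_genWeightSpace_of_mem_genWeightSpace hu hv
        by_cases h0 : genWeightSpace L (α + β : H → ℂ) = ⊥
        · rw [h0, LieSubmodule.mem_bot] at huv
          simp [huv]
        · set γ : Weight ℂ H L := ⟨α + β, h0⟩ with hγ
          have hγd : d γ = d α + d β := by
            have h₁ := h γ
            rw [hγ, Weight.coe_weight_mk, Pi.add_apply, h, h] at h₁
            exact_mod_cast h₁.symm
          suffices hγI : γ ∈ I from rootSpace_le_weightSum hγI huv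
          refine ⟨?_, fun hγi ↦ ?_⟩
          · have := hα.1
            have := hβ.1
            omega
          · obtain ⟨hα₁, hα₂⟩ := hpos hα.1
            obtain ⟨hβ₁, hβ₂⟩ := hpos hβ.1
            have hc : coordVec Δ (-α) + coordVec Δ (-β) = Pi.single i 1 := by
              rw [coordVec_neg, coordVec_neg, ← neg_add, ← coordVec_add Δ (γ := γ) rfl, hγi,
                coordVec_neg, neg_neg, coordVec_eq_iff, combination_single]
              rfl
            have hcj (j : Δ.support) : coordVec Δ (-α) j + coordVec Δ (-β) j =
                (Pi.single i 1 : Δ.support → ℤ) j := congrFun hc j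
            have hzero : ∀ j ≠ i, coordVec Δ (-α) j = 0 ∧ coordVec Δ (-β) j = 0 := fun j hj ↦ by
              have h₁ := hcj j
              rw [Pi.single_eq_of_ne hj] at h₁
              have h₂ : 0 ≤ coordVec Δ (-α) j := hα₁ j
              have h₃ : 0 ≤ coordVec Δ (-β) j := hβ₁ j
              omega
            have hi₁ := hcj i
            rw [Pi.single_eq_same] at hi₁
            have h₂ : 0 ≤ coordVec Δ (-α) i := hα₁ i
            have h₃ : 0 ≤ coordVec Δ (-β) i := hβ₁ i
            rcases (by omega : coordVec Δ (-α) i = 0 ∨ coordVec Δ (-β) i = 0) with h₄ | h₄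
            · refine hα₂ (funext fun j ↦ ?_)
              by_cases hj : j = i
              · rw [hj, h₄, Pi.zero_apply]
              · exact (hzero j hj).1
            · refine hβ₂ (funext fun j ↦ ?_)
              by_cases hj : j = i
              · rw [hj, h₄, Pi.zero_apply]
              · exact (hzero j hj).2 }
  have hK : LieSubalgebra.lieSpan ℂ L (weightSum {α : Weight ℂ H L | d α = -1} : Set L) ≤ K := by
    refine LieSubalgebra.lieSpan_le.2 (weightSum_le_weightSum.2 fun α hα ↦ ⟨?_, fun hαi ↦ ?_⟩)
    · simp only [Set.mem_ofPred_eq] at hα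
      omega
    · simp only [Set.mem_ofPred_eq] at hα
      rw [hαi, hneg] at hα
      omega
  have hle : weightSum {α : Weight ℂ H L | d α < 0} ≤ weightSum I := hgen.trans hK
  have hmem : -i.1.1 ∈ {α : Weight ℂ H L | d α < 0} := by
    simp only [Set.mem_ofPred_eq, hneg]
    omega
  exact (weightSum_le_weightSum.1 hle hmem).2 rfl

variable {Δ} in
/-- A weight function given by an element of the Cartan subalgebra, with values `0` and `1` at the
simple roots, is the sum of the coordinates over the simple roots with value `1`. -/
theorem degree_eq_of_forall [DecidableEq Δ.support] {E : H} {d : Weight ℂ H L → ℤ}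
    (h : ∀ α, α E = (d α : ℂ)) {S : Finset Δ.support}
    (hS : ∀ i : Δ.support, d i.1.1 = if i ∈ S then 1 else 0) (α : Weight ℂ H L) :
    degree Δ S α = d α := by
  rw [apply_eq_sum_coordVec Δ h, degree]
  simp only [hS, mul_ite, mul_one, mul_zero, Finset.sum_ite_mem, Finset.univ_inter]

/-- The choice of a base adapted to the bidegrees shows that an admissible bigrading is determined
by two sets of simple roots. -/
theorem IsAdmissible.exists_eq_ofSimpleRoots (h : IsAdmissible 𝒢) :
    ∃ (H : LieSubalgebra ℂ L) (_ : H.IsCartanSubalgebra) (Δ : (rootSystem H).Base)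
      (S₁ S₂ : Finset Δ.support), 𝒢 = ofSimpleRoots Δ S₁ S₂ := by
  classical
  obtain ⟨H, hH, E₁, E₂, d₁, d₂, hd₁, hd₂, h𝒢⟩ := h.toIsBigrading.exists_weight_degrees
  have hgr (a : ℤ) : gr 𝒢 a = weightSum {α | d₁ α = a} := by
    simp only [gr, h𝒢]
    rw [← weightSum_iUnion]
    congr 1
    ext α
    simp
  obtain ⟨Δ, hΔ⟩ := exists_base_lex_of_apply hd₁ hd₂
  have hneg {E : H} {d : Weight ℂ H L → ℤ} (h : ∀ α, α E = (d α : ℂ)) (α : Weight ℂ H L) :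
      d (-α) = -d α := by
    have h₁ := h (-α)
    rw [Weight.coe_neg, Pi.neg_apply, h] at h₁
    exact_mod_cast h₁.symm
  have hgen : weightSum {α | d₁ α < 0} ≤
      (LieSubalgebra.lieSpan ℂ L (weightSum {α | d₁ α = -1} : Set L)).toSubmodule := by
    rw [← hgr, h.generated]
    refine weightSum_le.2 fun α hα ↦ ?_
    refine le_iSup₂_of_le (d₁ α) hα ?_
    rw [hgr]
    exact rootSpace_le_weightSum rfl
  have hle (i : Δ.support) : d₁ i.1.1 ≤ 1 :=
    le_one_of_generated Δ hd₁ (fun i ↦ by have := hΔ i; omega) hgen i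
  have hd₁' (i : Δ.support) : d₁ i.1.1 = 0 ∨ d₁ i.1.1 = 1 := by
    have := hΔ i
    have := hle i
    omega
  have h0 {α : Weight ℂ H L} (hα : d₁ α = 0) : d₂ α ≤ 1 := by
    have hmem : α ∈ {α | d₁ α = 0} := hα
    have h₁ := h.gr_zero
    simp only [hgr, h𝒢, ← weightSum_union, weightSum_injective.eq_iff] at h₁
    rw [h₁] at hmem
    simp only [Set.mem_union, Set.mem_ofPred_eq] at hmem
    omega
  have h1 {α : Weight ℂ H L} (hα : d₁ α = 1) : d₂ α = 0 ∨ d₂ α = 1 := by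
    have hmem : -α ∈ {α | d₁ α = -1} := by
      simp only [Set.mem_ofPred_eq, hneg hd₁, hα]
    have h₁ := h.gr_neg_one
    simp only [hgr, h𝒢, ← weightSum_union, weightSum_injective.eq_iff] at h₁
    rw [h₁] at hmem
    simp only [Set.mem_union, Set.mem_ofPred_eq, hneg hd₂] at hmem
    omega
  -- the lexicographic order gives `d₂ ≥ 0` for simple roots with `d₁ = 0`
  have hd₂' (i : Δ.support) : d₂ i.1.1 = 0 ∨ d₂ i.1.1 = 1 := by
    rcases hd₁' i with hi | hi
    · have := h0 hi
      have := hΔ i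
      omega
    · exact h1 hi
  have hS {d : Weight ℂ H L → ℤ} (h : ∀ i : Δ.support, d i.1.1 = 0 ∨ d i.1.1 = 1)
      (i : Δ.support) :
      d i.1.1 = if i ∈ Finset.univ.filter (fun j : Δ.support ↦ d j.1.1 = 1) then 1 else 0 := by
    have hmem : i ∈ Finset.univ.filter (fun j : Δ.support ↦ d j.1.1 = 1) ↔ d i.1.1 = 1 :=
      ⟨fun hi ↦ (Finset.mem_filter.1 hi).2, fun hi ↦ Finset.mem_filter.2 ⟨Finset.mem_univ _, hi⟩⟩
    rw [if_congr hmem rfl rfl]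
    rcases h i with hi | hi <;> rw [hi] <;> norm_num
  refine ⟨H, hH, Δ, Finset.univ.filter fun i : Δ.support ↦ d₁ i.1.1 = 1,
    Finset.univ.filter fun i : Δ.support ↦ d₂ i.1.1 = 1, funext fun p ↦ ?_⟩
  rw [h𝒢, ofSimpleRoots_eq_weightSum]
  congr 1
  ext α
  simp only [Set.mem_ofPred_eq]
  rw [degree_eq_of_forall hd₁ (hS hd₁'), degree_eq_of_forall hd₂ (hS hd₂')]

end Standard

end CRBigrading

theorem mainTheorem8 {L : Type*} [LieRing L] [LieAlgebra ℂ L] [FiniteDimensional ℂ L]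
    [LieAlgebra.IsSimple ℂ L] :
    (∀ 𝒢 : ℤ × ℤ → Submodule ℂ L, CRBigrading.IsAdmissible 𝒢 ↔
      ∃ (H : LieSubalgebra ℂ L) (_ : H.IsCartanSubalgebra)
        (Δ : (LieAlgebra.IsKilling.rootSystem H).Base) (S₁ S₂ : Finset Δ.support),
        CRBigrading.InTable Δ S₁ S₂ ∧ 𝒢 = CRBigrading.ofSimpleRoots Δ S₁ S₂) ∧
    (∀ (H : LieSubalgebra ℂ L) [H.IsCartanSubalgebra]
      (Δ : (LieAlgebra.IsKilling.rootSystem H).Base) (S₁ S₂ : Finset Δ.support),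
      CRBigrading.IsAdmissible (CRBigrading.ofSimpleRoots Δ S₁ S₂) ↔
        CRBigrading.InTable Δ S₁ S₂) := by
  classical
  refine ⟨fun 𝒢 ↦ ⟨fun h ↦ ?_, ?_⟩, fun H _ Δ S₁ S₂ ↦
    CRBigrading.isAdmissible_ofSimpleRoots_iff Δ S₁ S₂⟩
  · obtain ⟨H, hH, Δ, S₁, S₂, rfl⟩ := h.exists_eq_ofSimpleRoots
    exact ⟨H, hH, Δ, S₁, S₂, (CRBigrading.isAdmissible_ofSimpleRoots_iff Δ S₁ S₂).1 h, rfl⟩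
  · rintro ⟨H, hH, Δ, S₁, S₂, hT, rfl⟩
    exact (CRBigrading.isAdmissible_ofSimpleRoots_iff Δ S₁ S₂).2 hT
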